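/- An algorithm here is a fixed program for a deterministic real RAM: its memory consists of an array of natural numbers and an array of real numbers, with indirect addressing; additions, (truncated) subtractions and comparisons of natural numbers, arithmetic operations and comparisons of real numbers, and queries for the distance between two points of $X$ or two points of $Y$, given by their indices, each take one unit of time (there is no rounding operation from reals to integers). A finite metric space $S$ has doubling dimension $\delta$ if every closed ball of radius $r$ in $S$ is contained in the union of at most $2^\delta$ closed balls of radius $r/2$. Its spread is $\Phi(S)=\operatorname{diam}(S)/d_{\min}(S)$, where $d_{\min}(S)$ is the smallest distance between two distinct points; if $S$ is a single point, we set $\log\Phi(S)=0$. For $\rho\ge 1$, a $\rho$-matching from $X$ to $Y$ is a mapping $\sigma:X\to Y$ such that $\frac1\rho d_X(x,x')\le d_Y(\sigma(x),\sigma(x'))\le\rho\, d_X(x,x')$ for all $x,x'\in X$. Given finite metric spaces $X,Y$ with $|X|=k$, $|Y|=n$, $1\le k\le n$, and reals $\rho\ge1$, $0<\varepsilon\le1$, the $(\rho,\varepsilon)$-distortion problem is to return a $(1+\varepsilon)\rho$-matching from $X$ to $Y$ whenever a $\rho$-matching from $X$ to $Y$ exists; if there is no $\rho$-matching, the algorithm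 has to return either a $(1+\varepsilon)\rho$-matching or no mapping. **Theorem.** There is an algorithm that solves the $(\rho,\varepsilon)$-distortion problem for all such $X,Y,\rho,\varepsilon$, and whose running time, when $X$ and $Y$ have doubling dimension $\delta=O(1)$, is $$2^{O(k^2\log k)}\left(\frac{\rho^2}{\varepsilon}\right)^{3k\delta} n+O\bigl(kn\log\Phi(Y)\bigr).$$ That is, for every $D$ there is a constant $C$, depending only on $D$, such that for all $\delta\le D$, all $k\le n$, all $X$ and $Y$ of doubling dimension $\delta$, all $\rho\geq 1$ and all $0<\varepsilon\leq 1$ the running time is at most $$C\,2^{C k^2\log_2 k}\left(\frac{\rho^2}{\varepsilon}\right)^{3k\delta} n+C\,kn\log_2\Phi(Y).$$ -/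

import Mathlib

/-! ### Finite metric spaces and matchings -/

/-- `S` has doubling dimension (at most) `δ`: every closed ball of radius `r` is contained in the
union of at most `2 ^ δ` closed balls of radius `r / 2`. -/
def HasDoublingDimension (S : Type*) [MetricSpace S] (δ : ℝ) : Prop :=
  ∀ (x : S) (r : ℝ), ∃ T : Finset S, (T.card : ℝ) ≤ (2 : ℝ) ^ δ ∧
    Metric.closedBall x r ⊆ ⋃ t ∈ T, Metric.closedBall t (r / 2)

/-- The spread of a finite metric space: the ratio of the diameter to the smallest distance
between two distinct points (and `0 / 0 = 0` for a one-point space). -/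
noncomputable def spread (S : Type*) [MetricSpace S] : ℝ :=
  Metric.diam (Set.univ : Set S) / Set.infsep (Set.univ : Set S)

/-- `σ` is a `ρ`-matching: it distorts distances by a factor at most `ρ`. -/
def IsDistortionMatching {X Y : Type*} [MetricSpace X] [MetricSpace Y] (ρ : ℝ) (σ : X → Y) :
    Prop :=
  ∀ x x' : X, (1 / ρ) * dist x x' ≤ dist (σ x) (σ x') ∧ dist (σ x) (σ x') ≤ ρ * dist x x'

/-! ### The machine model: a real RAM with access to the two distance functions

The memory consists of an infinite array of natural numbers and an infinite array of real
numbers, with indirect addressing. Natural numbers can be added, subtracted (truncated at `0`)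
and compared; real numbers can be added, subtracted, multiplied, divided and compared.
There is no conversion from real numbers to natural numbers. Every elementary operation, and
every query for the distance between two points of `X` or of `Y`, given by their indices, costs
one unit of time. -/

namespace RealRAM

/-- The contents of the memory. -/
structure State where
  nats : ℕ → ℕ
  reals : ℕ → ℝ

/-- The distance functions of the two input spaces, as functions of indices of points. -/
structure Oracle where
  distX : ℕ → ℕ → ℝ
  distY : ℕ → ℕ → ℝ

/-- Expressions for natural numbers. -/
inductive NExpr where
  | lit (c : ℕ)
  | cell (address : NExpr)
  | add (a b : NExpr)
  | sub (a b : NExpr)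

/-- Expressions for real numbers. -/
inductive RExpr where
  | ofNat (a : NExpr)
  | cell (address : NExpr)
  | distX (i j : NExpr)
  | distY (i j : NExpr)
  | add (a b : RExpr)
  | sub (a b : RExpr)
  | mul (a b : RExpr)
  | div (a b : RExpr)

/-- Tests. -/
inductive Test where
  | natLe (a b : NExpr)
  | realLe (a b : RExpr)
  | not (b : Test)
  | and (b c : Test)

/-- Programs. -/
inductive Program where
  | skip
  | storeNat (address : NExpr) (value : NExpr)
  | storeReal (address : NExpr) (value : RExpr)
  | seq (p q : Program)
  | ite (b : Test) (p q : Program)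
  | while (b : Test) (p : Program)

/-- The value of an expression. -/
def NExpr.eval (s : State) : NExpr → ℕ
  | lit c => c
  | cell a => s.nats (a.eval s)
  | add a b => a.eval s + b.eval s
  | sub a b => a.eval s - b.eval s

/-- The time taken by the evaluation of an expression: the number of its operations. -/
def NExpr.cost : NExpr → ℕ
  | lit _ => 1
  | cell a => a.cost + 1
  | add a b => a.cost + b.cost + 1
  | sub a b => a.cost + b.cost + 1

/-- The value of an expression. -/
noncomputable def RExpr.eval (o : Oracle) (s : State) : RExpr → ℝ
  | ofNat a => (a.eval s : ℝ)
  | cell a => s.reals (a.eval s)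
  | distX i j => o.distX (i.eval s) (j.eval s)
  | distY i j => o.distY (i.eval s) (j.eval s)
  | add a b => a.eval o s + b.eval o s
  | sub a b => a.eval o s - b.eval o s
  | mul a b => a.eval o s * b.eval o s
  | div a b => a.eval o s / b.eval o s

/-- The time taken by the evaluation of an expression: the number of its operations. -/
def RExpr.cost : RExpr → ℕ
  | ofNat a => a.cost + 1
  | cell a => a.cost + 1
  | distX i j => i.cost + j.cost + 1
  | distY i j => i.cost + j.cost + 1
  | add a b => a.cost + b.cost + 1
  | sub a b => a.cost + b.cost + 1
  | mul a b => a.cost + b.cost + 1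
  | div a b => a.cost + b.cost + 1

/-- The truth value of a test. -/
def Test.Holds (o : Oracle) (s : State) : Test → Prop
  | natLe a b => a.eval s ≤ b.eval s
  | realLe a b => a.eval o s ≤ b.eval o s
  | not b => ¬ b.Holds o s
  | and b c => b.Holds o s ∧ c.Holds o s

/-- The time taken by a test. -/
def Test.cost : Test → ℕ
  | natLe a b => a.cost + b.cost + 1
  | realLe a b => a.cost + b.cost + 1
  | not b => b.cost + 1
  | and b c => b.cost + c.cost + 1

/-- `Exec o p s t s'`: started in state `s`, the program `p` halts after exactly `t` units of
time, in state `s'`. -/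
inductive Exec (o : Oracle) : Program → State → ℕ → State → Prop where
  | skip (s : State) : Exec o .skip s 1 s
  | storeNat (a v : NExpr) (s : State) :
      Exec o (.storeNat a v) s (a.cost + v.cost + 1)
        { s with nats := Function.update s.nats (a.eval s) (v.eval s) }
  | storeReal (a : NExpr) (v : RExpr) (s : State) :
      Exec o (.storeReal a v) s (a.cost + v.cost + 1)
        { s with reals := Function.update s.reals (a.eval s) (v.eval o s) }
  | seq {p q : Program} {s s' s'' : State} {t t' : ℕ} :
      Exec o p s t s' → Exec o q s' t' s'' → Exec o (.seq p q) s (t + t') s''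
  | ite_true {b : Test} {p q : Program} {s s' : State} {t : ℕ} :
      b.Holds o s → Exec o p s t s' → Exec o (.ite b p q) s (b.cost + 1 + t) s'
  | ite_false {b : Test} {p q : Program} {s s' : State} {t : ℕ} :
      ¬ b.Holds o s → Exec o q s t s' → Exec o (.ite b p q) s (b.cost + 1 + t) s'
  | while_true {b : Test} {p : Program} {s s' s'' : State} {t t' : ℕ} :
      b.Holds o s → Exec o p s t s' → Exec o (.while b p) s' t' s'' →
        Exec o (.while b p) s (b.cost + 1 + t + t') s''
  | while_false {b : Test} {p : Program} {s : State} :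
      ¬ b.Holds o s → Exec o (.while b p) s (b.cost + 1) s

end RealRAM

/-! ### The `(ρ, ε)`-distortion problem -/

/-- The distance function of a metric space whose points are listed as `e 0, …, e (m - 1)`, in
terms of indices; it returns `0` if an index is out of range. -/
noncomputable def indexedDist {S : Type*} [MetricSpace S] {m : ℕ} (e : Fin m ≃ S) (i j : ℕ) : ℝ :=
  if h : i < m ∧ j < m then dist (e ⟨i, h.1⟩) (e ⟨j, h.2⟩) else 0

/-- The initial memory: `k` and `n` are in the cells `0` and `1` for natural numbers, `ρ` and `ε`
in the cells `0` and `1` for real numbers, and all other cells contain `0`. -/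
noncomputable def initialState (k n : ℕ) (ρ ε : ℝ) : RealRAM.State where
  nats a := if a = 0 then k else if a = 1 then n else 0
  reals a := if a = 0 then ρ else if a = 1 then ε else 0

/-- The final memory reports the mapping `σ`: cell `0` contains `1`, and cell `i + 1` contains the
index of the image of the `i`-th point of `X`. -/
def ReportsMapping {X Y : Type*} {k n : ℕ} (eX : Fin k ≃ X) (eY : Fin n ≃ Y) (s : RealRAM.State)
    (σ : X → Y) : Prop :=
  s.nats 0 = 1 ∧ ∀ i : Fin k, s.nats ((i : ℕ) + 1) = (eY.symm (σ (eX i)) : ℕ)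

/-- The program `P` solves the `(ρ, ε)`-distortion problem for the spaces `X` and `Y`, whose points
are listed by `eX` and `eY`, in time at most `T`: it halts within time `T`, and either it reports a
`(1 + ε) * ρ`-matching, or no `ρ`-matching exists and it leaves `0` in cell `0`, to say that it
returns no mapping. -/
def SolvesDistortionWithin (P : RealRAM.Program) {X Y : Type*} [MetricSpace X] [MetricSpace Y]
    {k n : ℕ} (eX : Fin k ≃ X) (eY : Fin n ≃ Y) (ρ ε T : ℝ) : Prop :=
  ∃ (t : ℕ) (s : RealRAM.State),
    RealRAM.Exec ⟨indexedDist eX, indexedDist eY⟩ P (initialState k n ρ ε) t s ∧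
    (t : ℝ) ≤ T ∧
    ((∃ σ : X → Y, IsDistortionMatching ((1 + ε) * ρ) σ ∧ ReportsMapping eX eY s σ) ∨
      (s.nats 0 = 0 ∧ ¬ ∃ σ : X → Y, IsDistortionMatching ρ σ))

/-! ### An abstract machine with named arrays and immutable lists -/

/-! The algorithm grows maps along single-linkage clusters of `X`. Components start as single
points; each step merges the components of a closest pair `u`, `v` of points in different
components, at distance `d`. These distances never decrease, and after `i` merges a component has
diameter at most `(2 ^ i - 1) * d`. Each component carries a table of maps into `Y`. Every map in it
is a `(1 + ε) * ρ`-matching on the component, and every `ρ`-matching of `X` is approximated there by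
some entry, up to `i * s` with `s = ε * d / (4 * k * ρ)`.

For a merge, a net of `Y` with cells of radius at most `2 * ρ * d` sorts the maps of both components
into buckets, by the cell of the image of `u` or of `v`. In each bucket only a maximal family with
mutual supremum distance above `s` is kept. Its images lie in a ball of radius `2 * ρ * 2 ^ k * d`,
so packing leaves at most `b = (B ^ e) ^ k` maps, where `B ≤ 2 ^ δ` and `2 ^ e` is about `2 ^ (k +
4) * k * ρ ^ 2 / ε`. Thinning costs another error `s`. Over fewer than `k` merges the error stays
below `ε * d / (4 * ρ)`, and since distances between components are at least `d`, this fits into the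
slack between `ρ` and `(1 + ε) * ρ`. So the pair approximating a `ρ`-matching passes an explicit
test of all cross distances. The images of `u` and `v` are then at most `2 * ρ * d` apart, so only
`B ^ 3` neighbouring cells are searched. The new table has at most `n * b ^ 2 * B ^ 3` entries, and
comparing each with a bucket of size `b` at a later merge gives `n * b ^ 3`, whence the exponent `3
* k * δ`.

The net is obtained by halving the scale until it is near `ρ * d` or every point is a center. That
takes about `log Φ(Y)` rounds of time `O(n)`, for each of at most `k` merges. When one component is
left, any entry of its table is an answer, and an empty table excludes a `ρ`-matching. The numbers
`B`, `e`, `L`, `δ` occur only in the analysis; the program does not know them.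

The program is written in a small language with named arrays and immutable lists, and is compiled to
the real RAM with constant slowdown (`Cmd.exec_compile`). The mathematics is in
`IsDoublingConst.card_le` (packing), `IsRefining.mem_flatMap` and `wp_buildNet` (nets),
`IsThinning.length_le` (bucket sizes), `IsTable.merge` (the inductive step) and `table_bound` (the
final estimate). -/

namespace ListMachine

open RealRAM (Oracle)

/-- Names of the arrays of natural numbers. -/
inductive NVar where
  | k | n | a | b | y | pos | cnt | found | comp | img | top | cen | cen2 | go | ea | eb | ca | cb
  | c0 | a0 | off | keep | near | ok | slot | flag
  deriving DecidableEq

/-- Names of the real variables. -/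
inductive RVar where
  | rho | eps | d | t | s
  deriving DecidableEq

/-- Names of the arrays of lists. -/
inductive LVar where
  | fr | fr2 | ch | bk | tab | res | l1 | l2 | l3
  deriving DecidableEq

/-- The contents of the memory of the abstract machine. -/
structure Mem where
  N : NVar → ℕ → ℕ
  R : RVar → ℝ
  L : LVar → ℕ → List ℕ
  out : ℕ → ℕ

/-- Expressions for natural numbers. -/
inductive NE where
  | lit (c : ℕ)
  | get (v : NVar) (i : NE)
  | head (v : LVar) (i : NE)
  | add (a b : NE)
  | sub (a b : NE)

/-- A variable, stored in the first cell of its array. -/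
abbrev NE.var (v : NVar) : NE := .get v (.lit 0)

/-- The first element of a list variable. -/
abbrev NE.hd (v : LVar) : NE := .head v (.lit 0)

/-- Expressions for real numbers. -/
inductive RE where
  | ofNat (a : NE)
  | var (v : RVar)
  | dX (i j : NE)
  | dY (i j : NE)
  | add (a b : RE)
  | mul (a b : RE)
  | div (a b : RE)

/-- Expressions for lists. -/
inductive LE where
  | nil
  | get (v : LVar) (i : NE)
  | tail (v : LVar) (i : NE)

/-- Tests. -/
inductive BE where
  | leN (a b : NE)
  | leR (a b : RE)
  | isNil (v : LVar) (i : NE)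
  | not (b : BE)
  | and (b c : BE)

/-- Commands. -/
inductive Cmd where
  | skip
  | setN (v : NVar) (i x : NE)
  | setR (v : RVar) (x : RE)
  | setL (v : LVar) (i : NE) (l : LE)
  | cons (v : LVar) (i x : NE) (l : LE)
  | out (i x : NE)
  | seq (p q : Cmd)
  | ite (b : BE) (p q : Cmd)
  | while (b : BE) (p : Cmd)

/-- Assignment to a variable for natural numbers. -/
abbrev Cmd.put (v : NVar) (x : NE) : Cmd := .setN v (.lit 0) x

/-- Sequential execution of a list of commands. -/
def Cmd.blk : List Cmd → Cmd
  | [] => .skip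
  | c :: l => .seq c (Cmd.blk l)

namespace Mem

/-- Assignment to a cell for natural numbers. -/
def setN (m : Mem) (v : NVar) (i x : ℕ) : Mem :=
  { m with N := Function.update m.N v (Function.update (m.N v) i x) }

/-- Assignment to a real variable. -/
def setR (m : Mem) (v : RVar) (x : ℝ) : Mem :=
  { m with R := Function.update m.R v x }

/-- Assignment to a cell for lists. -/
def setL (m : Mem) (v : LVar) (i : ℕ) (l : List ℕ) : Mem :=
  { m with L := Function.update m.L v (Function.update (m.L v) i l) }

/-- Assignment to an output cell. -/
def setOut (m : Mem) (i x : ℕ) : Mem :=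
  { m with out := Function.update m.out i x }

variable (m : Mem) (v w : NVar) (r r' : RVar) (u u' : LVar) (i x : ℕ) (z : ℝ) (l : List ℕ)

@[simp] lemma N_setN_self : (m.setN v i x).N v = Function.update (m.N v) i x := by simp [setN]
@[simp] lemma N_setN_ne {v w : NVar} (h : w ≠ v) : (m.setN v i x).N w = m.N w := by
  simp [setN, h]
@[simp] lemma R_setN : (m.setN v i x).R = m.R := rfl
@[simp] lemma L_setN : (m.setN v i x).L = m.L := rfl
@[simp] lemma out_setN : (m.setN v i x).out = m.out := rfl
@[simp] lemma R_setR_self : (m.setR r z).R r = z := by simp [setR]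
@[simp] lemma R_setR_ne {r r' : RVar} (h : r' ≠ r) : (m.setR r z).R r' = m.R r' := by
  simp [setR, h]
@[simp] lemma N_setR : (m.setR r z).N = m.N := rfl
@[simp] lemma L_setR : (m.setR r z).L = m.L := rfl
@[simp] lemma out_setR : (m.setR r z).out = m.out := rfl
@[simp] lemma L_setL_self : (m.setL u i l).L u = Function.update (m.L u) i l := by simp [setL]
@[simp] lemma L_setL_ne {u u' : LVar} (h : u' ≠ u) : (m.setL u i l).L u' = m.L u' := by
  simp [setL, h]
@[simp] lemma N_setL : (m.setL u i l).N = m.N := rfl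
@[simp] lemma R_setL : (m.setL u i l).R = m.R := rfl
@[simp] lemma out_setL : (m.setL u i l).out = m.out := rfl
@[simp] lemma N_setOut : (m.setOut i x).N = m.N := rfl
@[simp] lemma R_setOut : (m.setOut i x).R = m.R := rfl
@[simp] lemma L_setOut : (m.setOut i x).L = m.L := rfl
@[simp] lemma out_setOut : (m.setOut i x).out = Function.update m.out i x := rfl

end Mem

/-- The value of an expression. -/
@[simp] def NE.eval (m : Mem) : NE → ℕ
  | lit c => c
  | get v i => m.N v (i.eval m)
  | head v i => (m.L v (i.eval m)).headD 0
  | add a b => a.eval m + b.eval m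
  | sub a b => a.eval m - b.eval m

/-- The value of an expression. -/
@[simp] noncomputable def RE.eval (o : Oracle) (m : Mem) : RE → ℝ
  | ofNat a => (a.eval m : ℝ)
  | var v => m.R v
  | dX i j => o.distX (i.eval m) (j.eval m)
  | dY i j => o.distY (i.eval m) (j.eval m)
  | add a b => a.eval o m + b.eval o m
  | mul a b => a.eval o m * b.eval o m
  | div a b => a.eval o m / b.eval o m

/-- The value of an expression. -/
@[simp] def LE.eval (m : Mem) : LE → List ℕ
  | nil => []
  | get v i => m.L v (i.eval m)
  | tail v i => (m.L v (i.eval m)).tail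

/-- The truth value of a test. -/
@[simp] def BE.Holds (o : Oracle) (m : Mem) : BE → Prop
  | leN a b => a.eval m ≤ b.eval m
  | leR a b => a.eval o m ≤ b.eval o m
  | isNil v i => m.L v (i.eval m) = []
  | not b => ¬ b.Holds o m
  | and b c => b.Holds o m ∧ c.Holds o m

/-- `Run o q p m t m'`: started in `m`, the command `p` halts after exactly `t` units of
time in `m'`. The output cells are those with index less than `q`. -/
inductive Run (o : Oracle) (q : ℕ) : Cmd → Mem → ℕ → Mem → Prop where
  | skip (m : Mem) : Run o q .skip m 1 m
  | setN (v : NVar) (i x : NE) (m : Mem) :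
      Run o q (.setN v i x) m 1 (m.setN v (i.eval m) (x.eval m))
  | setR (v : RVar) (x : RE) (m : Mem) : Run o q (.setR v x) m 1 (m.setR v (x.eval o m))
  | setL (v : LVar) (i : NE) (l : LE) (m : Mem) :
      Run o q (.setL v i l) m 1 (m.setL v (i.eval m) (l.eval m))
  | cons (v : LVar) (i x : NE) (l : LE) (m : Mem) :
      Run o q (.cons v i x l) m 1 (m.setL v (i.eval m) (x.eval m :: l.eval m))
  | out (i x : NE) (m : Mem) (h : i.eval m < q) :
      Run o q (.out i x) m 1 (m.setOut (i.eval m) (x.eval m))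
  | seq {c c' : Cmd} {m m' m'' : Mem} {t t' : ℕ} :
      Run o q c m t m' → Run o q c' m' t' m'' → Run o q (.seq c c') m (t + t') m''
  | ite_true {b : BE} {c c' : Cmd} {m m' : Mem} {t : ℕ} :
      b.Holds o m → Run o q c m t m' → Run o q (.ite b c c') m (1 + t) m'
  | ite_false {b : BE} {c c' : Cmd} {m m' : Mem} {t : ℕ} :
      ¬ b.Holds o m → Run o q c' m t m' → Run o q (.ite b c c') m (1 + t) m'
  | while_true {b : BE} {c : Cmd} {m m' m'' : Mem} {t t' : ℕ} :
      b.Holds o m → Run o q c m t m' → Run o q (.while b c) m' t' m'' →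
        Run o q (.while b c) m (1 + t + t') m''
  | while_false {b : BE} {c : Cmd} {m : Mem} :
      ¬ b.Holds o m → Run o q (.while b c) m 1 m

/-! ### Frames -/

/-- Whether a command may write to an array of natural numbers. -/
def Cmd.writesN : Cmd → NVar → Bool
  | setN v _ _, w => v == w
  | seq p q, w => p.writesN w || q.writesN w
  | ite _ p q, w => p.writesN w || q.writesN w
  | .while _ p, w => p.writesN w
  | _, _ => false

/-- Whether a command may write to a real variable. -/
def Cmd.writesR : Cmd → RVar → Bool
  | setR v _, w => v == w
  | seq p q, w => p.writesR w || q.writesR w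
  | ite _ p q, w => p.writesR w || q.writesR w
  | .while _ p, w => p.writesR w
  | _, _ => false

/-- Whether a command may write to an array of lists. -/
def Cmd.writesL : Cmd → LVar → Bool
  | setL v _ _, w => v == w
  | cons v _ _ _, w => v == w
  | seq p q, w => p.writesL w || q.writesL w
  | ite _ p q, w => p.writesL w || q.writesL w
  | .while _ p, w => p.writesL w
  | _, _ => false

/-- The two memories agree wherever `c` cannot write. -/
structure SameOff (c : Cmd) (m m' : Mem) : Prop where
  N : ∀ v, c.writesN v = false → m'.N v = m.N v
  R : ∀ v, c.writesR v = false → m'.R v = m.R v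
  L : ∀ v, c.writesL v = false → m'.L v = m.L v

lemma SameOff.refl (c : Cmd) (m : Mem) : SameOff c m m :=
  ⟨fun _ _ => rfl, fun _ _ => rfl, fun _ _ => rfl⟩

lemma SameOff.trans {c : Cmd} {m m' m'' : Mem} (h : SameOff c m m') (h' : SameOff c m' m'') :
    SameOff c m m'' :=
  ⟨fun v hv => (h'.N v hv).trans (h.N v hv), fun v hv => (h'.R v hv).trans (h.R v hv),
    fun v hv => (h'.L v hv).trans (h.L v hv)⟩

lemma SameOff.mono {c c' : Cmd} {m m' : Mem} (h : SameOff c m m')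
    (hN : ∀ v, c'.writesN v = false → c.writesN v = false)
    (hR : ∀ v, c'.writesR v = false → c.writesR v = false)
    (hL : ∀ v, c'.writesL v = false → c.writesL v = false) : SameOff c' m m' :=
  ⟨fun v hv => h.N v (hN v hv), fun v hv => h.R v (hR v hv), fun v hv => h.L v (hL v hv)⟩

variable {o : Oracle} {q : ℕ}

/-- The frame is syntactic and Boolean, so for a concrete command its side conditions are closed by
`rfl`. All later proofs carry facts past a command in this way. -/
lemma Run.sameOff {c : Cmd} {m m' : Mem} {t : ℕ} (h : Run o q c m t m') : SameOff c m m' := by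
  induction h with
  | skip m => exact .refl _ _
  | setN v i x m =>
    refine ⟨fun w hw => ?_, fun _ _ => rfl, fun _ _ => rfl⟩
    have : w ≠ v := by rintro rfl; simp [Cmd.writesN] at hw
    simp [this]
  | setR v x m =>
    refine ⟨fun _ _ => rfl, fun w hw => ?_, fun _ _ => rfl⟩
    have : w ≠ v := by rintro rfl; simp [Cmd.writesR] at hw
    simp [this]
  | setL v i l m =>
    refine ⟨fun _ _ => rfl, fun _ _ => rfl, fun w hw => ?_⟩
    have : w ≠ v := by rintro rfl; simp [Cmd.writesL] at hw
    simp [this]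
  | cons v i x l m =>
    refine ⟨fun _ _ => rfl, fun _ _ => rfl, fun w hw => ?_⟩
    have : w ≠ v := by rintro rfl; simp [Cmd.writesL] at hw
    simp [this]
  | out i x m h => exact ⟨fun _ _ => rfl, fun _ _ => rfl, fun _ _ => rfl⟩
  | seq h₁ h₂ ih₁ ih₂ =>
    exact (ih₁.mono (by simp +contextual [Cmd.writesN]) (by simp +contextual [Cmd.writesR])
      (by simp +contextual [Cmd.writesL])).trans
      (ih₂.mono (by simp +contextual [Cmd.writesN]) (by simp +contextual [Cmd.writesR])
      (by simp +contextual [Cmd.writesL]))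
  | ite_true hb h ih =>
    exact ih.mono (by simp +contextual [Cmd.writesN]) (by simp +contextual [Cmd.writesR])
      (by simp +contextual [Cmd.writesL])
  | ite_false hb h ih =>
    exact ih.mono (by simp +contextual [Cmd.writesN]) (by simp +contextual [Cmd.writesR])
      (by simp +contextual [Cmd.writesL])
  | while_true hb h₁ h₂ ih₁ ih₂ =>
    exact (ih₁.mono (by simp [Cmd.writesN]) (by simp [Cmd.writesR])
      (by simp [Cmd.writesL])).trans ih₂
  | while_false hb => exact .refl _ _

/-! ### Total correctness with running times -/

/-- The command `c`, started in `m`, halts, and its running time and the final memory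
satisfy `Q`. -/
def wp (o : Oracle) (q : ℕ) (c : Cmd) (m : Mem) (Q : ℕ → Mem → Prop) : Prop :=
  ∃ t m', Run o q c m t m' ∧ Q t m'

/-- The continuation receives `SameOff`, so specifications need not list what a command leaves
alone. -/
lemma wp.mono {c : Cmd} {m : Mem} {Q Q' : ℕ → Mem → Prop} (h : wp o q c m Q)
    (hQ : ∀ t m', SameOff c m m' → Q t m' → Q' t m') : wp o q c m Q' := by
  obtain ⟨t, m', h, hq⟩ := h
  exact ⟨t, m', h, hQ t m' h.sameOff hq⟩

variable {m : Mem} {Q : ℕ → Mem → Prop}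

@[simp] lemma wp_skip : wp o q .skip m Q ↔ Q 1 m :=
  ⟨by rintro ⟨t, m', ⟨⟩, h⟩; exact h, fun h => ⟨_, _, .skip m, h⟩⟩

@[simp] lemma wp_setN {v : NVar} {i x : NE} :
    wp o q (.setN v i x) m Q ↔ Q 1 (m.setN v (i.eval m) (x.eval m)) :=
  ⟨by rintro ⟨t, m', ⟨⟩, h⟩; exact h, fun h => ⟨_, _, .setN _ _ _ _, h⟩⟩

@[simp] lemma wp_setR {v : RVar} {x : RE} :
    wp o q (.setR v x) m Q ↔ Q 1 (m.setR v (x.eval o m)) :=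
  ⟨by rintro ⟨t, m', ⟨⟩, h⟩; exact h, fun h => ⟨_, _, .setR _ _ _, h⟩⟩

@[simp] lemma wp_setL {v : LVar} {i : NE} {l : LE} :
    wp o q (.setL v i l) m Q ↔ Q 1 (m.setL v (i.eval m) (l.eval m)) :=
  ⟨by rintro ⟨t, m', ⟨⟩, h⟩; exact h, fun h => ⟨_, _, .setL _ _ _ _, h⟩⟩

@[simp] lemma wp_cons {v : LVar} {i x : NE} {l : LE} :
    wp o q (.cons v i x l) m Q ↔ Q 1 (m.setL v (i.eval m) (x.eval m :: l.eval m)) :=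
  ⟨by rintro ⟨t, m', ⟨⟩, h⟩; exact h, fun h => ⟨_, _, .cons _ _ _ _ _, h⟩⟩

@[simp] lemma wp_out {i x : NE} :
    wp o q (.out i x) m Q ↔ i.eval m < q ∧ Q 1 (m.setOut (i.eval m) (x.eval m)) := by
  constructor
  · rintro ⟨t, m', h, hq⟩
    cases h with
    | out _ _ _ h => exact ⟨h, hq⟩
  · exact fun h => ⟨_, _, .out _ _ _ h.1, h.2⟩

@[simp] lemma wp_seq {c c' : Cmd} :
    wp o q (.seq c c') m Q ↔ wp o q c m fun t m' => wp o q c' m' fun t' => Q (t + t') := by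
  constructor
  · rintro ⟨t, m', h, hq⟩
    cases h with
    | seq h₁ h₂ => exact ⟨_, _, h₁, _, _, h₂, hq⟩
  · rintro ⟨_, _, h₁, _, _, h₂, hq⟩
    exact ⟨_, _, .seq h₁ h₂, hq⟩

@[simp] lemma wp_ite {b : BE} {c c' : Cmd} :
    wp o q (.ite b c c') m Q ↔
      (b.Holds o m → wp o q c m fun t => Q (1 + t)) ∧
        (¬ b.Holds o m → wp o q c' m fun t => Q (1 + t)) := by
  constructor
  · rintro ⟨t, m', h, hq⟩
    cases h with
    | ite_true hb h => exact ⟨fun _ => ⟨_, _, h, hq⟩, fun hb' => absurd hb hb'⟩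
    | ite_false hb h => exact ⟨fun hb' => absurd hb' hb, fun _ => ⟨_, _, h, hq⟩⟩
  · rintro ⟨h₁, h₂⟩
    by_cases hb : b.Holds o m
    · obtain ⟨t, m', h, hq⟩ := h₁ hb
      exact ⟨_, _, .ite_true hb h, hq⟩
    · obtain ⟨t, m', h, hq⟩ := h₂ hb
      exact ⟨_, _, .ite_false hb h, hq⟩

@[simp] lemma wp_blk_nil : wp o q (.blk []) m Q ↔ Q 1 m := wp_skip

@[simp] lemma wp_blk_cons {c : Cmd} {l : List Cmd} :
    wp o q (.blk (c :: l)) m Q ↔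
      wp o q c m fun t m' => wp o q (.blk l) m' fun t' => Q (t + t') := wp_seq

/-- A loop with at most `L` iterations, each of which takes time at most `T`. -/
lemma wp_while {b : BE} {c : Cmd} {m : Mem} (I : ℕ → Mem → Prop) (L T : ℕ) (h₀ : I 0 m)
    (step : ∀ i m', SameOff c m m' → I i m' → b.Holds o m' →
      i < L ∧ wp o q c m' fun t m'' => t ≤ T ∧ I (i + 1) m'') :
    wp o q (.while b c) m fun t m' => t ≤ L * (T + 1) + 1 ∧ ¬ b.Holds o m' ∧ ∃ i, I i m' := by
  -- Induction on the number `j` of remaining iterations. Termination comes from `i < L`, which each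
  -- step has to supply.
  suffices H : ∀ j i m', i + j = L → SameOff c m m' → I i m' →
      wp o q (.while b c) m' fun t m'' => t ≤ j * (T + 1) + 1 ∧ ¬ b.Holds o m'' ∧ ∃ i, I i m'' from
    H L 0 m (zero_add L) (.refl _ _) h₀
  intro j
  induction j with
  | zero =>
    intro i m' hi hs hI
    by_cases hb : b.Holds o m'
    · have := (step i m' hs hI hb).1
      omega
    · exact ⟨_, _, .while_false hb, by omega, hb, i, hI⟩
  | succ j ih =>
    intro i m' hi hs hI
    by_cases hb : b.Holds o m'
    · obtain ⟨-, t, m₁, hr, ht, hI'⟩ := step i m' hs hI hb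
      obtain ⟨t', m₂, hr', ht', h⟩ := ih (i + 1) m₁ (by omega) (hs.trans hr.sameOff) hI'
      exact ⟨_, _, .while_true hb hr hr', by rw [add_mul]; omega, h⟩
    · exact ⟨_, _, .while_false hb, by omega, hb, i, hI⟩

/-- The loop in which `v` runs from `lo` to `hi`, with `hi` excluded. -/
def Cmd.forTo (v : NVar) (lo hi : NE) (c : Cmd) : Cmd :=
  .seq (.put v lo) (.while (.leN (.add (.var v) (.lit 1)) hi)
    (.seq c (.put v (.add (.var v) (.lit 1)))))

/-- The test evaluates `hi` anew in each round, so `hb` asks that its value survive everything the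
loop may write. The invariant is required once the counter has been set, which explains the write in
the conclusion of `step`. -/
lemma wp_forTo {v : NVar} {lo hi : NE} {c : Cmd} {m : Mem} (I : ℕ → Mem → Prop) (a b T : ℕ)
    (hv : c.writesN v = false) (ha : lo.eval m = a)
    (hb : ∀ m', SameOff (.forTo v lo hi c) m m' → hi.eval m' = b) (hab : a ≤ b)
    (h₀ : I a (m.setN v 0 a))
    (step : ∀ i m', SameOff (.forTo v lo hi c) m m' → a ≤ i → i < b → m'.N v 0 = i → I i m' →
      wp o q c m' fun t m'' => t ≤ T ∧ I (i + 1) (m''.setN v 0 (i + 1))) :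
    wp o q (.forTo v lo hi c) m fun t m' => t ≤ (b - a) * (T + 2) + 2 ∧ I b m' := by
  rw [Cmd.forTo, wp_seq, wp_setN]
  have h1 : SameOff (.forTo v lo hi c) m (m.setN v 0 a) :=
    (Run.setN (o := o) (q := q) v (.lit 0) (.lit a) m).sameOff.mono
      (by simp +contextual [Cmd.writesN, Cmd.forTo]) (by simp +contextual [Cmd.writesR])
      (by simp +contextual [Cmd.writesL])
  simp only [NE.eval, ha]
  refine (wp_while (fun i m' => m'.N v 0 = a + i ∧ a + i ≤ b ∧ I (a + i) m') (b - a) (T + 1)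
    (by simpa using ⟨hab, h₀⟩) ?_).mono ?_
  · rintro i m' hs ⟨hvi, hib, hI⟩ hlt
    have hs' : SameOff (.forTo v lo hi c) m m' := h1.trans (hs.mono
      (by simp +contextual [Cmd.writesN, Cmd.forTo]) (by simp +contextual [Cmd.writesR, Cmd.forTo])
      (by simp +contextual [Cmd.writesL, Cmd.forTo]))
    have hlt' : a + i < b := by
      simpa [hvi, hb m' hs', Nat.succ_le_iff] using hlt
    refine ⟨by omega, ?_⟩
    rw [wp_seq]
    refine (step (a + i) m' hs' (by omega) hlt' hvi hI).mono ?_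
    rintro t m'' hs'' ⟨ht, hI'⟩
    have : m''.N v 0 = a + i := by rw [hs''.N v hv, hvi]
    simp only [wp_setN, NE.eval, this]
    refine ⟨by omega, by simp [add_assoc], by omega, by simpa [add_assoc] using hI'⟩
  · rintro t m' hs ⟨ht, hb', i, hvi, hib, hI⟩
    have hs' : SameOff (.forTo v lo hi c) m m' := h1.trans (hs.mono
      (by simp +contextual [Cmd.writesN, Cmd.forTo]) (by simp +contextual [Cmd.writesR, Cmd.forTo])
      (by simp +contextual [Cmd.writesL, Cmd.forTo]))
    have : a + i = b := by
      have : ¬ (a + i + 1 ≤ b) := by simpa [hvi, hb m' hs'] using hb'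
      omega
    rw [this] at hI
    exact ⟨by have : (b - a) * (T + 1 + 1) = (b - a) * (T + 2) := rfl; omega, hI⟩

/-- The loop in which the first element of `v` runs through the list `x`. -/
def Cmd.forIn (v : LVar) (x : LE) (c : Cmd) : Cmd :=
  .seq (.setL v (.lit 0) x) (.while (.not (.isNil v (.lit 0)))
    (.seq c (.setL v (.lit 0) (.tail v (.lit 0)))))

/-- The invariant refers to the prefix already processed. The list is copied to `v` at the start and
lists are immutable, so the body may overwrite the variable from which it was read. -/
lemma wp_forIn {v : LVar} {x : LE} {c : Cmd} {m : Mem} (I : List ℕ → Mem → Prop) (T : ℕ)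
    (hv : c.writesL v = false) (l : List ℕ) (hl : x.eval m = l)
    (h₀ : I [] (m.setL v 0 l))
    (step : ∀ l₁ y l₂ m', l = l₁ ++ y :: l₂ → SameOff (.forIn v x c) m m' →
      m'.L v 0 = y :: l₂ → I l₁ m' →
      wp o q c m' fun t m'' => t ≤ T ∧ I (l₁ ++ [y]) (m''.setL v 0 l₂)) :
    wp o q (.forIn v x c) m fun t m' => t ≤ l.length * (T + 2) + 2 ∧ I l m' := by
  rw [Cmd.forIn, wp_seq, wp_setL]
  have h1 : SameOff (.forIn v x c) m (m.setL v 0 l) := by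
    rw [← hl]
    exact (Run.setL (o := o) (q := q) v (.lit 0) x m).sameOff.mono
      (by simp +contextual [Cmd.writesN]) (by simp +contextual [Cmd.writesR])
      (by simp +contextual [Cmd.writesL, Cmd.forIn])
  simp only [NE.eval, hl]
  refine (wp_while (fun i m' => ∃ l₁ l₂, l = l₁ ++ l₂ ∧ l₁.length = i ∧ m'.L v 0 = l₂ ∧ I l₁ m')
    l.length (T + 1) ⟨[], l, by simp, rfl, by simp, h₀⟩ ?_).mono ?_
  · rintro i m' hs ⟨l₁, l₂, hl', rfl, hv', hI⟩ hne
    have hs' : SameOff (.forIn v x c) m m' := h1.trans (hs.mono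
      (by simp +contextual [Cmd.writesN, Cmd.forIn]) (by simp +contextual [Cmd.writesR, Cmd.forIn])
      (by simp +contextual [Cmd.writesL, Cmd.forIn]))
    cases l₂ with
    | nil => exact absurd hv' hne
    | cons y l₂ =>
      refine ⟨by simp [hl'], ?_⟩
      rw [wp_seq]
      refine (step l₁ y l₂ m' hl' hs' hv' hI).mono ?_
      rintro t m'' hs'' ⟨ht, hI'⟩
      have : m''.L v 0 = y :: l₂ := by rw [hs''.L v hv, hv']
      simp only [wp_setL, NE.eval, LE.eval, this, List.tail_cons]
      exact ⟨by omega, l₁ ++ [y], l₂, by simp [hl'], by simp, by simp, hI'⟩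
  · rintro t m' - ⟨ht, hb, i, l₁, l₂, rfl, -, hv', hI⟩
    have : l₂ = [] := by simpa [hv'] using hb
    subst this
    simp only [List.append_nil] at ht ⊢
    exact ⟨by have : l₁.length * (T + 1 + 1) = l₁.length * (T + 2) := rfl; omega, hI⟩

end ListMachine

namespace ListMachine

open RealRAM (Oracle State NExpr RExpr Test Program Exec)

/-! ### Compilation to the real RAM

The cell `0` holds a base address; the arrays are interleaved behind it. Lists are stored in a
heap of pairs, which are never modified. -/

/-- The offset of an array of natural numbers. -/
def NVar.idx (v : NVar) : ℕ := v.ctorIdx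

/-- The offset of an array of lists. -/
def LVar.idx (v : LVar) : ℕ := 32 + v.ctorIdx

/-- The address of a real variable. -/
def RVar.idx : RVar → ℕ
  | rho => 0 | eps => 1 | d => 2 | t => 3 | s => 4

lemma NVar.idx_lt (v : NVar) : v.idx < 32 := by cases v <;> decide

lemma LVar.idx_ge (v : LVar) : 32 ≤ v.idx := Nat.le_add_right _ _

lemma LVar.idx_lt (v : LVar) : v.idx < 60 := by cases v <;> decide

lemma NVar.idx_injective : Function.Injective NVar.idx := by
  intro v w h
  cases v <;> cases w <;> first | rfl | exact absurd h (by decide)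

lemma LVar.idx_injective : Function.Injective LVar.idx := by
  intro v w h
  cases v <;> cases w <;> first | rfl | exact absurd h (by decide)

lemma RVar.idx_injective : Function.Injective RVar.idx := by
  intro v w h
  cases v <;> cases w <;> first | rfl | exact absurd h (by decide)

/-- The expression for a multiple. -/
def scale : ℕ → NExpr → NExpr
  | 0, _ => .lit 0
  | c + 1, e => .add (scale c e) e

lemma scale_eval (s : State) (c : ℕ) (e : NExpr) : (scale c e).eval s = c * e.eval s := by
  induction c with
  | zero => simp [scale, NExpr.eval]
  | succ c ih => simp [scale, NExpr.eval, ih, add_mul]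

/-- The expression for the address of the cell with index `i` in the array with offset `j`. -/
def addr (i : NExpr) (j : ℕ) : NExpr := .add (.cell (.lit 0)) (.add (scale 64 i) (.lit j))

/-- The content of the cell with index `i` in the array with offset `j`. -/
def phys (s : State) (i j : ℕ) : ℕ := s.nats (s.nats 0 + (64 * i + j))

/-- The state after writing to the cell with index `i` in the array with offset `j`. -/
def State.write (s : State) (i j x : ℕ) : State :=
  { s with nats := Function.update s.nats (s.nats 0 + (64 * i + j)) x }

lemma addr_eval (s : State) (i : NExpr) (j : ℕ) :
    (addr i j).eval s = s.nats 0 + (64 * i.eval s + j) := by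
  simp [addr, NExpr.eval, scale_eval]

lemma cell_addr_eval (s : State) (i : NExpr) (j : ℕ) :
    (NExpr.cell (addr i j)).eval s = phys s (i.eval s) j := by
  simp [NExpr.eval, addr_eval, phys]

/-- Compilation of expressions. -/
def NE.compile : NE → NExpr
  | lit c => .lit c
  | get v i => .cell (addr i.compile v.idx)
  | head v i => .cell (addr (.cell (addr i.compile v.idx)) 60)
  | add a b => .add a.compile b.compile
  | sub a b => .sub a.compile b.compile

/-- Compilation of expressions. -/
def RE.compile : RE → RExpr
  | ofNat a => .ofNat a.compile
  | var v => .cell (.lit v.idx)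
  | dX i j => .distX i.compile j.compile
  | dY i j => .distY i.compile j.compile
  | add a b => .add a.compile b.compile
  | mul a b => .mul a.compile b.compile
  | div a b => .div a.compile b.compile

/-- Compilation of list expressions to pointers. -/
def LE.compile : LE → NExpr
  | nil => .lit 0
  | get v i => .cell (addr i.compile v.idx)
  | tail v i => .cell (addr (.cell (addr i.compile v.idx)) 61)

/-- Compilation of tests. -/
def BE.compile : BE → Test
  | leN a b => .natLe a.compile b.compile
  | leR a b => .realLe a.compile b.compile
  | isNil v i => .natLe (.cell (addr i.compile v.idx)) (.lit 0)
  | not b => .not b.compile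
  | and b c => .and b.compile c.compile

/-- The first free cell of the heap. -/
def free : NExpr := .cell (addr (.lit 0) 62)

/-- Compilation of commands. -/
def Cmd.compile : Cmd → Program
  | skip => .skip
  | setN v i x => .storeNat (addr i.compile v.idx) x.compile
  | setR v x => .storeReal (.lit v.idx) x.compile
  | setL v i l => .storeNat (addr i.compile v.idx) l.compile
  | cons v i x l =>
      .seq (.storeNat (addr free 60) x.compile) (.seq (.storeNat (addr free 61) l.compile)
        (.seq (.storeNat (addr i.compile v.idx) free)
          (.storeNat (addr (.lit 0) 62) (.add free (.lit 1)))))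
  | out i x => .storeNat (.add i.compile (.lit 1)) x.compile
  | seq p q => .seq p.compile q.compile
  | ite b p q => .ite b.compile p.compile q.compile
  | .while b p => .while b.compile p.compile

/-- A pointer `h` represents a list, in a heap of size `al`. -/
def Chain (vl nx : ℕ → ℕ) (al : ℕ) : ℕ → List ℕ → Prop
  | h, [] => h = 0
  | h, x :: l => h ≠ 0 ∧ h < al ∧ vl h = x ∧ Chain vl nx al (nx h) l

/-- Heap cells below the old limit are never rewritten, so allocation preserves every list and lists
may share tails. -/
lemma Chain.mono {vl nx vl' nx' : ℕ → ℕ} {al al' : ℕ} (hal : al ≤ al')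
    (hv : ∀ x < al, vl' x = vl x) (hn : ∀ x < al, nx' x = nx x) {l : List ℕ} :
    ∀ {h : ℕ}, Chain vl nx al h l → Chain vl' nx' al' h l := by
  induction l with
  | nil => exact id
  | cons x l ih =>
    rintro h ⟨h0, hlt, hx, hc⟩
    exact ⟨h0, hlt.trans_le hal, by rw [hv _ hlt, hx], by rw [hn _ hlt]; exact ih hc⟩

/-- The state `s` of the real RAM represents the memory `m`. -/
structure Rel (q : ℕ) (m : Mem) (s : State) : Prop where
  base : s.nats 0 = q + 1
  nat : ∀ v i, phys s i v.idx = m.N v i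
  real : ∀ v, s.reals v.idx = m.R v
  free_pos : 1 ≤ phys s 0 62
  val_zero : phys s 0 60 = 0
  next_zero : phys s 0 61 = 0
  list : ∀ v i, Chain (phys s · 60) (phys s · 61) (phys s 0 62) (phys s i v.idx) (m.L v i)
  out : ∀ i < q, s.nats (i + 1) = m.out i

variable {o : Oracle} {q : ℕ} {m : Mem} {s : State}

lemma write_nats_le {q : ℕ} (hs : s.nats 0 = q + 1) (i j x : ℕ) {a : ℕ} (ha : a ≤ q) :
    (State.write s i j x).nats a = s.nats a := by
  simp only [State.write]
  rw [Function.update_of_ne]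
  omega

/-- Offsets are smaller than the stride 64, so `64 * i + j` determines both `i` and `j`: the
interleaved arrays do not overlap. -/
lemma phys_write {q : ℕ} (hs : s.nats 0 = q + 1) (i j x : ℕ) (hj : j < 64) (i' j' : ℕ)
    (hj' : j' < 64) :
    phys (State.write s i j x) i' j' = if i' = i ∧ j' = j then x else phys s i' j' := by
  rw [phys, write_nats_le hs i j x (Nat.zero_le _)]
  simp only [State.write, phys, Function.update_apply]
  congr 1
  apply propext
  constructor
  · intro h
    constructor <;> omega
  · rintro ⟨rfl, rfl⟩
    rfl

namespace Rel

/-- The empty list is the pointer `0`, and the reserved heap cell `0` holds value and successor `0`.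
Hence head and tail of the empty list take their default values without a test. -/
lemma head_eval (h : Rel q m s) (v : LVar) (i : ℕ) :
    phys s (phys s i v.idx) 60 = (m.L v i).headD 0 := by
  have := h.list v i
  cases hl : m.L v i with
  | nil =>
    rw [hl] at this
    rw [show phys s i v.idx = 0 from this, h.val_zero]
    rfl
  | cons x l =>
    rw [hl] at this
    exact this.2.2.1

lemma nexpr (h : Rel q m s) (e : NE) : e.compile.eval s = e.eval m := by
  induction e with
  | lit c => rfl
  | get v i ih => rw [NE.compile, cell_addr_eval, ih, h.nat]; rfl
  | head v i ih => rw [NE.compile, cell_addr_eval, cell_addr_eval, ih, h.head_eval]; rfl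
  | add a b iha ihb => simp [NE.compile, NExpr.eval, iha, ihb]
  | sub a b iha ihb => simp [NE.compile, NExpr.eval, iha, ihb]

lemma rexpr (h : Rel q m s) (e : RE) : e.compile.eval o s = e.eval o m := by
  induction e with
  | ofNat a => simp [RE.compile, RExpr.eval, h.nexpr]
  | var v => simp [RE.compile, RExpr.eval, NExpr.eval, h.real]
  | dX i j => simp [RE.compile, RExpr.eval, h.nexpr]
  | dY i j => simp [RE.compile, RExpr.eval, h.nexpr]
  | add a b iha ihb => simp [RE.compile, RExpr.eval, iha, ihb]
  | mul a b iha ihb => simp [RE.compile, RExpr.eval, iha, ihb]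
  | div a b iha ihb => simp [RE.compile, RExpr.eval, iha, ihb]

lemma lexpr (h : Rel q m s) (e : LE) :
    Chain (phys s · 60) (phys s · 61) (phys s 0 62) (e.compile.eval s) (e.eval m) := by
  cases e with
  | nil => rfl
  | get v i =>
    rw [LE.compile, cell_addr_eval, h.nexpr]
    exact h.list v _
  | tail v i =>
    rw [LE.compile, cell_addr_eval, cell_addr_eval, h.nexpr, LE.eval]
    have := h.list v (i.eval m)
    cases hl : m.L v (i.eval m) with
    | nil =>
      rw [hl] at this
      rw [show phys s (i.eval m) v.idx = 0 from this, h.next_zero]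
      rfl
    | cons x l =>
      rw [hl] at this
      exact this.2.2.2

lemma test (h : Rel q m s) (b : BE) : b.compile.Holds o s ↔ b.Holds o m := by
  induction b with
  | leN a b => simp [BE.compile, Test.Holds, h.nexpr]
  | leR a b => simp [BE.compile, Test.Holds, h.rexpr]
  | isNil v i =>
    rw [BE.compile, Test.Holds, cell_addr_eval, h.nexpr, NExpr.eval, BE.Holds]
    have := h.list v (i.eval m)
    cases hl : m.L v (i.eval m) with
    | nil =>
      rw [hl] at this
      simp [show phys s (i.eval m) v.idx = 0 from this]
    | cons x l =>
      rw [hl] at this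
      simpa using this.1
  | not b ih => simp [BE.compile, Test.Holds, ih]
  | and b c ihb ihc => simp [BE.compile, Test.Holds, ihb, ihc]

lemma write_nat (h : Rel q m s) (v : NVar) (i x : ℕ) :
    Rel q (m.setN v i x) (State.write s i v.idx x) := by
  have hv := v.idx_lt
  have hw : ∀ i' j', j' < 64 → j' ≠ v.idx →
      phys (State.write s i v.idx x) i' j' = phys s i' j' := fun i' j' h1 h2 => by
    rw [phys_write h.base _ _ _ (by omega) _ _ h1, if_neg (by tauto)]
  refine ⟨?_, ?_, h.real, ?_, ?_, ?_, ?_, ?_⟩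
  · rw [write_nats_le h.base _ _ _ (Nat.zero_le _), h.base]
  · intro w i'
    have hw' := w.idx_lt
    by_cases hwv : w = v
    · subst hwv
      rw [phys_write h.base _ _ _ (by omega) _ _ (by omega), h.nat]
      simp [Function.update_apply]
    · rw [hw _ _ (by omega) (NVar.idx_injective.ne hwv), h.nat, Mem.N_setN_ne _ _ _ hwv]
  · rw [hw _ _ (by omega) (by omega)]; exact h.free_pos
  · rw [hw _ _ (by omega) (by omega)]; exact h.val_zero
  · rw [hw _ _ (by omega) (by omega)]; exact h.next_zero
  · intro u i'
    have hu := u.idx_ge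
    have hu' := u.idx_lt
    simp only [hw _ 60 (by omega) (by omega), hw _ 61 (by omega) (by omega),
      hw _ 62 (by omega) (by omega), hw _ u.idx (by omega) (by omega), Mem.L_setN]
    exact h.list u i'
  · intro i' hi'
    rw [write_nats_le h.base _ _ _ (by omega), h.out _ hi', Mem.out_setN]

lemma write_list (h : Rel q m s) (v : LVar) (i x : ℕ) (l : List ℕ)
    (hl : Chain (phys s · 60) (phys s · 61) (phys s 0 62) x l) :
    Rel q (m.setL v i l) (State.write s i v.idx x) := by
  have hv := v.idx_lt
  have hv' := v.idx_ge
  have hw : ∀ i' j', j' < 64 → j' ≠ v.idx →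
      phys (State.write s i v.idx x) i' j' = phys s i' j' := fun i' j' h1 h2 => by
    rw [phys_write h.base _ _ _ (by omega) _ _ h1, if_neg (by tauto)]
  refine ⟨?_, ?_, h.real, ?_, ?_, ?_, ?_, ?_⟩
  · rw [write_nats_le h.base _ _ _ (Nat.zero_le _), h.base]
  · intro w i'
    have hw' := w.idx_lt
    rw [hw _ _ (by omega) (by omega), h.nat, Mem.N_setL]
  · rw [hw _ _ (by omega) (by omega)]; exact h.free_pos
  · rw [hw _ _ (by omega) (by omega)]; exact h.val_zero
  · rw [hw _ _ (by omega) (by omega)]; exact h.next_zero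
  · intro u i'
    have hu := u.idx_ge
    have hu' := u.idx_lt
    simp only [hw _ 60 (by omega) (by omega), hw _ 61 (by omega) (by omega),
      hw _ 62 (by omega) (by omega)]
    by_cases huv : u = v
    · subst huv
      rw [phys_write h.base _ _ _ (by omega) _ _ (by omega), Mem.L_setL_self,
        Function.update_apply]
      by_cases hi : i' = i
      · simpa [hi] using hl
      · simpa [hi] using h.list u i'
    · rw [hw _ _ (by omega) (LVar.idx_injective.ne huv), Mem.L_setL_ne _ _ _ huv]
      exact h.list u i'
  · intro i' hi'
    rw [write_nats_le h.base _ _ _ (by omega), h.out _ hi', Mem.out_setL]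

/-- Writing behind the end of the heap. -/
lemma write_heap (h : Rel q m s) (i j x : ℕ) (hj : j = 60 ∨ j = 61) (hi : phys s 0 62 ≤ i) :
    Rel q m (State.write s i j x) := by
  have hp := h.free_pos
  have hw : ∀ i' j', j' < 64 → (i' ≠ i ∨ j' ≠ j) →
      phys (State.write s i j x) i' j' = phys s i' j' := fun i' j' h1 h2 => by
    rw [phys_write h.base _ _ _ (by omega) _ _ h1, if_neg (by tauto)]
  refine ⟨?_, ?_, h.real, ?_, ?_, ?_, ?_, ?_⟩
  · rw [write_nats_le h.base _ _ _ (Nat.zero_le _), h.base]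
  · intro w i'
    have hw' := w.idx_lt
    rw [hw _ _ (by omega) (by omega), h.nat]
  · rw [hw _ _ (by omega) (by omega)]; exact h.free_pos
  · rw [hw _ _ (by omega) (by omega)]; exact h.val_zero
  · rw [hw _ _ (by omega) (by omega)]; exact h.next_zero
  · intro u i'
    have hu := u.idx_ge
    have hu' := u.idx_lt
    rw [hw _ u.idx (by omega) (by omega), hw 0 62 (by omega) (by omega)]
    exact (h.list u i').mono le_rfl (fun y hy => hw _ _ (by omega) (by omega))
      fun y hy => hw _ _ (by omega) (by omega)
  · intro i' hi'
    rw [write_nats_le h.base _ _ _ (by omega), h.out _ hi']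

/-- Extending the heap by one cell. -/
lemma write_free (h : Rel q m s) : Rel q m (State.write s 0 62 (phys s 0 62 + 1)) := by
  have hw : ∀ i' j', j' < 64 → j' ≠ 62 →
      phys (State.write s 0 62 (phys s 0 62 + 1)) i' j' = phys s i' j' := fun i' j' h1 h2 => by
    rw [phys_write h.base _ _ _ (by omega) _ _ h1, if_neg (by tauto)]
  have hf : phys (State.write s 0 62 (phys s 0 62 + 1)) 0 62 = phys s 0 62 + 1 := by
    rw [phys_write h.base _ _ _ (by omega) _ _ (by omega), if_pos (by simp)]
  refine ⟨?_, ?_, h.real, ?_, ?_, ?_, ?_, ?_⟩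
  · rw [write_nats_le h.base _ _ _ (Nat.zero_le _), h.base]
  · intro w i'
    have hw' := w.idx_lt
    rw [hw _ _ (by omega) (by omega), h.nat]
  · omega
  · rw [hw _ _ (by omega) (by omega)]; exact h.val_zero
  · rw [hw _ _ (by omega) (by omega)]; exact h.next_zero
  · intro u i'
    have hu := u.idx_ge
    have hu' := u.idx_lt
    rw [hw _ u.idx (by omega) (by omega), hf]
    exact (h.list u i').mono (by omega) (fun y hy => hw _ _ (by omega) (by omega))
      fun y hy => hw _ _ (by omega) (by omega)
  · intro i' hi'
    rw [write_nats_le h.base _ _ _ (by omega), h.out _ hi']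

lemma free_eval (s : State) : free.eval s = phys s 0 62 := cell_addr_eval _ _ _

end Rel

/-! ### Simulation of the abstract machine with constant slowdown -/

lemma Exec.store (s : State) (i v : NExpr) (j : ℕ) :
    Exec o (.storeNat (addr i j) v) s ((addr i j).cost + v.cost + 1)
      (State.write s (i.eval s) j (v.eval s)) := by
  have := Exec.storeNat (o := o) (addr i j) v s
  rwa [addr_eval] at this

/-- The compilation slows down by at most this factor. -/
def Cmd.factor : Cmd → ℕ
  | skip => 1
  | setN v i x => (addr i.compile v.idx).cost + x.compile.cost + 1
  | setR v x => (NExpr.lit v.idx).cost + x.compile.cost + 1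
  | setL v i l => (addr i.compile v.idx).cost + l.compile.cost + 1
  | cons v i x l =>
      ((addr free 60).cost + x.compile.cost + 1) + (((addr free 61).cost + l.compile.cost + 1) +
        (((addr i.compile v.idx).cost + free.cost + 1) +
          ((addr (.lit 0) 62).cost + (NExpr.add free (.lit 1)).cost + 1)))
  | out i x => (NExpr.add i.compile (.lit 1)).cost + x.compile.cost + 1
  | seq p q => p.factor + q.factor
  | ite b p q => b.compile.cost + 1 + p.factor + q.factor
  | .while b p => b.compile.cost + 1 + p.factor

/-- A basic command becomes straight-line code whose cost does not depend on the memory. The factor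
of a compound command contains the factors of its parts as summands, so the bound passes through
branches and loops, independently of the input. -/
lemma Cmd.exec_compile {c : Cmd} {m m' : Mem} {t : ℕ} (hr : Run o q c m t m') :
    ∀ s, Rel q m s →
      ∃ t' s', Exec o c.compile s t' s' ∧ t' ≤ c.factor * t ∧ Rel q m' s' := by
  induction hr with
  | skip m => exact fun s h => ⟨_, _, .skip s, by simp [Cmd.factor], h⟩
  | setN v i x m =>
    intro s h
    refine ⟨_, _, Exec.store s _ _ _, by simp [Cmd.factor], ?_⟩
    rw [h.nexpr, h.nexpr]
    exact h.write_nat v _ _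
  | setR v x m =>
    intro s h
    refine ⟨_, _, .storeReal _ _ s, by simp [Cmd.factor], ?_⟩
    rw [h.rexpr, NExpr.eval]
    refine ⟨h.base, h.nat, fun w => ?_, h.free_pos, h.val_zero, h.next_zero, h.list, h.out⟩
    by_cases hw : w = v
    · subst hw; simp
    · simp [hw, RVar.idx_injective.ne hw, h.real]
  | setL v i l m =>
    intro s h
    refine ⟨_, _, Exec.store s _ _ _, by simp [Cmd.factor], ?_⟩
    rw [h.nexpr]
    exact h.write_list v _ _ _ (h.lexpr l)
  | cons v i x l m =>
    intro s h
    set p := phys s 0 62 with hp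
    have hp1 : 1 ≤ p := h.free_pos
    have h₁ : Rel q m (State.write s p 60 (x.eval m)) :=
      h.write_heap _ _ _ (.inl rfl) le_rfl
    set s₁ := State.write s p 60 (x.eval m) with hs₁
    have hp' : phys s₁ 0 62 = p := by
      rw [hs₁, phys_write h.base _ _ _ (by omega) _ _ (by omega), if_neg (by omega)]
    have h₂ : Rel q m (State.write s₁ p 61 (l.compile.eval s₁)) :=
      h₁.write_heap _ _ _ (.inr rfl) hp'.le
    set s₂ := State.write s₁ p 61 (l.compile.eval s₁) with hs₂
    have hp₂ : phys s₂ 0 62 = p := by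
      rw [hs₂, phys_write h₁.base _ _ _ (by omega) _ _ (by omega), if_neg (by omega), hp']
    have h₃ := h₂.write_free
    have hl : Chain (phys s₁ · 60) (phys s₁ · 61) p (l.compile.eval s₁) (l.eval m) := by
      have := h₁.lexpr l
      rwa [hp'] at this
    have hl₂ : Chain (phys s₂ · 60) (phys s₂ · 61) (p + 1) p (x.eval m :: l.eval m) := by
      refine ⟨by omega, by omega, ?_, ?_⟩
      · simp only []
        rw [hs₂, phys_write h₁.base _ _ _ (by omega) _ _ (by omega), if_neg (by omega), hs₁,
          phys_write h.base _ _ _ (by omega) _ _ (by omega), if_pos (by simp)]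
      · have : phys s₂ p 61 = l.compile.eval s₁ := by
          rw [hs₂, phys_write h₁.base _ _ _ (by omega) _ _ (by omega), if_pos (by simp)]
        simp only [this]
        refine hl.mono (by omega) (fun y hy => ?_) fun y hy => ?_
        · rw [hs₂, phys_write h₁.base _ _ _ (by omega) _ _ (by omega), if_neg (by omega)]
        · rw [hs₂, phys_write h₁.base _ _ _ (by omega) _ _ (by omega), if_neg (by omega)]
    have hv := v.idx_lt
    have hv' := v.idx_ge
    -- The code stores the pointer before raising the heap limit, but `p` is a legal list only under
    -- the raised limit. The two writes hit different cells and are exchanged for the proof.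
    have hcomm : State.write (State.write s₂ 0 62 (p + 1)) (i.eval m) v.idx p =
        State.write (State.write s₂ (i.eval m) v.idx p) 0 62 (p + 1) := by
      have e1 := write_nats_le h₂.base 0 62 (p + 1) (Nat.zero_le _)
      have e2 := write_nats_le h₂.base (i.eval m) v.idx p (Nat.zero_le _)
      rw [State.write, e1]
      conv_rhs => rw [State.write, e2]
      simp only [State.write]
      rw [Function.update_comm]
      omega
    have h₄ : Rel q (m.setL v (i.eval m) (x.eval m :: l.eval m))
        (State.write (State.write s₂ (i.eval m) v.idx p) 0 62 (p + 1)) := by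
      rw [← hcomm]
      rw [hp₂] at h₃
      refine h₃.write_list v _ _ _ ?_
      have hf : phys (State.write s₂ 0 62 (p + 1)) 0 62 = p + 1 := by
        rw [phys_write h₂.base _ _ _ (by omega) _ _ (by omega), if_pos (by simp)]
      rw [hf]
      refine hl₂.mono le_rfl (fun y hy => ?_) fun y hy => ?_
      · rw [phys_write h₂.base _ _ _ (by omega) _ _ (by omega), if_neg (by omega)]
      · rw [phys_write h₂.base _ _ _ (by omega) _ _ (by omega), if_neg (by omega)]
    have x₁ := Exec.store (o := o) s free x.compile 60
    rw [Rel.free_eval, ← hp, h.nexpr, ← hs₁] at x₁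
    have x₂ := Exec.store (o := o) s₁ free l.compile 61
    rw [Rel.free_eval, hp', ← hs₂] at x₂
    have x₃ := Exec.store (o := o) s₂ i.compile free v.idx
    rw [Rel.free_eval, hp₂, h₂.nexpr] at x₃
    have x₄ := Exec.store (o := o) (State.write s₂ (i.eval m) v.idx p) (.lit 0)
      (.add free (.lit 1)) 62
    have hp₃ : phys (State.write s₂ (i.eval m) v.idx p) 0 62 = p := by
      rw [phys_write h₂.base _ _ _ (by omega) _ _ (by omega), if_neg (by omega), hp₂]
    simp only [NExpr.eval, Rel.free_eval, hp₃] at x₄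
    exact ⟨_, _, .seq x₁ (.seq x₂ (.seq x₃ x₄)), by simp [Cmd.factor], h₄⟩
  | out i x m hi =>
    intro s h
    refine ⟨_, _, .storeNat _ _ s, by simp [Cmd.factor], ?_⟩
    simp only [NExpr.eval, h.nexpr]
    have hw : ∀ a, a ≠ i.eval m + 1 →
        (Function.update s.nats (i.eval m + 1) (x.eval m)) a = s.nats a :=
      fun a ha => Function.update_of_ne ha _ _
    have hb : (Function.update s.nats (i.eval m + 1) (x.eval m)) 0 = s.nats 0 := hw 0 (by omega)
    have hph : ∀ i' j', phys { s with
        nats := Function.update s.nats (i.eval m + 1) (x.eval m) } i' j' = phys s i' j' := by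
      intro i' j'
      simp only [phys, hb]
      apply hw
      have := h.base
      omega
    refine ⟨hb.trans h.base, ?_, h.real, ?_, ?_, ?_, ?_, ?_⟩
    · simpa only [hph, Mem.N_setOut] using h.nat
    · simpa only [hph] using h.free_pos
    · simpa only [hph] using h.val_zero
    · simpa only [hph] using h.next_zero
    · simpa only [hph, Mem.L_setOut] using h.list
    · intro i' hi'
      by_cases h' : i' = i.eval m
      · subst h'; simp
      · have : i' + 1 ≠ i.eval m + 1 := by omega
        simp [h', h.out i' hi']
  | seq h₁ h₂ ih₁ ih₂ =>
    intro s h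
    obtain ⟨t₁, s₁, x₁, ht₁, r₁⟩ := ih₁ s h
    obtain ⟨t₂, s₂, x₂, ht₂, r₂⟩ := ih₂ s₁ r₁
    refine ⟨_, _, .seq x₁ x₂, ?_, r₂⟩
    rw [Cmd.factor]
    nlinarith [Nat.zero_le (Cmd.factor ‹_›)]
  | @ite_true b c c' m m' t hb h₁ ih₁ =>
    intro s h
    obtain ⟨t₁, s₁, x₁, ht₁, r₁⟩ := ih₁ s h
    refine ⟨_, _, .ite_true ((h.test b).2 hb) x₁, ?_, r₁⟩
    rw [Cmd.factor]
    nlinarith [Nat.zero_le (b.compile.cost * t), Nat.zero_le (c'.factor * t)]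
  | @ite_false b c c' m m' t hb h₁ ih₁ =>
    intro s h
    obtain ⟨t₁, s₁, x₁, ht₁, r₁⟩ := ih₁ s h
    refine ⟨_, _, .ite_false (fun hb' => hb ((h.test b).1 hb')) x₁, ?_, r₁⟩
    rw [Cmd.factor]
    nlinarith [Nat.zero_le (b.compile.cost * t), Nat.zero_le (c.factor * t)]
  | @while_true b c m m' m'' t t' hb h₁ h₂ ih₁ ih₂ =>
    intro s h
    obtain ⟨t₁, s₁, x₁, ht₁, r₁⟩ := ih₁ s h
    obtain ⟨t₂, s₂, x₂, ht₂, r₂⟩ := ih₂ s₁ r₁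
    refine ⟨_, _, .while_true ((h.test b).2 hb) x₁ x₂, ?_, r₂⟩
    rw [Cmd.factor] at ht₂ ⊢
    nlinarith [Nat.zero_le (b.compile.cost * t), Nat.zero_le (c.factor * t)]
  | @while_false b c m hb =>
    intro s h
    exact ⟨_, _, .while_false fun hb' => hb ((h.test b).1 hb'), by simp [Cmd.factor], h⟩

/-! ### Loading the input and returning the output -/

/-- The program that sets up the memory, executes a command, and returns the variable `flag`. -/
def Cmd.program (c : Cmd) : Program :=
  .seq (.storeNat (.add (.add (.cell (.lit 0)) (.lit 2)) (.lit NVar.k.idx)) (.cell (.lit 0)))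
    (.seq (.storeNat (.add (.add (.cell (.lit 0)) (.lit 2)) (.lit NVar.n.idx)) (.cell (.lit 1)))
      (.seq (.storeNat (.add (.add (.cell (.lit 0)) (.lit 2)) (.lit 62)) (.lit 1))
        (.seq (.storeNat (.lit 0) (.add (.cell (.lit 0)) (.lit 2)))
          (.seq c.compile (.storeNat (.lit 0) (NE.var .flag).compile)))))

/-- The initial memory. -/
noncomputable def initialMem (k n : ℕ) (ρ ε : ℝ) : Mem where
  N v i := if i = 0 then (match v with | .k => k | .n => n | _ => 0) else 0
  R v := match v with | .rho => ρ | .eps => ε | _ => 0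
  L _ _ := []
  out i := if i = 0 then n else 0

/-- The state in which the compiled command is started. -/
noncomputable def startState (k n : ℕ) (ρ ε : ℝ) : State where
  nats a := if a = 0 then k + 2 else if a = k + 2 + 62 then 1 else
    if a = k + 2 + NVar.n.idx then n else if a = k + 2 + NVar.k.idx then k else
    if a = 1 then n else 0
  reals a := if a = 0 then ρ else if a = 1 then ε else 0

/-- Behind the base only the cells for `k`, for `n` and for the heap limit can be nonzero, so all
lists are empty. The input `n` remaining in cell `1` is seen as the initial content of output cell
`0`. -/
lemma rel_startState (k n : ℕ) (ρ ε : ℝ) :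
    Rel (k + 1) (initialMem k n ρ ε) (startState k n ρ ε) := by
  have hk : NVar.k.idx = 0 := rfl
  have hn : NVar.n.idx = 1 := rfl
  have hp : ∀ i j, phys (startState k n ρ ε) i j = if 64 * i + j = 62 then 1 else
      if 64 * i + j = 1 then n else if 64 * i + j = 0 then k else 0 := by
    intro i j
    simp only [phys, startState, if_true, hk, hn, add_right_inj, add_zero]
    rw [if_neg (by omega), if_neg (c := k + 2 + (64 * i + j) = 1) (by omega)]
    split_ifs <;> first | rfl | omega
  refine ⟨rfl, ?_, ?_, ?_, ?_, ?_, ?_, ?_⟩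
  · intro v i
    have hv := v.idx_lt
    rw [hp, if_neg (by omega)]
    by_cases hi : i = 0
    · subst hi
      cases v <;> rfl
    · rw [if_neg (by omega), if_neg (by omega)]
      simp [initialMem, hi]
  · intro v
    cases v <;> simp [startState, initialMem, RVar.idx]
  · simp [hp]
  · simp [hp]
  · simp [hp]
  · intro u i
    have hu := u.idx_ge
    have hu' := u.idx_lt
    rw [hp _ u.idx, if_neg (by omega), if_neg (by omega), if_neg (by omega)]
    rfl
  · intro i hi
    simp only [startState, initialMem, hk, hn]
    rw [if_neg (by omega), if_neg (by omega), if_neg (by omega), if_neg (by omega)]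
    by_cases h : i = 0 <;> simp [h]

/-- The base address `k + 2` leaves the cells `1, …, k + 1` below it for output. Cell `0` holds `k`
until the base is written there, so the inputs are copied first. `K` covers the slowdown and the
five additional instructions. -/
lemma Cmd.exec_program (c : Cmd) : ∃ K : ℕ, ∀ (o : Oracle) (k n : ℕ) (ρ ε : ℝ) (T : ℕ)
    (Q : Mem → Prop), 1 ≤ k →
      wp o (k + 1) c (initialMem k n ρ ε) (fun t m => t ≤ T ∧ Q m) →
      ∃ t s m, Exec o c.program (initialState k n ρ ε) t s ∧ t ≤ K * (T + 1) ∧ Q m ∧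
        s.nats 0 = m.N .flag 0 ∧ ∀ i < k, s.nats (i + 1) = m.out i := by
  let e : ℕ → NExpr := fun j => .add (.add (.cell (.lit 0)) (.lit 2)) (.lit j)
  let f : NExpr := .add (.cell (.lit 0)) (.lit 2)
  have he : ∀ j s, (e j).eval s = s.nats 0 + 2 + j := fun _ _ => rfl
  have hf : ∀ s, f.eval s = s.nats 0 + 2 := fun _ => rfl
  refine ⟨c.factor + (((e 0).cost + (NExpr.cell (.lit 0)).cost + 1) +
    ((e 1).cost + (NExpr.cell (.lit 1)).cost + 1) + ((e 62).cost + (NExpr.lit 1).cost + 1) +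
    ((NExpr.lit 0).cost + f.cost + 1) +
      ((NExpr.lit 0).cost + (NE.var .flag).compile.cost + 1)),
    fun o k n ρ ε T Q hk ⟨t, m, hr, ht, hQ⟩ => ?_⟩
  obtain ⟨t', s', hx, ht', hr'⟩ := exec_compile hr _ (rel_startState k n ρ ε)
  have x₁ := Exec.storeNat (o := o) (e 0) (.cell (.lit 0)) (initialState k n ρ ε)
  have hk0 : (initialState k n ρ ε).nats 0 = k := rfl
  have hn0 : (initialState k n ρ ε).nats 1 = n := rfl
  rw [he, NExpr.eval, NExpr.eval, hk0] at x₁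
  set s₁ : State := { initialState k n ρ ε with
    nats := Function.update (initialState k n ρ ε).nats (k + 2 + 0) k } with hs₁
  have hk1 : s₁.nats 0 = k := by
    rw [hs₁]
    simp only
    rw [Function.update_of_ne (by omega), hk0]
  have hn1 : s₁.nats 1 = n := by
    rw [hs₁]
    simp only
    rw [Function.update_of_ne (by omega), hn0]
  have x₂ := Exec.storeNat (o := o) (e 1) (.cell (.lit 1)) s₁
  rw [he, NExpr.eval, NExpr.eval, hk1, hn1] at x₂
  set s₂ : State := { s₁ with nats := Function.update s₁.nats (k + 2 + 1) n } with hs₂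
  have hk2 : s₂.nats 0 = k := by
    rw [hs₂]
    simp only
    rw [Function.update_of_ne (by omega), hk1]
  have x₃ := Exec.storeNat (o := o) (e 62) (.lit 1) s₂
  rw [he, NExpr.eval, hk2] at x₃
  set s₃ : State := { s₂ with nats := Function.update s₂.nats (k + 2 + 62) 1 } with hs₃
  have hk3 : s₃.nats 0 = k := by
    rw [hs₃]
    simp only
    rw [Function.update_of_ne (by omega), hk2]
  have x₄ := Exec.storeNat (o := o) (.lit 0) f s₃
  rw [hf, NExpr.eval, hk3] at x₄
  have hs₄ : ({ s₃ with nats := Function.update s₃.nats 0 (k + 2) } : State) =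
      startState k n ρ ε := by
    simp only [hs₃, hs₂, hs₁, startState, initialState, State.mk.injEq, and_true]
    funext a
    have hk : NVar.k.idx = 0 := rfl
    have hn : NVar.n.idx = 1 := rfl
    simp only [Function.update_apply, hk, hn]
    by_cases ha : a = 0
    · simp [ha]
    · simp [ha]
  rw [hs₄] at x₄
  have x₅ := Exec.storeNat (o := o) (.lit 0) (NE.var .flag).compile s'
  rw [hr'.nexpr] at x₅
  refine ⟨_, _, m, .seq x₁ (.seq x₂ (.seq x₃ (.seq x₄ (.seq hx x₅)))), ?_, hQ, ?_, ?_⟩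
  · have : c.factor * t ≤ c.factor * T := Nat.mul_le_mul_left _ ht
    generalize (e 0).cost + (NExpr.cell (.lit 0)).cost + 1 = a₁
    generalize (e 1).cost + (NExpr.cell (.lit 1)).cost + 1 = a₂
    generalize (e 62).cost + (NExpr.lit 1).cost + 1 = a₃
    generalize (NExpr.lit 0).cost + f.cost + 1 = a₄
    generalize (NExpr.lit 0).cost + (NE.var .flag).compile.cost + 1 = a₅
    nlinarith [Nat.zero_le ((a₁ + a₂ + a₃ + a₄ + a₅) * T)]
  · simp [NExpr.eval]
  · intro i hi
    simp [NExpr.eval, hr'.out i (by omega)]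

end ListMachine

/-! ### Packing in doubling spaces -/

/-- Every closed ball is covered by at most `B` closed balls of half the radius. -/
def IsDoublingConst (Y : Type*) [MetricSpace Y] (B : ℕ) : Prop :=
  ∀ (x : Y) (r : ℝ), ∃ T : Finset Y, T.card ≤ B ∧
    Metric.closedBall x r ⊆ ⋃ t ∈ T, Metric.closedBall t (r / 2)

section Packing

variable {Y : Type*} [MetricSpace Y] {B : ℕ}

lemma HasDoublingDimension.isDoublingConst {δ : ℝ} (h : HasDoublingDimension Y δ) :
    IsDoublingConst Y ⌊(2 : ℝ) ^ δ⌋₊ := fun x r => by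
  obtain ⟨T, hT, hc⟩ := h x r
  exact ⟨T, Nat.le_floor hT, hc⟩

lemma IsDoublingConst.pos [Nonempty Y] (hB : IsDoublingConst Y B) : 1 ≤ B := by
  obtain ⟨x⟩ := ‹Nonempty Y›
  obtain ⟨T, hT, hc⟩ := hB x 0
  have : x ∈ ⋃ t ∈ T, Metric.closedBall t (0 / 2) := hc (by simp)
  simp only [Set.mem_iUnion] at this
  obtain ⟨t, ht, -⟩ := this
  exact (Finset.card_pos.2 ⟨t, ht⟩).trans_le hT

/-- Halve the radius `h` times, replacing every ball by at most `B` balls of the next generation. -/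
lemma IsDoublingConst.cover (hB : IsDoublingConst Y B) (h : ℕ) (x : Y) (r : ℝ) :
    ∃ T : Finset Y, T.card ≤ B ^ h ∧
      ∀ y, dist y x ≤ r → ∃ t ∈ T, dist y t ≤ r / 2 ^ h := by
  classical
  induction h with
  | zero => exact ⟨{x}, by simp, fun y hy => ⟨x, by simp, by simpa using hy⟩⟩
  | succ h ih =>
    obtain ⟨T, hT, hc⟩ := ih
    choose f hf hfc using fun t => hB t (r / 2 ^ h)
    refine ⟨T.biUnion f, ?_, fun y hy => ?_⟩
    · calc (T.biUnion f).card ≤ T.card * B := Finset.card_biUnion_le_card_mul _ _ _ fun t _ => hf t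
        _ ≤ B ^ (h + 1) := by rw [pow_succ]; exact Nat.mul_le_mul_right _ hT
    · obtain ⟨t, ht, hyt⟩ := hc y hy
      have := hfc t (Metric.mem_closedBall.2 hyt)
      simp only [Set.mem_iUnion, Metric.mem_closedBall] at this
      obtain ⟨u, hu, hyu⟩ := this
      refine ⟨u, Finset.mem_biUnion.2 ⟨t, ht, hu⟩, hyu.trans_eq ?_⟩
      rw [pow_succ, div_div]

/-- Maps from `A` into a ball that are separated in the supremum distance are few. -/
lemma IsDoublingConst.card_le (hB : IsDoublingConst Y B) {ι : Type*} (J : Finset ι)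
    (A : Finset ℕ) (g : ι → ℕ → Y) (x : Y) (r s : ℝ) (h : ℕ) (hs : 2 * (r / 2 ^ h) ≤ s)
    (hball : ∀ i ∈ J, ∀ a ∈ A, dist (g i a) x ≤ r)
    (hsep : ∀ i ∈ J, ∀ j ∈ J, i ≠ j → ∃ a ∈ A, s < dist (g i a) (g j a)) :
    J.card ≤ (B ^ h) ^ A.card := by
  classical
  obtain ⟨T, hT, hc⟩ := hB.cover h x r
  have : ∀ i a, ∃ t, i ∈ J → a ∈ A → t ∈ T ∧ dist (g i a) t ≤ r / 2 ^ h := by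
    intro i a
    by_cases hi : i ∈ J ∧ a ∈ A
    · obtain ⟨t, ht, hd⟩ := hc _ (hball i hi.1 a hi.2)
      exact ⟨t, fun _ _ => ⟨ht, hd⟩⟩
    · exact ⟨x, fun h1 h2 => absurd ⟨h1, h2⟩ hi⟩
  choose f hf using this
  -- `F i` records a covering point near each `g i a`. If two records agree, every pair of
  -- coordinates is at distance at most `2 * (r / 2 ^ h) ≤ s`, against the separation; so `F` is
  -- injective on `J`.
  let F : ι → ∀ a ∈ A, Y := fun i a _ => f i a
  have hle : J.card ≤ (A.pi fun _ => T).card := by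
    refine Finset.card_le_card_of_injOn F (fun i hi => ?_) fun i hi j hj hij => ?_
    · exact Finset.mem_coe.2 (Finset.mem_pi.2 fun a ha => (hf i a hi ha).1)
    · by_contra hne
      obtain ⟨a, ha, hlt⟩ := hsep i hi j hj hne
      have e : f i a = f j a := congrFun (congrFun hij a) ha
      have h1 := (hf i a hi ha).2
      have h2 := (hf j a hj ha).2
      rw [← e] at h2
      linarith [dist_triangle_right (g i a) (g j a) (f i a)]
  refine hle.trans ?_
  rw [Finset.card_pi, Finset.prod_const]
  exact Nat.pow_le_pow_left hT _

lemma IsDoublingConst.length_le (hB : IsDoublingConst Y B) {l : List ℕ} (hl : l.Nodup)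
    (pt : ℕ → Y) (x : Y) (r s : ℝ) (h : ℕ) (hs : 2 * (r / 2 ^ h) ≤ s)
    (hball : ∀ i ∈ l, dist (pt i) x ≤ r)
    (hsep : ∀ i ∈ l, ∀ j ∈ l, i ≠ j → s < dist (pt i) (pt j)) : l.length ≤ B ^ h := by
  have := hB.card_le l.toFinset {0} (fun i _ => pt i) x r s h hs (by simpa using hball)
    (by simpa using hsep)
  simpa [List.toFinset_card_of_nodup hl] using this

end Packing

/-! ### Nets -/

/-- Points with numbers `1, …, n`, whose distances are given by the oracle. -/
structure Represents (dY : ℕ → ℕ → ℝ) {Y : Type*} [MetricSpace Y] (pt : ℕ → Y) (n : ℕ) :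
    Prop where
  dist_eq : ∀ y z, y ∈ Finset.Ico 1 (n + 1) → z ∈ Finset.Ico 1 (n + 1) →
    dY (y - 1) (z - 1) = dist (pt y) (pt z)
  inj : ∀ y z, y ∈ Finset.Ico 1 (n + 1) → z ∈ Finset.Ico 1 (n + 1) → pt y = pt z → y = z

/-- The points `1, …, i - 1` have been assigned to centers, by `c`, within distance `t`; the
centers have distance more than `t`. -/
structure IsCentering {Y : Type*} [MetricSpace Y] (pt : ℕ → Y) (t : ℝ) (i : ℕ) (c : ℕ → ℕ) :
    Prop where
  mem : ∀ y ∈ Finset.Ico 1 i, c y ∈ Finset.Ico 1 i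
  idem : ∀ y ∈ Finset.Ico 1 i, c (c y) = c y
  close : ∀ y ∈ Finset.Ico 1 i, dist (pt y) (pt (c y)) ≤ t
  sep : ∀ y ∈ Finset.Ico 1 i, ∀ z ∈ Finset.Ico 1 i, c y = y → c z = z → y ≠ z →
    t < dist (pt y) (pt z)

/-- `c` assigns points to centers, and `fr y` lists all centers close to `y`. -/
structure IsNet {Y : Type*} [MetricSpace Y] (pt : ℕ → Y) (n : ℕ) (t : ℝ) (c : ℕ → ℕ)
    (fr : ℕ → List ℕ) : Prop extends IsCentering pt t (n + 1) c where
  nodup : ∀ y ∈ Finset.Ico 1 (n + 1), (fr y).Nodup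
  mem_fr : ∀ y ∈ Finset.Ico 1 (n + 1), ∀ z, z ∈ fr y ↔
    z ∈ Finset.Ico 1 (n + 1) ∧ c z = z ∧ dist (pt y) (pt z) ≤ 4 * t

/-- The refinement `c₂` of `c` has been computed for the points `1, …, i - 1`, and `ch w` lists
the new centers in the cell of `w`. -/
structure IsRefining {Y : Type*} [MetricSpace Y] (pt : ℕ → Y) (n : ℕ) (t : ℝ) (c : ℕ → ℕ) (i : ℕ)
    (c₂ : ℕ → ℕ) (ch : ℕ → List ℕ) (cnt : ℕ) : Prop extends IsCentering pt t i c₂ where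
  nodup : ∀ w ∈ Finset.Ico 1 (n + 1), (ch w).Nodup
  mem_ch : ∀ w ∈ Finset.Ico 1 (n + 1), ∀ z, z ∈ ch w ↔ z ∈ Finset.Ico 1 i ∧ c₂ z = z ∧ c z = w
  cnt_eq : cnt = ((Finset.Ico 1 i).filter fun y => c₂ y = y).card

section Nets

variable {Y : Type*} [MetricSpace Y] {pt : ℕ → Y} {n : ℕ} {t : ℝ} {c : ℕ → ℕ}
  {fr : ℕ → List ℕ}

/-- The listed centers lie in a ball of radius `4 * t` and are more than `t` apart. Three halvings
suffice, as `2 * (4 * t / 2 ^ 3) = t`. -/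
lemma IsNet.length_le {B : ℕ} (hB : IsDoublingConst Y B) (h : IsNet pt n t c fr) {y : ℕ}
    (hy : y ∈ Finset.Ico 1 (n + 1)) : (fr y).length ≤ B ^ 3 := by
  refine hB.length_le (h.nodup y hy) pt (pt y) (4 * t) t 3 (by linarith) (fun z hz => ?_)
    fun z hz w hw hzw => ?_
  · rw [dist_comm]
    exact ((h.mem_fr y hy z).1 hz).2.2
  · obtain ⟨h1, h2, -⟩ := (h.mem_fr y hy z).1 hz
    obtain ⟨h3, h4, -⟩ := (h.mem_fr y hy w).1 hw
    exact h.sep z h1 w h3 h2 h4 hzw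

variable {i cnt : ℕ} {c₂ : ℕ → ℕ} {ch : ℕ → List ℕ}

lemma IsRefining.zero (pt : ℕ → Y) (t : ℝ) (c c₂ : ℕ → ℕ)
    (hch : ∀ w ∈ Finset.Ico 1 (n + 1), ch w = []) : IsRefining pt n t c 1 c₂ ch 0 :=
  ⟨⟨by simp, by simp, by simp, by simp⟩, fun w hw => by simp [hch w hw],
    fun w hw => by simp [hch w hw], by simp⟩

/-- A coarse cell has radius `2 * t`, and `2 * (2 * t / 2 ^ 2) = t`. -/
lemma IsRefining.length_le {B : ℕ} (hB : IsDoublingConst Y B)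
    (h : IsNet pt n (2 * t) c fr) (hr : IsRefining pt n t c i c₂ ch cnt) (hi : i ≤ n + 1) {w : ℕ}
    (hw : w ∈ Finset.Ico 1 (n + 1)) : (ch w).length ≤ B ^ 2 := by
  refine hB.length_le (hr.nodup w hw) pt (pt w) (2 * t) t 2 (by linarith) (fun z hz => ?_)
    fun z hz u hu hzu => ?_
  · obtain ⟨h1, -, rfl⟩ := (hr.mem_ch w hw z).1 hz
    exact h.close z (Finset.Ico_subset_Ico_right hi h1)
  · obtain ⟨h1, h2, -⟩ := (hr.mem_ch w hw z).1 hz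
    obtain ⟨h3, h4, -⟩ := (hr.mem_ch w hw u).1 hu
    exact hr.sep z h1 u h3 h2 h4 hzu

/-- The coarse neighbour lists suffice to find fine centers: the coarse center of `z` is within `4 *
t + 2 * t` of `y`, which is less than the coarse listing radius `4 * (2 * t)` unless `t = 0`. Thus a
point inspects boundedly many candidates instead of all of `Y`. -/
lemma IsRefining.mem_flatMap (h : IsNet pt n (2 * t) c fr)
    (hr : IsRefining pt n t c i c₂ ch cnt) (hi : i ≤ n + 1) {y : ℕ}
    (hy : y ∈ Finset.Ico 1 (n + 1)) {z : ℕ} (hz : z ∈ Finset.Ico 1 i) (hc : c₂ z = z)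
    (hd : dist (pt y) (pt z) ≤ 4 * t) : z ∈ (fr y).flatMap ch := by
  have hz' := Finset.Ico_subset_Ico_right hi hz
  have h1 := h.close z hz'
  have h2 := dist_nonneg.trans h1
  refine List.mem_flatMap.2 ⟨c z, (h.mem_fr y hy _).2 ⟨h.mem z hz', h.idem z hz', ?_⟩,
    (hr.mem_ch _ (h.mem z hz') z).2 ⟨hz, hc, rfl⟩⟩
  linarith [dist_triangle (pt y) (pt z) (pt (c z))]

lemma IsRefining.of_mem_flatMap (h : IsNet pt n (2 * t) c fr)
    (hr : IsRefining pt n t c i c₂ ch cnt) {y : ℕ} (hy : y ∈ Finset.Ico 1 (n + 1)) {z : ℕ}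
    (hz : z ∈ (fr y).flatMap ch) : z ∈ Finset.Ico 1 i ∧ c₂ z = z := by
  obtain ⟨w, hw, hz⟩ := List.mem_flatMap.1 hz
  obtain ⟨h1, h2, -⟩ := (hr.mem_ch w ((h.mem_fr y hy w).1 hw).1 z).1 hz
  exact ⟨h1, h2⟩

/-- A new center that is not among the candidates is farther than `4 * t` from `i`, so checking the
candidates alone establishes the separation from all new centers. -/
lemma IsRefining.center (h : IsNet pt n (2 * t) c fr) (hr : IsRefining pt n t c i c₂ ch cnt)
    (hi : i ∈ Finset.Ico 1 (n + 1))
    (hf : ∀ z ∈ (fr i).flatMap ch, t < dist (pt i) (pt z)) :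
    IsRefining pt n t c (i + 1) (Function.update c₂ i i)
      (Function.update ch (c i) (i :: ch (c i))) (cnt + 1) := by
  rw [Finset.mem_Ico] at hi
  have ht : 0 ≤ t := by
    have := dist_nonneg.trans (h.close i (Finset.mem_Ico.2 hi))
    linarith
  have hins : Finset.Ico 1 (i + 1) = insert i (Finset.Ico 1 i) :=
    (Finset.insert_Ico_right_eq_Ico_add_one hi.1).symm
  have hne : ∀ z ∈ Finset.Ico 1 i, Function.update c₂ i i z = c₂ z := fun z hz =>
    Function.update_of_ne (Finset.mem_Ico.1 hz).2.ne _ _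
  have hfar : ∀ z ∈ Finset.Ico 1 i, c₂ z = z → t < dist (pt i) (pt z) := by
    intro z hz hc
    by_contra! hd
    exact hd.not_gt (hf z (hr.mem_flatMap h hi.2.le (Finset.mem_Ico.2 hi) hz hc (by linarith)))
  have hni : i ∉ Finset.Ico 1 i := by simp
  refine ⟨⟨?_, ?_, ?_, ?_⟩, ?_, ?_, ?_⟩
  · rw [hins]
    intro y hy
    rcases Finset.mem_insert.1 hy with rfl | hy
    · simp
    · rw [hne y hy]
      exact Finset.mem_insert_of_mem (hr.mem y hy)
  · rw [hins]
    intro y hy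
    rcases Finset.mem_insert.1 hy with rfl | hy
    · simp
    · rw [hne y hy, hne _ (hr.mem y hy), hr.idem y hy]
  · rw [hins]
    intro y hy
    rcases Finset.mem_insert.1 hy with rfl | hy
    · simpa using ht
    · rw [hne y hy]
      exact hr.close y hy
  · rw [hins]
    intro y hy z hz hcy hcz hyz
    rcases Finset.mem_insert.1 hy with rfl | hy <;> rcases Finset.mem_insert.1 hz with rfl | hz
    · exact absurd rfl hyz
    · rw [hne z hz] at hcz
      exact hfar z hz hcz
    · rw [hne y hy] at hcy
      rw [dist_comm]
      exact hfar y hy hcy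
    · rw [hne y hy] at hcy
      rw [hne z hz] at hcz
      exact hr.sep y hy z hz hcy hcz hyz
  · intro w hwn
    by_cases hw : w = c i
    · subst hw
      rw [Function.update_self, List.nodup_cons]
      exact ⟨fun hi' => hni ((hr.mem_ch _ hwn i).1 hi').1, hr.nodup _ hwn⟩
    · rw [Function.update_of_ne hw]
      exact hr.nodup _ hwn
  · intro w hwn z
    rw [hins, Finset.mem_insert]
    by_cases hz : z = i
    · subst hz
      by_cases hw : w = c z
      · simp [hw]
      · rw [Function.update_of_ne hw, hr.mem_ch _ hwn]
        simp [Ne.symm hw]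
    · rw [Function.update_of_ne hz]
      by_cases hw : w = c i
      · subst hw
        rw [Function.update_self, List.mem_cons, hr.mem_ch _ hwn]
        simp [hz]
      · rw [Function.update_of_ne hw, hr.mem_ch _ hwn]
        simp [hz]
  · rw [hins, Finset.filter_insert, if_pos (by simp), Finset.card_insert_of_notMem (by simp),
      hr.cnt_eq]
    congr 2
    exact Finset.filter_congr fun z hz => by rw [hne z hz]

lemma IsRefining.assign (hr : IsRefining pt n t c i c₂ ch cnt) (hi : 1 ≤ i) {z : ℕ}
    (hz : z ∈ Finset.Ico 1 i) (hc : c₂ z = z) (hd : dist (pt i) (pt z) ≤ t) :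
    IsRefining pt n t c (i + 1) (Function.update c₂ i z) ch cnt := by
  have hins : Finset.Ico 1 (i + 1) = insert i (Finset.Ico 1 i) :=
    (Finset.insert_Ico_right_eq_Ico_add_one hi).symm
  have hzi : z ≠ i := (Finset.mem_Ico.1 hz).2.ne
  have hne : ∀ z' ∈ Finset.Ico 1 i, Function.update c₂ i z z' = c₂ z' := fun z hz =>
    Function.update_of_ne (Finset.mem_Ico.1 hz).2.ne _ _
  refine ⟨⟨?_, ?_, ?_, ?_⟩, hr.nodup, ?_, ?_⟩
  · rw [hins]
    intro y hy
    rcases Finset.mem_insert.1 hy with rfl | hy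
    · simpa using .inr (Finset.mem_Ico.1 hz)
    · rw [hne y hy]
      exact Finset.mem_insert_of_mem (hr.mem y hy)
  · rw [hins]
    intro y hy
    rcases Finset.mem_insert.1 hy with rfl | hy
    · rw [Function.update_self, hne z hz, hc]
    · rw [hne y hy, hne _ (hr.mem y hy), hr.idem y hy]
  · rw [hins]
    intro y hy
    rcases Finset.mem_insert.1 hy with rfl | hy
    · simpa using hd
    · rw [hne y hy]
      exact hr.close y hy
  · rw [hins]
    intro y hy z' hz' hcy hcz hyz
    rcases Finset.mem_insert.1 hy with rfl | hy
    · rw [Function.update_self] at hcy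
      exact absurd hcy hzi
    rcases Finset.mem_insert.1 hz' with rfl | hz'
    · rw [Function.update_self] at hcz
      exact absurd hcz hzi
    rw [hne y hy] at hcy
    rw [hne z' hz'] at hcz
    exact hr.sep y hy z' hz' hcy hcz hyz
  · intro w hwn z'
    rw [hr.mem_ch _ hwn, hins, Finset.mem_insert]
    by_cases hz' : z' = i
    · subst hz'
      simp [hzi]
    · simp [hz']
  · rw [hins, Finset.filter_insert, if_neg (by simpa using hzi), hr.cnt_eq]
    congr 1
    exact Finset.filter_congr fun z hz => by rw [hne z hz]

/-- Each new center belongs to the cell of exactly one coarse center, so lists of different cells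
are disjoint. -/
lemma IsRefining.nodup_flatMap (h : IsNet pt n (2 * t) c fr)
    (hr : IsRefining pt n t c i c₂ ch cnt) {y : ℕ} (hy : y ∈ Finset.Ico 1 (n + 1)) :
    ((fr y).flatMap ch).Nodup := by
  have hm : ∀ w ∈ fr y, w ∈ Finset.Ico 1 (n + 1) := fun w hw => ((h.mem_fr y hy w).1 hw).1
  refine List.nodup_flatMap.2 ⟨fun w hw => hr.nodup w (hm w hw),
    (h.nodup y hy).imp_of_mem fun {w w'} hw hw' hww => ?_⟩
  intro z hz hz'
  exact hww (((hr.mem_ch w (hm w hw) z).1 hz).2.2.symm.trans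
    ((hr.mem_ch w' (hm w' hw') z).1 hz').2.2)

lemma IsRefining.isNet (h : IsNet pt n (2 * t) c fr)
    (hr : IsRefining pt n t c (n + 1) c₂ ch cnt) {fr₂ : ℕ → List ℕ}
    (hf : ∀ y ∈ Finset.Ico 1 (n + 1), (fr₂ y).Nodup ∧ ∀ z, z ∈ fr₂ y ↔
      z ∈ (fr y).flatMap ch ∧ dist (pt y) (pt z) ≤ 4 * t) : IsNet pt n t c₂ fr₂ := by
  refine ⟨hr.toIsCentering, fun y hy => (hf y hy).1, fun y hy z => ?_⟩
  rw [(hf y hy).2]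
  constructor
  · rintro ⟨hz, hd⟩
    obtain ⟨h1, h2⟩ := hr.of_mem_flatMap h hy hz
    exact ⟨h1, h2, hd⟩
  · rintro ⟨hz, hc, hd⟩
    exact ⟨hr.mem_flatMap h le_rfl hy hz hc hd, hd⟩

lemma IsNet.congr {c' : ℕ → ℕ} {fr' : ℕ → List ℕ} (h : IsNet pt n t c fr)
    (hc : ∀ y ∈ Finset.Ico 1 (n + 1), c' y = c y)
    (hf : ∀ y ∈ Finset.Ico 1 (n + 1), fr' y = fr y) : IsNet pt n t c' fr' := by
  refine ⟨⟨fun y hy => ?_, fun y hy => ?_, fun y hy => ?_, fun y hy z hz hcy hcz hyz => ?_⟩,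
    fun y hy => ?_, fun y hy z => ?_⟩
  · rw [hc y hy]; exact h.mem y hy
  · rw [hc y hy, hc _ (h.mem y hy)]; exact h.idem y hy
  · rw [hc y hy]; exact h.close y hy
  · rw [hc y hy] at hcy
    rw [hc z hz] at hcz
    exact h.sep y hy z hz hcy hcz hyz
  · rw [hf y hy]; exact h.nodup y hy
  · rw [hf y hy, h.mem_fr y hy]
    exact and_congr_right fun hz => by rw [hc z hz]

end Nets

namespace ListMachine

open RealRAM (Oracle)

/-! ### The computation of nets -/

/-- The successor of a variable. -/
abbrev NE.succ (v : NVar) : NE := .add (.var v) (.lit 1)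

/-- The distance of two points of `Y`. -/
abbrev RE.distY (y z : NE) : RE := .dY (.sub y (.lit 1)) (.sub z (.lit 1))

/-- The loop over the new centers in the neighbouring cells of the point `y`. -/
def nearLoop (c : Cmd) : Cmd :=
  .forIn .l1 (.get .fr (.var .y)) (.forIn .l2 (.get .ch (.hd .l1)) c)

/-- Looking for a center close to `y`. -/
def findCenter : Cmd :=
  nearLoop (.ite (.leR (.distY (.var .y) (.hd .l2)) (.var .t)) (.put .found (.hd .l2)) .skip)

/-- Assigning the point `y` to a center. -/
def assignCenter : Cmd :=
  .blk [.put .found (.lit 0), findCenter,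
    .ite (.leN (.var .found) (.lit 0))
      (.blk [.setN .cen2 (.var .y) (.var .y),
        .cons .ch (.get .cen (.var .y)) (.var .y) (.get .ch (.get .cen (.var .y))),
        .put .cnt (.succ .cnt)])
      (.setN .cen2 (.var .y) (.var .found))]

/-- Listing the centers close to `y`. -/
def listCenters : Cmd :=
  .blk [.setL .fr2 (.var .y) .nil,
    nearLoop (.ite (.leR (.distY (.var .y) (.hd .l2)) (.mul (.ofNat (.lit 4)) (.var .t)))
      (.cons .fr2 (.var .y) (.hd .l2) (.get .fr2 (.var .y))) .skip)]

/-- The loop over all points of `Y`. -/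
abbrev forY (c : Cmd) : Cmd := .forTo .y (.lit 1) (.succ .n) c

/-- Halving the scale of a net. -/
def refineNet : Cmd :=
  .blk [.setR .t (.div (.var .t) (.ofNat (.lit 2))),
    forY (.setL .ch (.var .y) .nil),
    .put .cnt (.lit 0),
    forY assignCenter,
    forY listCenters,
    forY (.blk [.setN .cen (.var .y) (.get .cen2 (.var .y)),
      .setL .fr (.var .y) (.get .fr2 (.var .y))])]

/-- Computing a net at the scale `ρ * d`. -/
def buildNet : Cmd :=
  .blk [.setR .t (.ofNat (.lit 0)),
    forY (.ite (.leR (.var .t) (.dY (.lit 0) (.sub (.var .y) (.lit 1))))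
      (.setR .t (.dY (.lit 0) (.sub (.var .y) (.lit 1)))) .skip),
    .setR .t (.add (.var .t) (.mul (.var .rho) (.var .d))),
    forY (.blk [.setN .cen (.var .y) (.lit 1), .cons .fr (.var .y) (.lit 1) .nil]),
    .put .cnt (.lit 1),
    .while (.and (.leR (.mul (.var .rho) (.var .d)) (.div (.var .t) (.ofNat (.lit 2))))
      (.leN (.succ .cnt) (.var .n))) refineNet]

variable {o : Oracle} {q : ℕ}

/-- The nested loops are presented as one loop over a concatenated list, so that the invariant
refers to a single prefix. It must not depend on the loop variables `l1` and `l2`. -/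
lemma wp_nearLoop {c : Cmd} {m : Mem} (I : List ℕ → Mem → Prop) (F C T : ℕ)
    (h1 : c.writesL .l1 = false) (h2 : c.writesL .l2 = false) (h3 : c.writesL .ch = false)
    (hF : (m.L .fr (m.N .y 0)).length ≤ F)
    (hC : ∀ w ∈ m.L .fr (m.N .y 0), (m.L .ch w).length ≤ C)
    (hI₁ : ∀ l m' x, I l m' → I l (m'.setL .l1 0 x))
    (hI₂ : ∀ l m' x, I l m' → I l (m'.setL .l2 0 x))
    (h₀ : I [] m)
    (step : ∀ l₁ z l₂ m', (m.L .fr (m.N .y 0)).flatMap (m.L .ch) = l₁ ++ z :: l₂ →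
      SameOff (nearLoop c) m m' → (m'.L .l2 0).headD 0 = z → I l₁ m' →
      wp o q c m' fun t m'' => t ≤ T ∧ I (l₁ ++ [z]) m'') :
    wp o q (nearLoop c) m fun t m' => t ≤ F * (C * (T + 2) + 4) + 2 ∧
      I ((m.L .fr (m.N .y 0)).flatMap (m.L .ch)) m' := by
  have hch : (nearLoop c).writesL .ch = false := by
    simp [nearLoop, Cmd.writesL, Cmd.forIn, h3]
  refine (wp_forIn (fun l m' => I (l.flatMap (m.L .ch)) m') (C * (T + 2) + 2) ?_
    (m.L .fr (m.N .y 0)) rfl (hI₁ _ _ _ h₀) ?_).mono ?_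
  · simp [Cmd.writesL, Cmd.forIn, h1]
  · intro l₁ w l₂ m₁ hl hs hw hI
    refine (wp_forIn (fun l m' => I (l₁.flatMap (m.L .ch) ++ l) m') T h2 (m.L .ch w) ?_
      (by simpa using hI₂ _ _ _ hI) ?_).mono ?_
    · simp only [LE.eval, NE.eval, hw, List.headD_cons, hs.L .ch hch]
    · intro k₁ z k₂ m₂ hk hs₂ hz hI'
      refine (step (l₁.flatMap (m.L .ch) ++ k₁) z (k₂ ++ l₂.flatMap (m.L .ch)) m₂ ?_ ?_ ?_
        hI').mono ?_
      · simp [hl, hk]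
      · exact hs.trans (hs₂.mono (by simp +contextual [Cmd.writesN, Cmd.forIn])
          (by simp +contextual [Cmd.writesR, Cmd.forIn])
          (by simp +contextual [Cmd.writesL, Cmd.forIn]))
      · simp [hz]
      · rintro t m₃ - ⟨ht, hI''⟩
        exact ⟨ht, hI₂ _ _ _ (by simpa using hI'')⟩
    · rintro t m₂ - ⟨ht, hI'⟩
      refine ⟨ht.trans ?_, hI₁ _ _ _ (by simpa using hI')⟩
      gcongr
      exact hC w (by simp [hl])
  · rintro t m' - ⟨ht, hI⟩
    refine ⟨ht.trans ?_, hI⟩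
    have : C * (T + 2) + 2 + 2 = C * (T + 2) + 4 := rfl
    rw [this]
    gcongr

variable {Y : Type*} [MetricSpace Y] {pt : ℕ → Y} {n : ℕ} {B : ℕ} {m : Mem}

/-- Points are numbered from `1`, which leaves `0` free to say that no center is close. -/
lemma wp_findCenter (hY : Represents o.distY pt n) (h0 : m.N .found 0 = 0)
    (hy : m.N .y 0 ∈ Finset.Ico 1 (n + 1)) {F C : ℕ}
    (hF : (m.L .fr (m.N .y 0)).length ≤ F) (hC : ∀ w ∈ m.L .fr (m.N .y 0), (m.L .ch w).length ≤ C)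
    (hn : ∀ z ∈ (m.L .fr (m.N .y 0)).flatMap (m.L .ch), z ∈ Finset.Ico 1 (n + 1)) :
    wp o q findCenter m fun t m' => t ≤ F * (C * 4 + 4) + 2 ∧
      ((m'.N .found 0 = 0 ∧ ∀ z ∈ (m.L .fr (m.N .y 0)).flatMap (m.L .ch),
        m.R .t < dist (pt (m.N .y 0)) (pt z)) ∨
      (m'.N .found 0 ∈ (m.L .fr (m.N .y 0)).flatMap (m.L .ch) ∧
        dist (pt (m.N .y 0)) (pt (m'.N .found 0)) ≤ m.R .t)) := by
  let J : List ℕ → Mem → Prop := fun l m' =>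
    (m'.N .found 0 = 0 ∧ ∀ z ∈ l, m.R .t < dist (pt (m.N .y 0)) (pt z)) ∨
      (m'.N .found 0 ∈ (m.L .fr (m.N .y 0)).flatMap (m.L .ch) ∧
        dist (pt (m.N .y 0)) (pt (m'.N .found 0)) ≤ m.R .t)
  refine wp_nearLoop J F C 2 rfl rfl rfl hF hC (fun _ _ _ h => h) (fun _ _ _ h => h)
    (.inl ⟨h0, by simp⟩) fun l₁ z l₂ m' hl hs hz hI => ?_
  have hzm : z ∈ (m.L .fr (m.N .y 0)).flatMap (m.L .ch) := by simp [hl]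
  have ey : m'.N .y = m.N .y := hs.N _ rfl
  have et : m'.R .t = m.R .t := hs.R _ rfl
  simp only [wp_ite, wp_setN, wp_skip, BE.Holds, RE.eval, NE.eval, hz, ey, et,
    hY.dist_eq _ _ hy (hn z hzm)]
  refine ⟨fun h => ⟨le_rfl, .inr ⟨by simpa using hzm, by simpa using h⟩⟩,
    fun h => ⟨le_rfl, hI.imp_left fun hI => ⟨hI.1, fun w hw => ?_⟩⟩⟩
  rcases List.mem_append.1 hw with hw | hw
  · exact hI.2 w hw
  · rw [List.mem_singleton.1 hw]
    exact not_le.1 h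

lemma wp_assignCenter (hY : Represents o.distY pt n) (hB : IsDoublingConst Y B)
    (hy : m.N .y 0 ∈ Finset.Ico 1 (n + 1))
    (hnet : IsNet pt n (2 * m.R .t) (m.N .cen) (m.L .fr))
    (hr : IsRefining pt n (m.R .t) (m.N .cen) (m.N .y 0) (m.N .cen2) (m.L .ch) (m.N .cnt 0)) :
    wp o q assignCenter m fun t m' => t ≤ B ^ 3 * (B ^ 2 * 4 + 4) + 9 ∧
      IsRefining pt n (m.R .t) (m.N .cen) (m.N .y 0 + 1) (m'.N .cen2) (m'.L .ch)
        (m'.N .cnt 0) := by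
  have hy' := Finset.mem_Ico.1 hy
  have hn : ∀ z ∈ (m.L .fr (m.N .y 0)).flatMap (m.L .ch), z ∈ Finset.Ico 1 (m.N .y 0) ∧
      m.N .cen2 z = z := fun z hz => hr.of_mem_flatMap hnet hy hz
  simp only [assignCenter, wp_blk_cons, wp_blk_nil, wp_setN, NE.eval]
  refine (wp_findCenter (m := m.setN .found 0 0) hY (by simp) (by simpa using hy)
    (F := B ^ 3) (C := B ^ 2) (by simpa using hnet.length_le hB hy)
    (fun w hw => by
      simpa using hr.length_le hB hnet hy'.2.le ((hnet.mem_fr _ hy w).1 (by simpa using hw)).1) (by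
      intro z hz
      exact Finset.Ico_subset_Ico_right hy'.2.le (hn z (by simpa using hz)).1)).mono ?_
  rintro t m' hs ⟨ht, h⟩
  have e1 : m'.N .y = m.N .y := hs.N _ rfl
  have e2 : m'.N .cen = m.N .cen := hs.N _ rfl
  have e3 : m'.N .cen2 = m.N .cen2 := hs.N _ rfl
  have e4 : m'.N .cnt = m.N .cnt := hs.N _ rfl
  have e5 : m'.L .ch = m.L .ch := hs.L _ rfl
  simp only [wp_ite, wp_blk_cons, wp_blk_nil, wp_setN, wp_cons, NE.eval, LE.eval, BE.Holds,
    Mem.N_setN_self, ne_eq, reduceCtorEq, not_false_eq_true, Mem.N_setN_ne, Mem.L_setN,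
    Mem.N_setL, Mem.L_setL_self, e1, e2, e3, e4, e5, Nat.le_zero, Function.update_self] at h ⊢
  rcases h with ⟨h0, hf⟩ | ⟨hf, hd⟩
  · rw [h0]
    refine ⟨fun _ => ⟨by omega, ?_⟩, fun h => absurd rfl h⟩
    exact hr.center hnet hy hf
  · obtain ⟨h1, h2⟩ := hn _ hf
    have h3 := (Finset.mem_Ico.1 h1).1
    refine ⟨fun h => absurd h (by omega), fun _ => ⟨by omega, ?_⟩⟩
    exact hr.assign hy'.1 h1 h2 hd

lemma wp_listCenters (hY : Represents o.distY pt n) (hB : IsDoublingConst Y B)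
    (hy : m.N .y 0 ∈ Finset.Ico 1 (n + 1))
    (hnet : IsNet pt n (2 * m.R .t) (m.N .cen) (m.L .fr)) {c₂ : ℕ → ℕ} {cnt : ℕ}
    (hr : IsRefining pt n (m.R .t) (m.N .cen) (n + 1) c₂ (m.L .ch) cnt) :
    wp o q listCenters m fun t m' => t ≤ B ^ 3 * (B ^ 2 * 4 + 4) + 4 ∧
      (m'.L .fr2 (m.N .y 0)).Nodup ∧ (∀ z, z ∈ m'.L .fr2 (m.N .y 0) ↔
        z ∈ (m.L .fr (m.N .y 0)).flatMap (m.L .ch) ∧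
          dist (pt (m.N .y 0)) (pt z) ≤ 4 * m.R .t) ∧
      ∀ y, y ≠ m.N .y 0 → m'.L .fr2 y = m.L .fr2 y := by
  classical
  have hn : ∀ z ∈ (m.L .fr (m.N .y 0)).flatMap (m.L .ch), z ∈ Finset.Ico 1 (n + 1) :=
    fun z hz => (hr.of_mem_flatMap hnet hy hz).1
  simp only [listCenters, wp_blk_cons, wp_blk_nil, wp_setL, NE.eval, LE.eval]
  let J : List ℕ → Mem → Prop := fun l m' =>
    m'.L .fr2 (m.N .y 0) =
      (l.filter fun z => dist (pt (m.N .y 0)) (pt z) ≤ 4 * m.R .t).reverse ∧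
    ∀ y, y ≠ m.N .y 0 → m'.L .fr2 y = m.L .fr2 y
  refine (wp_nearLoop (m := m.setL .fr2 (m.N .y 0) []) J (B ^ 3) (B ^ 2) 2 rfl rfl rfl
    (by simpa using hnet.length_le hB hy) (fun w hw => by
      simpa using hr.length_le hB hnet le_rfl ((hnet.mem_fr _ hy w).1 (by simpa using hw)).1)
    (fun _ _ _ h => by simpa [J] using h) (fun _ _ _ h => by simpa [J] using h)
    (by simp +contextual [J]) fun l₁ z l₂ m' hl hs hz hI => ?_).mono ?_
  · have hzm : z ∈ (m.L .fr (m.N .y 0)).flatMap (m.L .ch) := by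
      have : z ∈ l₁ ++ z :: l₂ := by simp
      rw [← hl] at this
      simpa using this
    have ey : m'.N .y = m.N .y := hs.N _ rfl
    have et : m'.R .t = m.R .t := hs.R _ rfl
    simp only [wp_ite, wp_cons, wp_skip, BE.Holds, RE.eval, NE.eval, LE.eval, hz, ey, et,
      hY.dist_eq _ _ hy (hn z hzm), Nat.cast_ofNat]
    refine ⟨fun h => ⟨le_rfl, ?_, fun y hy' => ?_⟩, fun h => ⟨le_rfl, ?_, hI.2⟩⟩
    · simp [hI.1, h]
    · simp [hy', hI.2 y hy']
    · simp [hI.1, h]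
  · rintro t m' - ⟨ht, hI, hI'⟩
    simp only [Mem.N_setL, ne_eq, reduceCtorEq, not_false_eq_true, Mem.L_setL_ne] at hI
    have ht' : t ≤ B ^ 3 * (B ^ 2 * 4 + 4) + 2 := ht
    refine ⟨by omega, ?_, fun z => ?_, hI'⟩
    · rw [hI]
      exact List.nodup_reverse.2 ((hr.nodup_flatMap hnet hy).filter _)
    · rw [hI]
      simp

lemma wp_refineNet (hY : Represents o.distY pt n) (hB : IsDoublingConst Y B)
    (hn : m.N .n 0 = n) (hnet : IsNet pt n (m.R .t) (m.N .cen) (m.L .fr)) :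
    wp o q refineNet m fun t m' => t ≤ n * (2 * (B ^ 3 * (B ^ 2 * 4 + 4)) + 30) + 12 ∧
      m'.R .t = m.R .t / 2 ∧ IsNet pt n (m'.R .t) (m'.N .cen) (m'.L .fr) ∧
      m'.N .cnt 0 = ((Finset.Ico 1 (n + 1)).filter fun y => m'.N .cen y = y).card := by
  simp only [refineNet, wp_blk_cons, wp_blk_nil, wp_setR, wp_setN, NE.eval, RE.eval,
    Nat.cast_ofNat]
  set m₁ := m.setR .t (m.R .t / 2) with hm₁
  have hn₁ : m₁.N .n 0 = n := hn
  have ht₁ : m₁.R .t = m.R .t / 2 := by simp [hm₁]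
  -- The scale variable has already been halved, so the present net is one at scale `2 * t`.
  have hnet₁ : IsNet pt n (2 * m₁.R .t) (m₁.N .cen) (m₁.L .fr) := by
    rw [ht₁, mul_div_cancel₀ _ two_ne_zero]
    simpa [hm₁] using hnet
  clear_value m₁
  refine (wp_forTo (fun i m' => ∀ w ∈ Finset.Ico 1 i, m'.L .ch w = []) 1 (n + 1) 1 rfl rfl
    (fun m' hs => by simp [hs.N .n rfl, hn₁]) (by omega) (by simp) ?_).mono ?_
  · intro i m' hs hi hi' hy hI
    simp only [wp_setL, NE.eval, hy, LE.eval]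
    refine ⟨le_rfl, fun w hw => ?_⟩
    by_cases hwi : w = i
    · simp [hwi]
    · simp only [Finset.mem_Ico] at hw hI
      simpa [hwi] using hI w (by omega)
  rintro t₂ m₂ hs₂ ⟨ht₂, hch⟩
  have hn₂ : m₂.N .n 0 = n := by rw [hs₂.N .n rfl, hn₁]
  have hc₂ : m₂.N .cen = m₁.N .cen := hs₂.N _ rfl
  have hf₂ : m₂.L .fr = m₁.L .fr := hs₂.L _ rfl
  have hr₂ : m₂.R .t = m₁.R .t := hs₂.R _ rfl
  refine (wp_forTo (fun i m' => IsRefining pt n (m₁.R .t) (m₁.N .cen) i (m'.N .cen2) (m'.L .ch)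
    (m'.N .cnt 0)) 1 (n + 1) (B ^ 3 * (B ^ 2 * 4 + 4) + 9) rfl rfl
    (fun m' hs => by simp [hs.N .n rfl, hn₂]) (by omega) ?_ ?_).mono ?_
  · simpa using IsRefining.zero _ _ _ _ hch
  · intro i m' hs hi hi' hy hI
    have e1 : m'.N .cen = m₁.N .cen := (hs.N .cen rfl).trans (by simpa using hc₂)
    have e2 : m'.L .fr = m₁.L .fr := (hs.L .fr rfl).trans (by simpa using hf₂)
    have e3 : m'.R .t = m₁.R .t := (hs.R .t rfl).trans (by simpa using hr₂)
    refine (wp_assignCenter hY hB (by simp [hy]; omega) (by rwa [e1, e2, e3])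
      (by rwa [e1, e3, hy])).mono ?_
    rintro t m'' - ⟨ht, h⟩
    rw [e1, e3, hy] at h
    exact ⟨ht, by simpa using h⟩
  rintro t₃ m₃ hs₃ ⟨ht₃, hr⟩
  have hn₃ : m₃.N .n 0 = n := by rw [hs₃.N .n rfl]; simpa using hn₂
  have hc₃ : m₃.N .cen = m₁.N .cen := (hs₃.N .cen rfl).trans (by simpa using hc₂)
  have hf₃ : m₃.L .fr = m₁.L .fr := (hs₃.L .fr rfl).trans (by simpa using hf₂)
  have hr₃ : m₃.R .t = m₁.R .t := (hs₃.R .t rfl).trans (by simpa using hr₂)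
  refine (wp_forTo (fun i m' => ∀ y ∈ Finset.Ico 1 i, (m'.L .fr2 y).Nodup ∧
    ∀ z, z ∈ m'.L .fr2 y ↔ z ∈ (m₁.L .fr y).flatMap (m₃.L .ch) ∧
      dist (pt y) (pt z) ≤ 4 * m₁.R .t) 1 (n + 1) (B ^ 3 * (B ^ 2 * 4 + 4) + 4) rfl rfl
    (fun m' hs => by simp [hs.N .n rfl, hn₃]) (by omega) (by simp) ?_).mono ?_
  · intro i m' hs hi hi' hy hI
    have e1 : m'.N .cen = m₁.N .cen := (hs.N .cen rfl).trans hc₃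
    have e2 : m'.L .fr = m₁.L .fr := (hs.L .fr rfl).trans hf₃
    have e3 : m'.R .t = m₁.R .t := (hs.R .t rfl).trans hr₃
    have e4 : m'.L .ch = m₃.L .ch := hs.L .ch rfl
    refine (wp_listCenters hY hB (by simp [hy]; omega) (by rwa [e1, e2, e3])
      (by rw [e1, e3, e4]; exact hr)).mono ?_
    rintro t m'' - ⟨ht, h1, h2, h3⟩
    rw [e2, e3, e4, hy] at h2
    rw [hy] at h1 h3
    refine ⟨ht, fun y hy' => ?_⟩
    by_cases hyi : y = i
    · subst hyi
      exact ⟨h1, h2⟩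
    · simp only [Finset.mem_Ico] at hy' hI
      rw [Mem.L_setN, h3 y hyi]
      exact hI y (by omega)
  rintro t₄ m₄ hs₄ ⟨ht₄, hfr⟩
  have hn₄ : m₄.N .n 0 = n := by rw [hs₄.N .n rfl]; exact hn₃
  have hr₄ : m₄.R .t = m₁.R .t := (hs₄.R .t rfl).trans hr₃
  have hcen : m₄.N .cen2 = m₃.N .cen2 := hs₄.N _ rfl
  have hcnt : m₄.N .cnt = m₃.N .cnt := hs₄.N _ rfl
  have hfinal := hr.isNet hnet₁ hfr
  refine (wp_forTo (fun i m' => ∀ y ∈ Finset.Ico 1 i, m'.N .cen y = m₃.N .cen2 y ∧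
    m'.L .fr y = m₄.L .fr2 y) 1 (n + 1) 3 rfl rfl
    (fun m' hs => by simp [hs.N .n rfl, hn₄]) (by omega) (by simp) ?_).mono ?_
  · intro i m' hs hi hi' hy hI
    have e1 : m'.N .cen2 = m₃.N .cen2 := (hs.N .cen2 rfl).trans hcen
    have e2 : m'.L .fr2 = m₄.L .fr2 := hs.L .fr2 rfl
    simp only [wp_blk_cons, wp_blk_nil, wp_setN, wp_setL, NE.eval, LE.eval, hy, e1]
    refine ⟨by omega, fun y hy' => ?_⟩
    by_cases hyi : y = i
    · subst hyi
      simp [hy, e2]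
    · simp only [Finset.mem_Ico] at hy' hI
      have := hI y (by omega)
      simpa [hyi, hy] using this
  · rintro t₅ m₅ hs₅ ⟨ht₅, h⟩
    have e3 : m₅.R .t = m₁.R .t := (hs₅.R .t rfl).trans hr₄
    refine ⟨?_, e3.trans ht₁, ?_, ?_⟩
    · simp only [add_tsub_cancel_right] at ht₂ ht₃ ht₄ ht₅
      nlinarith
    · rw [e3]
      exact hfinal.congr (fun y hy => (h y hy).1) fun y hy => (h y hy).2
    · rw [hs₅.N .cnt rfl, hcnt, hr.cnt_eq]
      congr 1
      exact Finset.filter_congr fun y hy => by rw [(h y hy).1]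

/-- A net at the scale `r`: neighbours within distance `2 * r` are listed, and cells have radius
at most `2 * r`. -/
structure IsNetAt (pt : ℕ → Y) (n : ℕ) (r : ℝ) (c : ℕ → ℕ) (fr : ℕ → List ℕ) (B : ℕ) : Prop where
  mem : ∀ y ∈ Finset.Ico 1 (n + 1), c y ∈ Finset.Ico 1 (n + 1)
  near : ∀ y ∈ Finset.Ico 1 (n + 1), ∀ z ∈ Finset.Ico 1 (n + 1),
    dist (pt y) (pt z) ≤ 2 * r → c z ∈ fr y
  mem_of_mem_fr : ∀ y ∈ Finset.Ico 1 (n + 1), ∀ z ∈ fr y, z ∈ Finset.Ico 1 (n + 1)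
  cell : ∀ y ∈ Finset.Ico 1 (n + 1), dist (pt y) (pt (c y)) ≤ 2 * r
  length_le : ∀ y ∈ Finset.Ico 1 (n + 1), (fr y).length ≤ B ^ 3

lemma wp_buildNet (hY : Represents o.distY pt n) (hB : IsDoublingConst Y B)
    (hn : m.N .n 0 = n) (h1n : 1 ≤ n) {e D : ℝ} {L : ℕ}
    (hD : ∀ y ∈ Finset.Ico 1 (n + 1), ∀ z ∈ Finset.Ico 1 (n + 1), dist (pt y) (pt z) ≤ D)
    (he : ∀ y ∈ Finset.Ico 1 (n + 1), ∀ z ∈ Finset.Ico 1 (n + 1), y ≠ z →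
      e ≤ dist (pt y) (pt z))
    (hL : ∀ i : ℕ, 2 ^ i * e ≤ 2 * D → i < L) (hr : 0 ≤ m.R .rho * m.R .d) :
    wp o q buildNet m fun t m' =>
      t ≤ n * 10 + 20 + L * (n * (2 * (B ^ 3 * (B ^ 2 * 4 + 4)) + 30) + 13) ∧
      IsNetAt pt n (m.R .rho * m.R .d) (m'.N .cen) (m'.L .fr) B := by
  set r := m.R .rho * m.R .d with hr_def
  have h1 : 1 ∈ Finset.Ico 1 (n + 1) := by simp; omega
  have hD0 : 0 ≤ D := by simpa using hD 1 h1 1 h1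
  simp only [buildNet, wp_blk_cons, wp_blk_nil, wp_setR, wp_setN, NE.eval, RE.eval,
    Nat.cast_zero]
  refine (wp_forTo (fun i m' => 0 ≤ m'.R .t ∧ m'.R .t ≤ D ∧
    ∀ y ∈ Finset.Ico 1 i, dist (pt 1) (pt y) ≤ m'.R .t) 1 (n + 1) 2 rfl rfl
    (fun m' hs => by simp [hs.N .n rfl, hn]) (by omega) (by simp [hD0]) ?_).mono ?_
  · rintro i m' hs hi hi' hy ⟨hI0, hI1, hI⟩
    have hyi : i ∈ Finset.Ico 1 (n + 1) := Finset.mem_Ico.2 ⟨hi, hi'⟩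
    have hd := hY.dist_eq 1 i h1 hyi
    rw [Nat.sub_self] at hd
    simp only [wp_ite, wp_setR, wp_skip, BE.Holds, RE.eval, NE.eval, hy, hd, Mem.R_setN,
      Mem.R_setR_self]
    refine ⟨fun h => ⟨le_rfl, dist_nonneg, hD 1 h1 i hyi, fun y hy' => ?_⟩,
      fun h => ⟨le_rfl, hI0, hI1, fun y hy' => ?_⟩⟩
    · by_cases hyi : y = i
      · rw [hyi]
      · simp only [Finset.mem_Ico] at hy' hI
        exact (hI y (by omega)).trans h
    · by_cases hyi : y = i
      · rw [hyi]
        exact (not_le.1 h).le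
      · simp only [Finset.mem_Ico] at hy' hI
        exact hI y (by omega)
  rintro t₁ m₁ hs₁ ⟨ht₁, hp, hle, hfar⟩
  have hn₁ : m₁.N .n 0 = n := by rw [hs₁.N .n rfl]; exact hn
  have er : m₁.R .rho = m.R .rho := (hs₁.R .rho rfl).trans (by simp)
  have ed : m₁.R .d = m.R .d := (hs₁.R .d rfl).trans (by simp)
  rw [er, ed, ← hr_def]
  -- Point `1` alone is a net at this scale. The summand `r` makes the invariant `r ≤ t` true at the
  -- start.
  set t₀ := m₁.R .t + r with ht₀
  refine (wp_forTo (fun i m' => ∀ y ∈ Finset.Ico 1 i, m'.N .cen y = 1 ∧ m'.L .fr y = [1])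
    1 (n + 1) 3 rfl rfl (fun m' hs => by simp [hs.N .n rfl, hn₁]) (by omega) (by simp) ?_).mono ?_
  · intro i m' hs hi hi' hy hI
    simp only [wp_blk_cons, wp_blk_nil, wp_setN, wp_cons, NE.eval, LE.eval, hy]
    refine ⟨by omega, fun y hy' => ?_⟩
    by_cases hyi : y = i
    · subst hyi
      simp [hy]
    · simp only [Finset.mem_Ico] at hy' hI
      have := hI y (by omega)
      simpa [hyi, hy] using this
  rintro t₂ m₂ hs₂ ⟨ht₂, hinit⟩
  have hn₂ : m₂.N .n 0 = n := by rw [hs₂.N .n rfl]; exact hn₁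
  have er₂ : m₂.R .rho = m.R .rho := (hs₂.R .rho rfl).trans (by simpa using er)
  have ed₂ : m₂.R .d = m.R .d := (hs₂.R .d rfl).trans (by simpa using ed)
  have et₂ : m₂.R .t = t₀ := (hs₂.R .t rfl).trans (by simp)
  have hnet₀ : IsNet pt n t₀ (m₂.N .cen) (m₂.L .fr) := by
    refine IsNet.congr (c := fun _ => 1) (fr := fun _ => [1]) ?_ (fun y hy => (hinit y hy).1)
      fun y hy => (hinit y hy).2
    have hc : ∀ y ∈ Finset.Ico 1 (n + 1), dist (pt y) (pt 1) ≤ t₀ := fun y hy => by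
      rw [dist_comm]
      linarith [hfar y hy]
    refine ⟨⟨fun _ _ => h1, fun _ _ => rfl, hc, ?_⟩, by simp, fun y hy z => ?_⟩
    · rintro y - z - rfl rfl h
      exact absurd rfl h
    · rw [List.mem_singleton]
      constructor
      · rintro rfl
        exact ⟨h1, rfl, by linarith [hc y hy]⟩
      · exact fun h => h.2.1.symm
  let I : ℕ → Mem → Prop := fun i m' => m'.R .t * 2 ^ i = t₀ ∧ r ≤ m'.R .t ∧
    IsNet pt n (m'.R .t) (m'.N .cen) (m'.L .fr) ∧
    m'.N .cnt 0 = ((Finset.Ico 1 (n + 1)).filter fun y => m'.N .cen y = y).card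
  refine (wp_while I L (n * (2 * (B ^ 3 * (B ^ 2 * 4 + 4)) + 30) + 12) ?_ ?_).mono ?_
  · refine ⟨by simp [et₂], by simp [et₂]; linarith, by simpa [et₂] using hnet₀, ?_⟩
    have : ((Finset.Ico 1 (n + 1)).filter fun y => (m₂.setN .cnt 0 1).N .cen y = y) = {1} := by
      ext y
      simp only [Finset.mem_filter, Finset.mem_singleton, ne_eq, reduceCtorEq,
        not_false_eq_true, Mem.N_setN_ne]
      constructor
      · rintro ⟨hy, h⟩
        rw [← h, (hinit y hy).1]
      · rintro rfl
        exact ⟨h1, (hinit 1 h1).1⟩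
    rw [this]
    simp
  · rintro i m' hs ⟨hti, hri, hnet, hcnt⟩ hb
    have e1 : m'.N .n 0 = n := by rw [hs.N .n rfl]; exact hn₂
    have e2 : m'.R .rho = m.R .rho := (hs.R .rho rfl).trans er₂
    have e3 : m'.R .d = m.R .d := (hs.R .d rfl).trans ed₂
    simp only [BE.Holds, RE.eval, NE.eval, e1, e2, e3, Nat.cast_ofNat, ← hr_def] at hb
    obtain ⟨hb1, hb2⟩ := hb
    -- As there are fewer than `n` centers, some point differs from its center, and their distance
    -- shows that `e ≤ t`.
    have hex : ∃ y ∈ Finset.Ico 1 (n + 1), m'.N .cen y ≠ y := by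
      by_contra! hall
      rw [Finset.filter_true_of_mem hall] at hcnt
      simp at hcnt
      omega
    obtain ⟨y, hy, hne⟩ := hex
    have het : e ≤ m'.R .t := (he y hy _ (hnet.mem y hy) hne.symm).trans (hnet.close y hy)
    have h2 : (1 : ℝ) ≤ 2 ^ i := one_le_pow₀ one_le_two
    refine ⟨hL i ?_, ?_⟩
    -- From `t * 2 ^ i = t₀ ≤ D + r` and `r ≤ t / 2` follows `2 ^ i * t ≤ 2 * D`; moreover `e ≤ t`.
    · nlinarith [dist_nonneg.trans (hnet.close y hy)]
    · refine (wp_refineNet hY hB e1 hnet).mono ?_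
      rintro t m'' - ⟨ht, h3, h4, h5⟩
      refine ⟨ht, ?_, ?_, h4, h5⟩
      · rw [h3, pow_succ, ← hti]
        ring
      · rw [h3]
        exact hb1
  · rintro t₃ m₃ hs₃ ⟨ht₃, hb, i, -, hri, hnet, hcnt⟩
    have e1 : m₃.N .n 0 = n := by rw [hs₃.N .n rfl]; exact hn₂
    have e2 : m₃.R .rho = m.R .rho := (hs₃.R .rho rfl).trans er₂
    have e3 : m₃.R .d = m.R .d := (hs₃.R .d rfl).trans ed₂
    simp only [BE.Holds, RE.eval, NE.eval, e1, e2, e3, Nat.cast_ofNat, ← hr_def] at hb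
    refine ⟨?_, hnet.mem, fun y hy z hz hyz => ?_, fun y hy z hz => ((hnet.mem_fr y hy z).1 hz).1,
      fun y hy => ?_, fun y hy => hnet.length_le hB hy⟩
    · simp only [add_tsub_cancel_right] at ht₁ ht₂
      have : n * (2 * (B ^ 3 * (B ^ 2 * 4 + 4)) + 30) + 12 + 1 =
        n * (2 * (B ^ 3 * (B ^ 2 * 4 + 4)) + 30) + 13 := rfl
      rw [this] at ht₃
      omega
    -- The center of `z` is within `2 * r + t ≤ 3 * t` of `y`, inside the listing radius `4 * t`.
    · refine (hnet.mem_fr y hy _).2 ⟨hnet.mem z hz, hnet.idem z hz, ?_⟩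
      linarith [hnet.close z hz, dist_triangle (pt y) (pt z) (pt (m₃.N .cen z))]
    -- The loop stops for one of two reasons: either `t < 2 * r`, which bounds the cells, or every
    -- point is its own center and the distance is zero.
    · by_cases hrt : r ≤ m₃.R .t / 2
      · have hcn : n ≤ m₃.N .cnt 0 := by
          by_contra! h
          exact hb ⟨hrt, h⟩
        have hall : ((Finset.Ico 1 (n + 1)).filter fun y => m₃.N .cen y = y) =
            Finset.Ico 1 (n + 1) :=
          Finset.eq_of_subset_of_card_le (Finset.filter_subset _ _) (by simp; omega)
        rw [← hall] at hy
        rw [(Finset.mem_filter.1 hy).2, dist_self]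
        linarith
      · linarith [hnet.close y hy]

end ListMachine

namespace ListMachine

open RealRAM (Oracle)

/-! ### Thinning a table of partial maps

A partial map is given by its address `p`: the image of the point `a` of `X` is `img (p + a)`. -/

/-- Equality of numbers. -/
abbrev BE.eq (x y : NE) : BE := .and (.leN x y) (.leN y x)

/-- The loop in which `v` runs through the points of `X`. -/
abbrev forX (v : NVar) (c : Cmd) : Cmd := .forTo v (.lit 0) (.var .k) c

/-- The image of the point `a` under the first map in a list. -/
abbrev NE.image (v : LVar) (x : NVar) : NE := .get .img (.add (.hd v) (.var x))

/-- Testing whether two maps are close. -/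
def testNear : Cmd :=
  .blk [.put .near (.lit 1),
    forX .a (.ite (.and (.eq (.get .comp (.var .a)) (.var .c0))
      (.not (.leR (.distY (.image .l1 .a) (.image .l2 .a)) (.var .s)))) (.put .near (.lit 0)) .skip)]

/-- Thinning the table of the component `c0`: the remaining maps are put into the buckets
belonging to the centers of the images of `a0`. -/
def thin : Cmd :=
  .forIn .l1 (.get .tab (.var .c0)) (.blk [
    .put .pos (.add (.get .cen (.image .l1 .a0)) (.var .off)),
    .put .keep (.lit 1),
    .forIn .l2 (.get .bk (.var .pos))
      (.blk [testNear, .ite (.leN (.lit 1) (.var .near)) (.put .keep (.lit 0)) .skip]),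
    .ite (.leN (.lit 1) (.var .keep)) (.cons .bk (.var .pos) (.hd .l1) (.get .bk (.var .pos)))
      .skip])

/-- Two maps on the component `c` are close to each other. -/
def MapsClose {Y : Type*} [MetricSpace Y] (pt : ℕ → Y) (k : ℕ) (comp img : ℕ → ℕ) (s : ℝ)
    (c p q : ℕ) : Prop :=
  ∀ a < k, comp a = c → dist (pt (img (p + a))) (pt (img (q + a))) ≤ s

/-- `K` distributes a thinning of the list `l` of maps to buckets. -/
structure IsThinning {Y : Type*} [MetricSpace Y] (pt : ℕ → Y) (n k : ℕ) (comp img cen : ℕ → ℕ)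
    (s : ℝ) (c a : ℕ) (l : List ℕ) (K : ℕ → List ℕ) : Prop where
  sub : ∀ w ∈ Finset.Ico 1 (n + 1), ∀ p ∈ K w, p ∈ l ∧ cen (img (p + a)) = w
  far : ∀ w ∈ Finset.Ico 1 (n + 1), (K w).Pairwise fun p q => ¬ MapsClose pt k comp img s c p q
  close : ∀ p ∈ l, ∃ q ∈ K (cen (img (p + a))), MapsClose pt k comp img s c p q

variable {Y : Type*} [MetricSpace Y] {pt : ℕ → Y} {n k B : ℕ} {comp img cen : ℕ → ℕ} {s : ℝ}
  {c a : ℕ} {l : List ℕ} {K : ℕ → List ℕ}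

lemma MapsClose.symm {p q : ℕ} (h : MapsClose pt k comp img s c p q) :
    MapsClose pt k comp img s c q p := fun a ha hc => by
  rw [dist_comm]
  exact h a ha hc

lemma MapsClose.refl (hs : 0 ≤ s) (p : ℕ) : MapsClose pt k comp img s c p p := fun a _ _ => by
  simpa using hs

/-- Maps in a bucket are tuples of points in one ball around the center of the bucket, separated by
more than `s` in some coordinate. A component has at most `k` points, whence the exponent `k`. -/
lemma IsThinning.length_le (hB : IsDoublingConst Y B) (hs : 0 ≤ s)
    (h : IsThinning pt n k comp img cen s c a l K) {R : ℝ} {e : ℕ} (hR : 2 * (R / 2 ^ e) ≤ s)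
    (hball : ∀ p ∈ l, ∀ b < k, comp b = c →
      dist (pt (img (p + b))) (pt (cen (img (p + a)))) ≤ R)
    {w : ℕ} (hw : w ∈ Finset.Ico 1 (n + 1)) : (K w).length ≤ (B ^ e) ^ k := by
  have hnd : (K w).Nodup := (h.far w hw).imp fun {p q} hpq => by
    rintro rfl
    exact hpq (.refl hs _)
  have := hB.card_le (K w).toFinset ((Finset.range k).filter fun b => comp b = c)
    (fun p b => pt (img (p + b))) (pt w) R s e hR ?_ ?_
  · rw [List.toFinset_card_of_nodup hnd] at this
    refine this.trans (Nat.pow_le_pow_right ?_ ?_)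
    · have : Nonempty Y := ⟨pt 0⟩
      exact Nat.pow_pos hB.pos
    · exact (Finset.card_filter_le _ _).trans (by simp)
  · intro p hp b hb
    rw [List.mem_toFinset] at hp
    rw [Finset.mem_filter, Finset.mem_range] at hb
    obtain ⟨hpl, rfl⟩ := h.sub w hw p hp
    exact hball p hpl b hb.1 hb.2
  · intro p hp q hq hpq
    rw [List.mem_toFinset] at hp hq
    have hsymm : Std.Symm fun p q => ¬ MapsClose pt k comp img s c p q :=
      ⟨fun p q h h' => h h'.symm⟩
    have := (h.far w hw).forall hp hq hpq
    rw [MapsClose] at this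
    push Not at this
    obtain ⟨b, hb, hc, hlt⟩ := this
    exact ⟨b, by simp [hb, hc], hlt⟩

variable {o : Oracle} {q : ℕ} {m : Mem}

lemma wp_testNear (hY : Represents o.distY pt n) (hk : m.N .k 0 = k) {p p' : ℕ}
    (hp : (m.L .l1 0).headD 0 = p) (hp' : (m.L .l2 0).headD 0 = p')
    (hr : ∀ a < k, m.N .comp a = m.N .c0 0 → m.N .img (p + a) ∈ Finset.Ico 1 (n + 1))
    (hr' : ∀ a < k, m.N .comp a = m.N .c0 0 → m.N .img (p' + a) ∈ Finset.Ico 1 (n + 1)) :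
    wp o q testNear m fun t m' => t ≤ k * 4 + 4 ∧
      (1 ≤ m'.N .near 0 ↔
        MapsClose pt k (m.N .comp) (m.N .img) (m.R .s) (m.N .c0 0) p p') := by
  simp only [testNear, wp_blk_cons, wp_blk_nil, wp_setN, NE.eval]
  refine (wp_forTo (fun i m' => (1 ≤ m'.N .near 0 ↔
    MapsClose pt i (m.N .comp) (m.N .img) (m.R .s) (m.N .c0 0) p p')) 0 k 2 rfl rfl
    (fun m' hs => by simp [hs.N .k rfl, hk]) (by omega) (by simp [MapsClose]) ?_).mono ?_
  · intro i m' hs hi hi' ha hI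
    have e1 : m'.N .comp = m.N .comp := hs.N .comp rfl
    have e2 : m'.N .c0 = m.N .c0 := hs.N .c0 rfl
    have e3 : m'.N .img = m.N .img := hs.N .img rfl
    have e4 : m'.L .l1 = m.L .l1 := hs.L .l1 rfl
    have e5 : m'.L .l2 = m.L .l2 := hs.L .l2 rfl
    have e6 : m'.R .s = m.R .s := hs.R .s rfl
    have hsucc : MapsClose pt (i + 1) (m.N .comp) (m.N .img) (m.R .s) (m.N .c0 0) p p' ↔
        MapsClose pt i (m.N .comp) (m.N .img) (m.R .s) (m.N .c0 0) p p' ∧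
        (m.N .comp i = m.N .c0 0 →
          dist (pt (m.N .img (p + i))) (pt (m.N .img (p' + i))) ≤ m.R .s) := by
      constructor
      · exact fun h => ⟨fun a ha => h a (by omega), h i (by omega)⟩
      · rintro ⟨h1, h2⟩ a ha
        rcases Nat.lt_succ_iff_lt_or_eq.1 ha with ha | rfl
        · exact h1 a ha
        · exact h2
    simp only [wp_ite, wp_setN, wp_skip, BE.Holds, RE.eval, NE.eval, e1, e2, e3, e4, e5, e6, ha,
      hp, hp', ← le_antisymm_iff, hsucc]
    refine ⟨fun h => ⟨le_rfl, ?_⟩, fun h => ⟨le_rfl, ?_⟩⟩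
    · rw [hY.dist_eq _ _ (hr i hi' h.1) (hr' i hi' h.1)] at h
      have : ¬ (m.N .comp i = m.N .c0 0 →
          dist (pt (m.N .img (p + i))) (pt (m.N .img (p' + i))) ≤ m.R .s) := fun h' => h.2 (h' h.1)
      simp [this]
    · have : m.N .comp i = m.N .c0 0 →
          dist (pt (m.N .img (p + i))) (pt (m.N .img (p' + i))) ≤ m.R .s := by
        intro hc
        rw [hY.dist_eq _ _ (hr i hi' hc) (hr' i hi' hc)] at h
        by_contra h'
        exact h ⟨hc, h'⟩
      simp only [ne_eq, reduceCtorEq, not_false_eq_true, Mem.N_setN_ne]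
      exact hI.trans (and_iff_left this).symm
  · rintro t m' - ⟨ht, h⟩
    refine ⟨?_, h⟩
    have ht' : t ≤ k * 4 + 2 := ht
    omega

/-- The bound for the time of thinning a table of length `T` with buckets of size `b`. -/
def thinTime (k T b : ℕ) : ℕ := T * (b * (4 * k + 10) + 10) + 2

/-- Thinning is greedy: a map is dropped exactly when a map kept earlier in the same bucket is close
to it. The last clause of the conclusion allows two thinnings to share the array `bk` in disjoint
ranges. -/
lemma wp_thin (hY : Represents o.distY pt n) (hB : IsDoublingConst Y B)
    (hk : m.N .k 0 = k) (hs : 0 ≤ m.R .s) {R : ℝ} {e : ℕ} (hR : 2 * (R / 2 ^ e) ≤ m.R .s)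
    (hcen : ∀ y ∈ Finset.Ico 1 (n + 1), m.N .cen y ∈ Finset.Ico 1 (n + 1))
    (ha0 : m.N .a0 0 < k) (hc0 : m.N .comp (m.N .a0 0) = m.N .c0 0)
    (hr : ∀ p ∈ m.L .tab (m.N .c0 0), ∀ a < k, m.N .comp a = m.N .c0 0 →
      m.N .img (p + a) ∈ Finset.Ico 1 (n + 1))
    (hball : ∀ p ∈ m.L .tab (m.N .c0 0), ∀ b < k, m.N .comp b = m.N .c0 0 →
      dist (pt (m.N .img (p + b))) (pt (m.N .cen (m.N .img (p + m.N .a0 0)))) ≤ R)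
    (hbk : ∀ w ∈ Finset.Ico 1 (n + 1), m.L .bk (w + m.N .off 0) = []) :
    wp o q thin m fun t m' =>
      t ≤ thinTime k (m.L .tab (m.N .c0 0)).length ((B ^ e) ^ k) ∧
      IsThinning pt n k (m.N .comp) (m.N .img) (m.N .cen) (m.R .s) (m.N .c0 0) (m.N .a0 0)
        (m.L .tab (m.N .c0 0)) (fun w => m'.L .bk (w + m.N .off 0)) ∧
      ∀ j, (∀ w ∈ Finset.Ico 1 (n + 1), j ≠ w + m.N .off 0) → m'.L .bk j = m.L .bk j := by
  refine (wp_forIn (fun l m' => IsThinning pt n k (m.N .comp) (m.N .img) (m.N .cen) (m.R .s)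
    (m.N .c0 0) (m.N .a0 0) l (fun w => m'.L .bk (w + m.N .off 0)) ∧
      ∀ j, (∀ w ∈ Finset.Ico 1 (n + 1), j ≠ w + m.N .off 0) → m'.L .bk j = m.L .bk j)
    ((B ^ e) ^ k * (4 * k + 10) + 8) rfl (m.L .tab (m.N .c0 0)) rfl ?_ ?_).mono ?_
  · refine ⟨⟨fun w hw p hp => ?_, fun w hw => ?_, by simp⟩, by simp⟩
    · simp [hbk w hw] at hp
    · simp [hbk w hw]
  · rintro l₁ p l₂ m₁ hl hs₁ hp ⟨hI, hI'⟩
    have e1 : m₁.N .comp = m.N .comp := hs₁.N .comp rfl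
    have e2 : m₁.N .c0 = m.N .c0 := hs₁.N .c0 rfl
    have e3 : m₁.N .img = m.N .img := hs₁.N .img rfl
    have e4 : m₁.N .cen = m.N .cen := hs₁.N .cen rfl
    have e5 : m₁.N .a0 = m.N .a0 := hs₁.N .a0 rfl
    have e6 : m₁.N .off = m.N .off := hs₁.N .off rfl
    have e7 : m₁.R .s = m.R .s := hs₁.R .s rfl
    have e8 : m₁.N .k 0 = k := (congrFun (hs₁.N .k rfl) 0).trans hk
    have hpm : p ∈ m.L .tab (m.N .c0 0) := by simp [hl]
    simp only [wp_blk_cons, wp_blk_nil, wp_setN, NE.eval, hp, List.headD_cons, e3, e4, e5, e6]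
    set w := m.N .cen (m.N .img (p + m.N .a0 0)) with hw
    have hwm : w ∈ Finset.Ico 1 (n + 1) := hcen _ (hr p hpm _ ha0 hc0)
    set off := m.N .off 0 with hoff
    set m₂ := (m₁.setN .pos 0 (w + off)).setN .keep 0 1 with hm₂
    have hsub : ∀ q ∈ m₁.L .bk (w + off), q ∈ m.L .tab (m.N .c0 0) := fun q hq => by
      rw [hl]
      exact List.mem_append_left _ (hI.sub w hwm q hq).1
    -- At any time the buckets form a thinning of the prefix processed so far. Packing therefore
    -- bounds the inner loop in every round, not only at the end.
    have hlen : (m₁.L .bk (w + off)).length ≤ (B ^ e) ^ k :=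
      hI.length_le hB hs hR (fun p hp => hball p (by simp [hl, hp])) hwm
    refine (wp_forIn (fun l m' => 1 ≤ m'.N .keep 0 ↔ ∀ q ∈ l,
      ¬ MapsClose pt k (m.N .comp) (m.N .img) (m.R .s) (m.N .c0 0) p q) (k * 4 + 7) rfl
      (m₁.L .bk (w + off)) (by simp [hm₂]) (by simp [hm₂]) ?_).mono ?_
    · intro k₁ p' k₂ m₃ hk' hs₃ hp' hJ
      have hp'm : p' ∈ m.L .tab (m.N .c0 0) := hsub p' (by simp [hk'])
      have f1 : m₃.N .comp = m.N .comp := (hs₃.N .comp rfl).trans (by simpa [hm₂] using e1)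
      have f2 : m₃.N .c0 = m.N .c0 := (hs₃.N .c0 rfl).trans (by simpa [hm₂] using e2)
      have f3 : m₃.N .img = m.N .img := (hs₃.N .img rfl).trans (by simpa [hm₂] using e3)
      have f4 : m₃.R .s = m.R .s := (hs₃.R .s rfl).trans (by simpa [hm₂] using e7)
      have f5 : m₃.N .k 0 = k := (congrFun (hs₃.N .k rfl) 0).trans (by simpa [hm₂] using e8)
      have f6 : m₃.L .l1 = m₁.L .l1 := (hs₃.L .l1 rfl).trans (by simp [hm₂])
      simp only [wp_blk_cons]
      refine (wp_testNear hY f5 (p := p) (p' := p') (by simp [f6, hp]) (by simp [hp'])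
        (by rw [f1, f2, f3]; exact hr p hpm) (by rw [f1, f2, f3]; exact hr p' hp'm)).mono ?_
      rintro t m₄ hs₄ ⟨ht, hnear⟩
      rw [f1, f2, f3, f4] at hnear
      have g1 : m₄.N .keep = m₃.N .keep := hs₄.N .keep rfl
      simp only [wp_blk_nil, wp_ite, wp_setN, wp_skip, BE.Holds, NE.eval, hnear]
      refine ⟨fun h => ⟨by omega, ?_⟩, fun h => ⟨by omega, ?_⟩⟩
      · simp [h]
      · simp only [Mem.N_setL, g1, hJ, List.forall_mem_append, List.forall_mem_singleton]
        tauto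
    · rintro t m₅ hs₅ ⟨ht, hkeep⟩
      have f1 : m₅.N .pos = m₂.N .pos := hs₅.N .pos rfl
      have f2 : m₅.L .bk = m₁.L .bk := (hs₅.L .bk rfl).trans (by simp [hm₂])
      have f3 : m₅.L .l1 = m₁.L .l1 := (hs₅.L .l1 rfl).trans (by simp [hm₂])
      have f4 : m₂.N .pos 0 = w + off := by simp [hm₂]
      have ht' : t ≤ (B ^ e) ^ k * (4 * k + 10) + 2 := by
        refine ht.trans ?_
        have : k * 4 + 7 + 2 ≤ 4 * k + 10 := by omega
        gcongr
      simp only [wp_ite, wp_cons, wp_skip, BE.Holds, NE.eval, LE.eval, hkeep, f1, f2, f3, f4, hp,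
        List.headD_cons]
      refine ⟨fun h => ⟨by omega, ⟨?_, ?_, ?_⟩, ?_⟩, fun h => ⟨by omega, ⟨?_, ?_, ?_⟩, ?_⟩⟩
      · intro u hu p' hp'
        by_cases huw : u = w
        · subst huw
          simp only [ne_eq, reduceCtorEq, not_false_eq_true, Mem.L_setL_ne, Mem.L_setL_self,
            Function.update_self, List.mem_cons] at hp'
          rcases hp' with rfl | hp'
          · exact ⟨by simp, hw.symm⟩
          · exact ⟨List.mem_append_left _ (hI.sub _ hu p' hp').1, (hI.sub _ hu p' hp').2⟩
        · simp only [ne_eq, reduceCtorEq, not_false_eq_true, Mem.L_setL_ne, Mem.L_setL_self,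
            Function.update_apply, add_left_inj, huw, if_false, f2] at hp'
          exact ⟨List.mem_append_left _ (hI.sub _ hu p' hp').1, (hI.sub _ hu p' hp').2⟩
      · intro u hu
        by_cases huw : u = w
        · subst huw
          simp only [ne_eq, reduceCtorEq, not_false_eq_true, Mem.L_setL_ne, Mem.L_setL_self,
            Function.update_self, List.pairwise_cons]
          exact ⟨h, hI.far _ hu⟩
        · simp only [ne_eq, reduceCtorEq, not_false_eq_true, Mem.L_setL_ne, Mem.L_setL_self,
            Function.update_apply, add_left_inj, huw, if_false, f2]
          exact hI.far _ hu
      · intro p' hp'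
        have hmono : ∀ u, ∀ x ∈ m₁.L .bk (u + off),
            x ∈ (Function.update (m₁.L .bk) (w + off) (p :: m₁.L .bk (w + off))) (u + off) := by
          intro u x hx
          by_cases huw : u = w
          · subst huw
            simp [hx]
          · simpa [huw] using hx
        simp only [ne_eq, reduceCtorEq, not_false_eq_true, Mem.L_setL_ne, Mem.L_setL_self, f2]
        rcases List.mem_append.1 hp' with hp' | hp'
        · obtain ⟨x, hx, hc⟩ := hI.close p' hp'
          exact ⟨x, hmono _ _ hx, hc⟩
        · rw [List.mem_singleton.1 hp', ← hw]
          exact ⟨p, by simp, .refl hs p⟩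
      · intro j hj
        have : j ≠ w + off := hj w hwm
        simpa [this, f2] using hI' j hj
      · intro u hu p' hp'
        simp only [ne_eq, reduceCtorEq, not_false_eq_true, Mem.L_setL_ne, f2] at hp'
        exact ⟨List.mem_append_left _ (hI.sub _ hu p' hp').1, (hI.sub _ hu p' hp').2⟩
      · intro u hu
        simp only [ne_eq, reduceCtorEq, not_false_eq_true, Mem.L_setL_ne, f2]
        exact hI.far u hu
      · intro p' hp'
        simp only [ne_eq, reduceCtorEq, not_false_eq_true, Mem.L_setL_ne, f2]
        rcases List.mem_append.1 hp' with hp' | hp'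
        · exact hI.close p' hp'
        · rw [List.mem_singleton.1 hp', ← hw]
          push Not at h
          exact h
      · intro j hj
        simpa [f2] using hI' j hj
  · rintro t m' - ⟨ht, h⟩
    exact ⟨ht, h⟩

end ListMachine

namespace ListMachine

open RealRAM (Oracle)

/-! ### Combining the maps on two components -/

/-- The distortion that is allowed. -/
def RE.distortion : RE := .mul (.add (.ofNat (.lit 1)) (.var .eps)) (.var .rho)

/-- The distance of the images of `a` and `b` under the first maps in `l1` and `l3`. -/
def RE.imageDist : RE := .distY (.image .l1 .a) (.image .l3 .b)

/-- Testing whether the distance between `a` and `b` is distorted too much. -/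
def testPair : Cmd :=
  .ite (.and
      (.and (.eq (.get .comp (.var .a)) (.var .ca)) (.eq (.get .comp (.var .b)) (.var .cb)))
      (.not (.and
        (.leR (.mul (.div (.ofNat (.lit 1)) .distortion) (.dX (.var .a) (.var .b))) .imageDist)
        (.leR .imageDist (.mul .distortion (.dX (.var .a) (.var .b)))))))
    (.put .ok (.lit 0)) .skip

/-- Testing whether the distances between two components are distorted too much. -/
def testCross : Cmd := .blk [.put .ok (.lit 1), forX .a (forX .b testPair)]

/-- Joining the maps at the heads of `l1` and `l3`. -/
def joinMaps : Cmd :=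
  .blk [forX .a (.ite (.eq (.get .comp (.var .a)) (.var .ca))
      (.setN .img (.add (.var .top) (.var .a)) (.image .l1 .a))
      (.setN .img (.add (.var .top) (.var .a)) (.image .l3 .a))),
    .cons .res (.lit 0) (.var .top) (.get .res (.lit 0)),
    .put .top (.add (.var .top) (.var .k))]

/-- Joining the maps at the heads of `l1` and `l3` if possible. -/
def tryJoin : Cmd := .blk [testCross, .ite (.leN (.lit 1) (.var .ok)) joinMaps .skip]

/-- Joining all pairs of maps on the two components. -/
def combine : Cmd :=
  .blk [.setL .res (.lit 0) .nil,
    .forTo .pos (.lit 1) (.succ .n) (.forIn .l1 (.get .bk (.var .pos))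
      (.forIn .l2 (.get .fr (.image .l1 .ea))
        (.forIn .l3 (.get .bk (.add (.hd .l2) (.var .n))) tryJoin)))]

/-- The distances between the components `c` and `c'` are distorted by at most `ρ` if the first
is mapped by `p` and the second by `q`. -/
def Compatible {Y : Type*} [MetricSpace Y] (pt : ℕ → Y) (dX : ℕ → ℕ → ℝ) (k : ℕ)
    (comp img : ℕ → ℕ) (ρ : ℝ) (c c' p q : ℕ) : Prop :=
  ∀ a < k, ∀ b < k, comp a = c → comp b = c' →
    (1 / ρ) * dX a b ≤ dist (pt (img (p + a))) (pt (img (q + b))) ∧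
      dist (pt (img (p + a))) (pt (img (q + b))) ≤ ρ * dX a b

/-- The map `r` arises by joining `p` and `q`. -/
def IsJoin (k : ℕ) (comp img img' : ℕ → ℕ) (c p q r : ℕ) : Prop :=
  ∀ a < k, img' (r + a) = if comp a = c then img (p + a) else img (q + a)

variable {Y : Type*} [MetricSpace Y] {pt : ℕ → Y} {n k : ℕ} {o : Oracle} {q : ℕ} {m : Mem}

lemma wp_testCross (hY : Represents o.distY pt n) (hk : m.N .k 0 = k) {p p' : ℕ} {ρ : ℝ}
    (hρ : RE.distortion.eval o m = ρ)
    (hp : (m.L .l1 0).headD 0 = p) (hp' : (m.L .l3 0).headD 0 = p')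
    (hr : ∀ a < k, m.N .comp a = m.N .ca 0 → m.N .img (p + a) ∈ Finset.Ico 1 (n + 1))
    (hr' : ∀ a < k, m.N .comp a = m.N .cb 0 → m.N .img (p' + a) ∈ Finset.Ico 1 (n + 1)) :
    wp o q testCross m fun t m' => t ≤ k * (k * 4 + 4) + 4 ∧
      (1 ≤ m'.N .ok 0 ↔
        Compatible pt o.distX k (m.N .comp) (m.N .img) ρ (m.N .ca 0) (m.N .cb 0) p p') := by
  let G : ℕ → ℕ → Prop := fun a b => m.N .comp a = m.N .ca 0 → m.N .comp b = m.N .cb 0 →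
    (1 / ρ) * o.distX a b ≤ dist (pt (m.N .img (p + a))) (pt (m.N .img (p' + b))) ∧
      dist (pt (m.N .img (p + a))) (pt (m.N .img (p' + b))) ≤ ρ * o.distX a b
  simp only [testCross, wp_blk_cons, wp_blk_nil, wp_setN, NE.eval]
  refine (wp_forTo (fun i m' => (1 ≤ m'.N .ok 0 ↔ ∀ a < i, ∀ b < k, G a b)) 0 k (k * 4 + 2)
    rfl rfl (fun m' hs => by simp [hs.N .k rfl, hk]) (by omega) (by simp) ?_).mono ?_
  · intro i m₁ hs₁ hi hi' ha hI
    have k₁ : m₁.N .k 0 = k := (congrFun (hs₁.N .k rfl) 0).trans hk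
    have hpair : ∀ j m₂, SameOff (forX .b testPair) m₁ m₂ → j < k → m₂.N .b 0 = j →
      ((1 ≤ m₂.N .ok 0 ↔ (∀ a < i, ∀ b < k, G a b) ∧ ∀ b < j, G i b)) →
      wp o q testPair m₂ fun t m₃ => t ≤ 2 ∧
        (1 ≤ (m₃.setN .b 0 (j + 1)).N .ok 0 ↔
          (∀ a < i, ∀ b < k, G a b) ∧ ∀ b < j + 1, G i b) := by
      intro j m₂ hs₂ hj hbj hJ
      have e1 : m₂.N .comp = m.N .comp := (hs₂.N .comp rfl).trans (hs₁.N .comp rfl)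
      have e2 : m₂.N .ca = m.N .ca := (hs₂.N .ca rfl).trans (hs₁.N .ca rfl)
      have e2' : m₂.N .cb = m.N .cb := (hs₂.N .cb rfl).trans (hs₁.N .cb rfl)
      have e3 : m₂.N .img = m.N .img := (hs₂.N .img rfl).trans (hs₁.N .img rfl)
      have e4 : m₂.L .l1 = m.L .l1 := (hs₂.L .l1 rfl).trans (hs₁.L .l1 rfl)
      have e5 : m₂.L .l3 = m.L .l3 := (hs₂.L .l3 rfl).trans (hs₁.L .l3 rfl)
      have e6 : RE.distortion.eval o m₂ = ρ := by
        rw [← hρ]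
        simp only [RE.distortion, RE.eval, NE.eval, (hs₂.R .rho rfl).trans (hs₁.R .rho rfl),
          (hs₂.R .eps rfl).trans (hs₁.R .eps rfl),
          Mem.R_setN]
      have e7 : m₂.N .a 0 = i := (congrFun (hs₂.N .a rfl) 0).trans ha
      have hsucc : (∀ b < j + 1, G i b) ↔ (∀ b < j, G i b) ∧ G i j := by
        constructor
        · exact fun h => ⟨fun a ha => h a (by omega), h j (by omega)⟩
        · rintro ⟨h1, h2⟩ a ha
          rcases Nat.lt_succ_iff_lt_or_eq.1 ha with ha | rfl
          · exact h1 a ha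
          · exact h2
      have hG : G i j ↔ ¬ ((m.N .comp i = m.N .ca 0 ∧ m.N .comp j = m.N .cb 0) ∧
          ¬ ((1 / ρ) * o.distX i j ≤ o.distY (m.N .img (p + i) - 1) (m.N .img (p' + j) - 1) ∧
            o.distY (m.N .img (p + i) - 1) (m.N .img (p' + j) - 1) ≤ ρ * o.distX i j)) := by
        constructor
        · rintro h ⟨⟨h1, h2⟩, h3⟩
          rw [hY.dist_eq _ _ (hr i hi' h1) (hr' j hj h2)] at h3
          exact h3 (h h1 h2)
        · intro h h1 h2
          rw [hY.dist_eq _ _ (hr i hi' h1) (hr' j hj h2)] at h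
          by_contra h3
          exact h ⟨⟨h1, h2⟩, h3⟩
      simp only [testPair, wp_ite, wp_setN, wp_skip, BE.Holds, RE.eval, RE.imageDist, NE.eval, e1, e2, e2',
        e3, e4, e5, e6, e7, hbj, hp, hp', ← le_antisymm_iff, hsucc, Nat.cast_one]
      refine ⟨fun h => ⟨le_rfl, ?_⟩, fun h => ⟨le_rfl, ?_⟩⟩
      · have : ¬ G i j := by rw [hG]; exact not_not.2 h
        simp [this]
      · have : G i j := hG.2 h
        simp only [ne_eq, reduceCtorEq, not_false_eq_true, Mem.N_setN_ne]
        rw [hJ, and_iff_left this]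
    refine (wp_forTo (fun j m' => (1 ≤ m'.N .ok 0 ↔ (∀ a < i, ∀ b < k, G a b) ∧
      ∀ b < j, G i b)) 0 k 2 rfl rfl (fun m' hs => by simp [hs.N .k rfl, k₁]) (by omega)
      (by simpa using hI) fun j m₂ hs₂ _ hj hbj hJ => hpair j m₂ hs₂ hj hbj hJ).mono ?_
    rintro t m' - ⟨ht, h⟩
    refine ⟨ht, ?_⟩
    simp only [ne_eq, reduceCtorEq, not_false_eq_true, Mem.N_setN_ne]
    refine h.trans ⟨fun h a ha b hb => ?_, fun h => ⟨fun a ha => h a (by omega),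
      h i (by omega)⟩⟩
    rcases Nat.lt_succ_iff_lt_or_eq.1 ha with ha | rfl
    · exact h.1 a ha b hb
    · exact h.2 b hb
  · rintro t m' - ⟨ht, h⟩
    refine ⟨?_, h.trans ⟨fun h a ha b hb h1 h2 => h a ha b hb h1 h2,
      fun h a ha b hb h1 h2 => h a ha b hb h1 h2⟩⟩
    have ht' : t ≤ k * (k * 4 + 4) + 2 := ht
    omega

/-- New maps are written from `top` on and nothing below is changed, so the addresses in existing
tables keep their meaning. -/
lemma wp_joinMaps (hk : m.N .k 0 = k) {p p' : ℕ}
    (hp : (m.L .l1 0).headD 0 = p) (hp' : (m.L .l3 0).headD 0 = p')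
    (hpk : p + k ≤ m.N .top 0) (hpk' : p' + k ≤ m.N .top 0) :
    wp o q joinMaps m fun t m' => t ≤ k * 4 + 5 ∧
      m'.L .res 0 = m.N .top 0 :: m.L .res 0 ∧
      m'.N .top 0 = m.N .top 0 + k ∧ (∀ j < m.N .top 0, m'.N .img j = m.N .img j) ∧
      IsJoin k (m.N .comp) (m.N .img) (m'.N .img) (m.N .ca 0) p p' (m.N .top 0) := by
  simp only [joinMaps, wp_blk_cons, wp_blk_nil, wp_setN, wp_cons, NE.eval, LE.eval]
  refine (wp_forTo (fun i m' => (∀ j < m.N .top 0, m'.N .img j = m.N .img j) ∧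
    IsJoin i (m.N .comp) (m.N .img) (m'.N .img) (m.N .ca 0) p p' (m.N .top 0)) 0 k 2 rfl rfl
    (fun m' hs => by simp [hs.N .k rfl, hk]) (by omega) (by simp [IsJoin]) ?_).mono ?_
  · rintro i m₁ hs hi hi' ha ⟨hI, hJ⟩
    have e1 : m₁.N .comp = m.N .comp := hs.N .comp rfl
    have e2 : m₁.N .ca = m.N .ca := hs.N .ca rfl
    have e3 : m₁.N .top = m.N .top := hs.N .top rfl
    have e4 : m₁.L .l1 = m.L .l1 := hs.L .l1 rfl
    have e5 : m₁.L .l3 = m.L .l3 := hs.L .l3 rfl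
    have key : ∀ x, x = (if m.N .comp i = m.N .ca 0 then m.N .img (p + i)
        else m.N .img (p' + i)) → (∀ j < m.N .top 0,
          Function.update (m₁.N .img) (m.N .top 0 + i) x j = m.N .img j) ∧
        IsJoin (i + 1) (m.N .comp) (m.N .img)
          (Function.update (m₁.N .img) (m.N .top 0 + i) x) (m.N .ca 0) p p' (m.N .top 0) := by
      intro x hx
      refine ⟨fun j hj => ?_, fun a ha' => ?_⟩
      · rw [Function.update_of_ne (by omega), hI j hj]
      · rcases Nat.lt_succ_iff_lt_or_eq.1 ha' with ha' | rfl
        · rw [Function.update_of_ne (by omega), hJ a ha']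
        · rw [Function.update_self, hx]
    simp only [wp_ite, wp_setN, BE.Holds, NE.eval, e1, e2, e3, e4, e5, ha, hp, hp',
      ← le_antisymm_iff, ne_eq, reduceCtorEq, not_false_eq_true, Mem.N_setN_ne, Mem.N_setN_self]
    refine ⟨fun h => ⟨le_rfl, ?_⟩, fun h => ⟨le_rfl, ?_⟩⟩
    · exact key _ (by rw [if_pos h, hI _ (by omega)])
    · exact key _ (by rw [if_neg h, hI _ (by omega)])
  · rintro t m₁ hs ⟨ht, hI, hJ⟩
    have e3 : m₁.N .top = m.N .top := hs.N .top rfl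
    have e4 : m₁.L .res = m.L .res := hs.L .res rfl
    have e5 : m₁.N .k 0 = k := (congrFun (hs.N .k rfl) 0).trans hk
    have ht' : t ≤ k * 4 + 2 := ht
    refine ⟨by omega, by simp [e3, e4], by simp [e3, e5], ?_, ?_⟩
    · simpa using hI
    · simpa using hJ

/-- The result after the pairs of maps in `S` have been joined. -/
structure Combined (pt : ℕ → Y) (dX : ℕ → ℕ → ℝ) (k : ℕ) (comp img : ℕ → ℕ) (ρ : ℝ)
    (c c' : ℕ) (l l' : List ℕ) (top : ℕ) (S : Set (ℕ × ℕ)) (N : ℕ)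
    (img' : ℕ → ℕ) (top' : ℕ) (res : List ℕ) : Prop where
  img_eq : ∀ j < top, img' j = img j
  le_top : top ≤ top'
  sound : ∀ r ∈ res, r + k ≤ top' ∧ ∃ p ∈ l, ∃ p' ∈ l',
    Compatible pt dX k comp img ρ c c' p p' ∧ IsJoin k comp img img' c p p' r
  complete : ∀ x ∈ S, Compatible pt dX k comp img ρ c c' x.1 x.2 →
    ∃ r ∈ res, IsJoin k comp img img' c x.1 x.2 r
  length_le : res.length ≤ N

/-- On leaving a loop, the set of tried pairs and the count are restated for the enclosing loop by
an inclusion and an inequality. -/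
lemma Combined.mono {dX : ℕ → ℕ → ℝ} {comp img img' : ℕ → ℕ} {ρ : ℝ} {c c' top top' : ℕ}
    {l l' res : List ℕ} {S S' : Set (ℕ × ℕ)} {N N' : ℕ}
    (h : Combined pt dX k comp img ρ c c' l l' top S N img' top' res) (hS : S' ⊆ S)
    (hN : N ≤ N') : Combined pt dX k comp img ρ c c' l l' top S' N' img' top' res :=
  ⟨h.img_eq, h.le_top, h.sound, fun x hx => h.complete x (hS hx), h.length_le.trans hN⟩

lemma wp_tryJoin (hY : Represents o.distY pt n) (hk : m.N .k 0 = k) {comp img : ℕ → ℕ}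
    {top c c' : ℕ} {p p' : ℕ} {ρ : ℝ} {l l' : List ℕ} {S : Set (ℕ × ℕ)} {N : ℕ}
    (hρ : RE.distortion.eval o m = ρ) (hcomp : m.N .comp = comp) (hc : m.N .ca 0 = c)
    (hc' : m.N .cb 0 = c')
    (hp : (m.L .l1 0).headD 0 = p) (hp' : (m.L .l3 0).headD 0 = p')
    (hpl : p ∈ l) (hpl' : p' ∈ l')
    (hr : ∀ p ∈ l, p + k ≤ top ∧ ∀ a < k, comp a = c → img (p + a) ∈ Finset.Ico 1 (n + 1))
    (hr' : ∀ p ∈ l', p + k ≤ top ∧ ∀ a < k, comp a = c' → img (p + a) ∈ Finset.Ico 1 (n + 1))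
    (h : Combined pt o.distX k comp img ρ c c' l l' top S N (m.N .img) (m.N .top 0)
      (m.L .res 0)) :
    wp o q tryJoin m fun t m' => t ≤ k * (k * 4 + 8) + 11 ∧
      Combined pt o.distX k comp img ρ c c' l l' top (insert (p, p') S) (N + 1)
        (m'.N .img) (m'.N .top 0) (m'.L .res 0) := by
  obtain ⟨hpt, hpr⟩ := hr p hpl
  obtain ⟨hpt', hpr'⟩ := hr' p' hpl'
  have hle := h.le_top
  have hcongr : Compatible pt o.distX k comp (m.N .img) ρ c c' p p' ↔
      Compatible pt o.distX k comp img ρ c c' p p' := by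
    refine forall₂_congr fun a ha => forall₂_congr fun b hb => ?_
    rw [h.img_eq _ (by omega), h.img_eq _ (by omega)]
  simp only [tryJoin, wp_blk_cons, wp_blk_nil]
  refine (wp_testCross hY hk hρ hp hp' ?_ ?_).mono ?_
  · intro a ha h1
    rw [hcomp, hc] at h1
    rw [h.img_eq _ (by omega)]
    exact hpr a ha h1
  · intro a ha h1
    rw [hcomp, hc'] at h1
    rw [h.img_eq _ (by omega)]
    exact hpr' a ha h1
  rintro t m₁ hs ⟨ht, hok⟩
  rw [hcomp, hc, hc', hcongr] at hok
  have e1 : m₁.N .comp = comp := (hs.N .comp rfl).trans hcomp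
  have e2 : m₁.N .ca 0 = c := (congrFun (hs.N .ca rfl) 0).trans hc
  have e3 : m₁.N .img = m.N .img := hs.N .img rfl
  have e4 : m₁.N .top = m.N .top := hs.N .top rfl
  have e5 : m₁.L .res = m.L .res := hs.L .res rfl
  have e6 : m₁.N .k 0 = k := (congrFun (hs.N .k rfl) 0).trans hk
  have e7 : m₁.L .l1 = m.L .l1 := hs.L .l1 rfl
  have e8 : m₁.L .l3 = m.L .l3 := hs.L .l3 rfl
  simp only [wp_ite, wp_skip, BE.Holds, NE.eval, hok]
  refine ⟨fun hC => ?_, fun hC => ⟨by nlinarith, ?_⟩⟩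
  · refine (wp_joinMaps e6 (p := p) (p' := p') (by rw [e7, hp]) (by rw [e8, hp'])
      (by rw [e4]; omega) (by rw [e4]; omega)).mono ?_
    rintro t' m₂ - ⟨ht', hres, htop, himg, hj⟩
    rw [e1, e2, e3, e4] at hj
    rw [e4] at htop himg
    rw [e3] at himg
    rw [e4, e5] at hres
    have hj' : ∀ x y r, x + k ≤ top → y + k ≤ top → IsJoin k comp (m.N .img) (m₂.N .img) c x y r →
        IsJoin k comp img (m₂.N .img) c x y r := by
      intro x y r hx hy hj a ha
      rw [hj a ha, h.img_eq _ (by omega), h.img_eq _ (by omega)]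
    have hold : ∀ r ∈ m.L .res 0, ∀ x y, IsJoin k comp img (m.N .img) c x y r →
        IsJoin k comp img (m₂.N .img) c x y r := by
      intro r hr x y hj a ha
      have := (h.sound r hr).1
      rw [himg _ (by omega), hj a ha]
    refine ⟨by nlinarith, ⟨fun j hj => ?_, by omega, ?_, ?_, ?_⟩⟩
    · rw [himg j (by omega), h.img_eq j hj]
    · intro r hrr
      rw [hres, List.mem_cons] at hrr
      rcases hrr with rfl | hrr
      · exact ⟨htop.ge, p, hpl, p', hpl', hC, hj' _ _ _ hpt hpt' hj⟩
      · obtain ⟨h1, x, hx, y, hy, h2, h3⟩ := h.sound r hrr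
        exact ⟨by omega, x, hx, y, hy, h2, hold r hrr _ _ h3⟩
    · intro x hx hcx
      rw [hres]
      rcases hx with rfl | hx
      · exact ⟨_, List.mem_cons_self, hj' _ _ _ hpt hpt' hj⟩
      · obtain ⟨r, hrr, h1⟩ := h.complete x hx hcx
        exact ⟨r, List.mem_cons_of_mem _ hrr, hold r hrr _ _ h1⟩
    · rw [hres, List.length_cons]
      exact Nat.succ_le_succ h.length_le
  · rw [e3, e4, e5]
    refine ⟨h.img_eq, h.le_top, h.sound, ?_, h.length_le.trans (Nat.le_succ _)⟩
    rintro x (rfl | hx) hcx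
    · exact absurd hcx hC
    · exact h.complete x hx hcx

/-- The bound for the time of combining, for buckets of size `b` and `f` neighbours. -/
def combineTime (n k b f : ℕ) : ℕ :=
  n * (b * (f * (b * (k * (k * 4 + 8) + 13) + 4) + 4) + 4) + 4

/-- Each nested loop adds to `S` the pairs visited so far, and to `N` the number of rounds times the
bound for the loops inside it. The second family of buckets is shifted by `n`. -/
lemma wp_combine (hY : Represents o.distY pt n) (hk : m.N .k 0 = k) (hn : m.N .n 0 = n)
    {ρ : ℝ} {l l' : List ℕ} {b f : ℕ} (hρ : RE.distortion.eval o m = ρ)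
    (hr : ∀ p ∈ l, p + k ≤ m.N .top 0 ∧ ∀ a < k, m.N .comp a = m.N .ca 0 →
      m.N .img (p + a) ∈ Finset.Ico 1 (n + 1))
    (hr' : ∀ p ∈ l', p + k ≤ m.N .top 0 ∧ ∀ a < k, m.N .comp a = m.N .cb 0 →
      m.N .img (p + a) ∈ Finset.Ico 1 (n + 1))
    (hea : m.N .ea 0 < k) (hcea : m.N .comp (m.N .ea 0) = m.N .ca 0)
    (hl : ∀ w ∈ Finset.Ico 1 (n + 1), ∀ p ∈ m.L .bk w, p ∈ l)
    (hl' : ∀ w ∈ Finset.Ico 1 (n + 1), ∀ p ∈ m.L .bk (w + n), p ∈ l')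
    (hb : ∀ w ∈ Finset.Ico 1 (n + 1), (m.L .bk w).length ≤ b)
    (hb' : ∀ w ∈ Finset.Ico 1 (n + 1), (m.L .bk (w + n)).length ≤ b)
    (hfr : ∀ y ∈ Finset.Ico 1 (n + 1), ∀ z ∈ m.L .fr y, z ∈ Finset.Ico 1 (n + 1))
    (hf : ∀ y ∈ Finset.Ico 1 (n + 1), (m.L .fr y).length ≤ f) :
    wp o q combine m fun t m' => t ≤ combineTime n k b f ∧
      Combined pt o.distX k (m.N .comp) (m.N .img) ρ (m.N .ca 0) (m.N .cb 0) l l' (m.N .top 0)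
        {x | ∃ w ∈ Finset.Ico 1 (n + 1), x.1 ∈ m.L .bk w ∧
          ∃ z ∈ m.L .fr (m.N .img (x.1 + m.N .ea 0)), x.2 ∈ m.L .bk (z + n)}
        (n * (b * (f * b))) (m'.N .img) (m'.N .top 0) (m'.L .res 0) := by
  let J : Set (ℕ × ℕ) → ℕ → Mem → Prop := fun S N m' =>
    Combined pt o.distX k (m.N .comp) (m.N .img) ρ (m.N .ca 0) (m.N .cb 0) l l' (m.N .top 0)
      S N (m'.N .img) (m'.N .top 0) (m'.L .res 0)
  have hmono : ∀ {S S' N N'} {m' : Mem}, S' ⊆ S → N ≤ N' → J S N m' → J S' N' m' :=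
    fun h1 h2 h => h.mono h1 h2
  simp only [combine, wp_blk_cons, wp_blk_nil, wp_setL, NE.eval, LE.eval]
  refine (wp_forTo (fun i m' => J {x | ∃ w ∈ Finset.Ico 1 i, x.1 ∈ m.L .bk w ∧
      ∃ z ∈ m.L .fr (m.N .img (x.1 + m.N .ea 0)), x.2 ∈ m.L .bk (z + n)}
      ((i - 1) * (b * (f * b))) m') 1 (n + 1)
    (b * (f * (b * (k * (k * 4 + 8) + 13) + 4) + 4) + 2) rfl rfl
    (fun m' hs => by simp [hs.N .n rfl, hn]) (by omega) ?_ ?_).mono ?_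
  · exact ⟨by simp, by simp, by simp, by simp, by simp⟩
  · intro w m₁ hs₁ hw hw' hpos hI₁
    have hwm : w ∈ Finset.Ico 1 (n + 1) := Finset.mem_Ico.2 ⟨hw, hw'⟩
    have a1 : m₁.L .bk = m.L .bk := (hs₁.L .bk rfl).trans (by simp)
    have a2 : m₁.L .fr = m.L .fr := (hs₁.L .fr rfl).trans (by simp)
    set S₁ : Set (ℕ × ℕ) := {x | ∃ w' ∈ Finset.Ico 1 w, x.1 ∈ m.L .bk w' ∧
      ∃ z ∈ m.L .fr (m.N .img (x.1 + m.N .ea 0)), x.2 ∈ m.L .bk (z + n)} with hS₁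
    set N₁ := (w - 1) * (b * (f * b)) with hN₁
    refine (wp_forIn (fun k₁ m' => J (S₁ ∪ {x | x.1 ∈ k₁ ∧
      ∃ z ∈ m.L .fr (m.N .img (x.1 + m.N .ea 0)), x.2 ∈ m.L .bk (z + n)})
      (N₁ + k₁.length * (f * b)) m') (f * (b * (k * (k * 4 + 8) + 13) + 4) + 2) rfl (m.L .bk w)
      (by simp [hpos, a1]) (by simpa [J] using hI₁) ?_).mono ?_
    · intro k₁ p k₂ m₂ hkp hs₂ hp hI₂
      have hpb : p ∈ m.L .bk w := by simp [hkp]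
      have hpl : p ∈ l := hl w hwm p hpb
      have b1 : m₂.L .bk = m.L .bk := (hs₂.L .bk rfl).trans a1
      have b2 : m₂.L .fr = m.L .fr := (hs₂.L .fr rfl).trans a2
      have b3 : m₂.N .ea = m.N .ea := (hs₂.N .ea rfl).trans (hs₁.N .ea rfl)
      -- Maps joined in earlier rounds lie above the old `top`, so the image that selects the
      -- neighbour list is unaffected.
      have b4 : m₂.N .img (p + m.N .ea 0) = m.N .img (p + m.N .ea 0) :=
        hI₂.img_eq _ (by have := (hr p hpl).1; omega)
      have hym : m.N .img (p + m.N .ea 0) ∈ Finset.Ico 1 (n + 1) :=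
        (hr p hpl).2 _ hea hcea
      set y := m.N .img (p + m.N .ea 0) with hy
      set S₂ : Set (ℕ × ℕ) := S₁ ∪ {x | x.1 ∈ k₁ ∧
        ∃ z ∈ m.L .fr (m.N .img (x.1 + m.N .ea 0)), x.2 ∈ m.L .bk (z + n)} with hS₂
      set N₂ := N₁ + k₁.length * (f * b) with hN₂
      refine (wp_forIn (fun j₁ m' => J (S₂ ∪ {x | x.1 = p ∧ ∃ z ∈ j₁, x.2 ∈ m.L .bk (z + n)})
        (N₂ + j₁.length * b) m') (b * (k * (k * 4 + 8) + 13) + 2) rfl (m.L .fr y)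
        (by simp [hp, b2, b3, b4]) (by simpa [J] using hI₂) ?_).mono ?_
      · intro j₁ z j₂ m₃ hjz hs₃ hz hI₃
        have hzm : z ∈ Finset.Ico 1 (n + 1) := hfr y hym z (by simp [hjz])
        have c1 : m₃.L .bk = m.L .bk := (hs₃.L .bk rfl).trans b1
        have c2 : m₃.N .n 0 = n := ((congrFun (hs₃.N .n rfl) 0).trans
          ((congrFun (hs₂.N .n rfl) 0).trans (congrFun (hs₁.N .n rfl) 0))).trans hn
        set S₃ : Set (ℕ × ℕ) := S₂ ∪ {x | x.1 = p ∧ ∃ z ∈ j₁, x.2 ∈ m.L .bk (z + n)} with hS₃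
        set N₃ := N₂ + j₁.length * b with hN₃
        refine (wp_forIn (fun i₁ m' => J (S₃ ∪ {x | x.1 = p ∧ x.2 ∈ i₁}) (N₃ + i₁.length) m')
          (k * (k * 4 + 8) + 11) rfl (m.L .bk (z + n)) (by simp [hz, c1, c2])
          (by simpa [J] using hI₃) ?_).mono ?_
        · intro i₁ p' i₂ m₄ hip hs₄ hp' hI₄
          have hpl' : p' ∈ l' := hl' z hzm p' (by simp [hip])
          have d0 : ∀ v, v ≠ .img → v ≠ .top → v ≠ .pos → v ≠ .a → v ≠ .b → v ≠ .ok →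
              m₄.N v = m.N v := by
            intro v h1 h2 h3 h4 h5 h6
            refine (hs₄.N v ?_).trans ((hs₃.N v ?_).trans ((hs₂.N v ?_).trans (hs₁.N v ?_))) <;>
            · cases v <;> first | rfl | contradiction
          have d1 : RE.distortion.eval o m₄ = ρ := by
            rw [← hρ]
            simp only [RE.distortion, RE.eval, NE.eval, hs₄.R .rho rfl, hs₃.R .rho rfl,
              hs₂.R .rho rfl, hs₁.R .rho rfl, hs₄.R .eps rfl, hs₃.R .eps rfl,
              hs₂.R .eps rfl, hs₁.R .eps rfl, Mem.R_setL]
          have d2 : m₄.L .l1 = m₂.L .l1 := (hs₄.L .l1 rfl).trans (hs₃.L .l1 rfl)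
          refine (wp_tryJoin hY (by rw [d0 .k] <;> simp [hk]) d1 (d0 .comp (by simp) (by simp)
            (by simp) (by simp) (by simp) (by simp)) (by rw [d0 .ca] <;> simp)
            (by rw [d0 .cb] <;> simp) (p := p) (p' := p') (by simp [d2, hp]) (by simp [hp'])
            hpl hpl' hr hr' hI₄).mono ?_
          rintro t m₅ - ⟨ht, h⟩
          refine ⟨ht, hmono ?_ (by simp [add_assoc]) h⟩
          rintro ⟨x, x'⟩ (hx | ⟨rfl, hx⟩)
          · exact .inr (.inl hx)
          · rcases List.mem_append.1 hx with hx | hx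
            · exact .inr (.inr ⟨rfl, hx⟩)
            · rw [List.mem_singleton] at hx
              exact .inl (by rw [← hx])
        · rintro t m₄ - ⟨ht, h⟩
          have hbz := hb' z hzm
          refine ⟨ht.trans ?_, hmono ?_ ?_ h⟩
          · gcongr
          · rintro ⟨x, x'⟩ (hx | ⟨rfl, u, hu, hx⟩)
            · exact .inl (.inl hx)
            · rcases List.mem_append.1 hu with hu | hu
              · exact .inl (.inr ⟨rfl, u, hu, hx⟩)
              · rw [List.mem_singleton] at hu
                exact .inr ⟨rfl, by rw [← hu]; exact hx⟩
          · rw [List.length_append, List.length_singleton, add_mul, one_mul, hN₃]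
            omega
      · rintro t m₃ - ⟨ht, h⟩
        have hfy := hf y hym
        refine ⟨ht.trans ?_, hmono ?_ ?_ h⟩
        · have : b * (k * (k * 4 + 8) + 13) + 2 + 2 = b * (k * (k * 4 + 8) + 13) + 4 := rfl
          rw [this]
          gcongr
        · rintro ⟨x, x'⟩ (hx | ⟨hx, hx'⟩)
          · exact .inl (.inl hx)
          · rcases List.mem_append.1 hx with hx | hx
            · exact .inl (.inr ⟨hx, hx'⟩)
            · rw [List.mem_singleton] at hx
              subst hx
              exact .inr ⟨rfl, hx'⟩
        · have : (m.L .fr y).length * b ≤ f * b := Nat.mul_le_mul_right _ hfy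
          rw [List.length_append, List.length_singleton, add_mul, one_mul, hN₂]
          omega
    · rintro t m₂ - ⟨ht, h⟩
      have hbw := hb w hwm
      refine ⟨ht.trans ?_, ?_⟩
      · have : f * (b * (k * (k * 4 + 8) + 13) + 4) + 2 + 2 =
          f * (b * (k * (k * 4 + 8) + 13) + 4) + 4 := rfl
        rw [this]
        gcongr
      · have h' := hmono (S' := {x | ∃ w' ∈ Finset.Ico 1 (w + 1), x.1 ∈ m.L .bk w' ∧
          ∃ z ∈ m.L .fr (m.N .img (x.1 + m.N .ea 0)), x.2 ∈ m.L .bk (z + n)})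
          (N' := (w + 1 - 1) * (b * (f * b))) ?_ ?_ h
        · simpa [J] using h'
        · rintro ⟨x, x'⟩ ⟨u, hu, hx⟩
          rw [Finset.mem_Ico] at hu
          rcases Nat.lt_succ_iff_lt_or_eq.1 hu.2 with hlt | rfl
          · exact .inl ⟨u, Finset.mem_Ico.2 ⟨hu.1, hlt⟩, hx⟩
          · exact .inr hx
        · have : (m.L .bk w).length * (f * b) ≤ b * (f * b) := Nat.mul_le_mul_right _ hbw
          obtain ⟨w, rfl⟩ : ∃ v, w = v + 1 := ⟨w - 1, by omega⟩
          simp only [add_tsub_cancel_right, hN₁] at *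
          rw [add_mul, one_mul]
          omega
  · rintro t m' - ⟨ht, h⟩
    refine ⟨?_, by simpa [J] using h⟩
    simp only [add_tsub_cancel_right] at ht
    have : t ≤ n * (b * (f * (b * (k * (k * 4 + 8) + 13) + 4) + 4) + 4) + 2 := ht
    rw [combineTime]
    omega

end ListMachine

namespace ListMachine

/-! ### The tables of partial maps -/

/-- The tables after `i` steps: `tab c` is a table of maps on the component `c`; it contains an
approximation of every matching. Components have distance at least `d`. -/
structure IsTable {X Y : Type*} [MetricSpace X] [MetricSpace Y] (xp : ℕ → X) (pt : ℕ → Y)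
    (n k : ℕ) (ρ ε : ℝ) (N i : ℕ) (d : ℝ) (comp img : ℕ → ℕ) (top : ℕ) (tab : ℕ → List ℕ) :
    Prop where
  comp_lt : ∀ a < k, comp a < k
  card_le : ((Finset.range k).image comp).card + i ≤ k
  diam : ∀ a < k, ∀ b < k, comp a = comp b → dist (xp a) (xp b) ≤ (2 ^ i - 1) * d
  sep : ∀ a < k, ∀ b < k, comp a ≠ comp b → d ≤ dist (xp a) (xp b)
  below : ∀ b < k, ∀ p ∈ tab (comp b), p + k ≤ top
  mem : ∀ b < k, ∀ p ∈ tab (comp b), ∀ a < k, comp a = comp b →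
    img (p + a) ∈ Finset.Ico 1 (n + 1)
  sound : ∀ c < k, ∀ p ∈ tab (comp c), ∀ a < k, ∀ b < k, comp a = comp c → comp b = comp c →
    1 / ((1 + ε) * ρ) * dist (xp a) (xp b) ≤ dist (pt (img (p + a))) (pt (img (p + b))) ∧
      dist (pt (img (p + a))) (pt (img (p + b))) ≤ (1 + ε) * ρ * dist (xp a) (xp b)
  length_le : ∀ b < k, (tab (comp b)).length ≤ N
  complete : ∀ τ : X → Y, IsDistortionMatching ρ τ → ∀ b < k, ∃ p ∈ tab (comp b), ∀ a < k,
    comp a = comp b → dist (pt (img (p + a))) (τ (xp a)) ≤ i * (ε * d / (4 * (k * ρ)))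

variable {X Y : Type*} [MetricSpace X] [MetricSpace Y] {xp : ℕ → X} {pt : ℕ → Y}
  {n k N i : ℕ} {ρ ε d : ℝ} {comp img : ℕ → ℕ} {top : ℕ} {tab : ℕ → List ℕ}

/-- Used when the closest distance grows from one merge to the next. The diameter and error bounds
are nonnegative multiples of `d` and only get weaker; just the separation has to be supplied anew.
-/
lemma IsTable.mono (h : IsTable xp pt n k ρ ε N i d comp img top tab) (hρ : 1 ≤ ρ) (hε : 0 < ε)
    {d' : ℝ} (hd : d ≤ d')
    (hsep : ∀ a < k, ∀ b < k, comp a ≠ comp b → d' ≤ dist (xp a) (xp b)) :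
    IsTable xp pt n k ρ ε N i d' comp img top tab where
  comp_lt := h.comp_lt
  card_le := h.card_le
  diam a ha b hb hab := (h.diam a ha b hb hab).trans
    (mul_le_mul_of_nonneg_left hd (sub_nonneg.2 (one_le_pow₀ one_le_two)))
  sep := hsep
  below := h.below
  mem := h.mem
  sound := h.sound
  length_le := h.length_le
  complete τ hτ b hb := by
    obtain ⟨p, hp, hpa⟩ := h.complete τ hτ b hb
    refine ⟨p, hp, fun a ha hab => (hpa a ha hab).trans ?_⟩
    gcongr

/-- The images spread over at most `2 * ρ * (2 ^ i - 1) * d`. The `- 1` leaves room for the cell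
radius `2 * ρ * d`. -/
lemma IsTable.dist_cell_le (h : IsTable xp pt n k ρ ε N i d comp img top tab) (hρ : 1 ≤ ρ)
    (hε1 : ε ≤ 1) (hd : 0 ≤ d) {cen : ℕ → ℕ} {fr : ℕ → List ℕ} {B : ℕ}
    (hnet : IsNetAt pt n (ρ * d) cen fr B) {c a p : ℕ} (hc : c < k) (ha : a < k)
    (hac : comp a = comp c) (hp : p ∈ tab (comp c)) :
    dist (pt (img (p + a))) (pt (cen (img (p + c)))) ≤ 2 * (ρ * (2 ^ k * d)) := by
  have h1 := (h.sound c hc p hp a ha c hc hac rfl).2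
  have h2 := h.diam a ha c hc hac
  have h3 := hnet.cell _ (h.mem c hc p hp c hc rfl)
  have h4 := dist_triangle (pt (img (p + a))) (pt (img (p + c))) (pt (cen (img (p + c))))
  have hik : i ≤ k := by have := h.card_le; omega
  have h5 : (2 : ℝ) ^ i ≤ 2 ^ k := pow_le_pow_right₀ one_le_two hik
  have h6 : (1 + ε) * ρ * dist (xp a) (xp c) ≤ 2 * ρ * ((2 ^ i - 1) * d) := by
    gcongr
    · linarith
  have h7 : ρ * (2 ^ i * d) ≤ ρ * (2 ^ k * d) := by gcongr
  nlinarith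

/-- The number of components plus the number of merges is at most `k`, and here at least two
components remain. -/
lemma IsTable.succ_lt (h : IsTable xp pt n k ρ ε N i d comp img top tab) {a b : ℕ} (ha : a < k)
    (hb : b < k) (hab : comp a ≠ comp b) : i + 1 < k := by
  have h1 : 1 < ((Finset.range k).image comp).card :=
    Finset.one_lt_card.2 ⟨comp a, Finset.mem_image_of_mem _ (Finset.mem_range.2 ha), comp b,
      Finset.mem_image_of_mem _ (Finset.mem_range.2 hb), hab⟩
  have := h.card_le
  omega

/-- The inductive step. Soundness is inherited inside the old components and was tested across them.
For completeness, the entries near a given `ρ`-matching are followed through thinning, the cross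
test and the neighbour search. -/
lemma IsTable.merge (h : IsTable xp pt n k ρ ε N i d comp img top tab) (hρ : 1 ≤ ρ)
    (hε : 0 < ε) (hε1 : ε ≤ 1) {dX : ℕ → ℕ → ℝ}
    (hX : ∀ a < k, ∀ b < k, dX a b = dist (xp a) (xp b)) {u v : ℕ} (hu : u < k) (hv : v < k)
    (huv : comp u ≠ comp v) (hd : dist (xp u) (xp v) = d) (hd0 : 0 < d)
    {cen : ℕ → ℕ} {fr : ℕ → List ℕ} {B : ℕ} (hnet : IsNetAt pt n (ρ * d) cen fr B)
    {K K' : ℕ → List ℕ}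
    (hK : IsThinning pt n k comp img cen (ε * d / (4 * (k * ρ))) (comp u) u (tab (comp u)) K)
    (hK' : IsThinning pt n k comp img cen (ε * d / (4 * (k * ρ))) (comp v) v (tab (comp v)) K')
    {img' : ℕ → ℕ} {top' : ℕ} {res : List ℕ}
    (hC : Combined pt dX k comp img ((1 + ε) * ρ) (comp u) (comp v) (tab (comp u))
      (tab (comp v)) top {x | ∃ w ∈ Finset.Ico 1 (n + 1), x.1 ∈ K w ∧
        ∃ z ∈ fr (img (x.1 + u)), x.2 ∈ K' z} N img' top' res)
    {comp' : ℕ → ℕ} (hcomp : ∀ a < k, comp' a = if comp a = comp v then comp u else comp a)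
    {tab' : ℕ → List ℕ} (htab : ∀ c, tab' c = if c = comp u then res else tab c) :
    IsTable xp pt n k ρ ε N (i + 1) d comp' img' top' tab' := by
  have hik := h.succ_lt hu hv huv
  have hin : ∀ a < k, comp' a = comp u → comp a = comp u ∨ comp a = comp v := by
    intro a ha hc
    rw [hcomp a ha] at hc
    split_ifs at hc with h1
    · exact .inr h1
    · exact .inl hc
  have hout : ∀ a < k, comp' a ≠ comp u → comp' a = comp a ∧ comp a ≠ comp v := by
    intro a ha hc
    rw [hcomp a ha] at hc ⊢
    split_ifs at hc ⊢ with h1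
    · exact absurd rfl hc
    · exact ⟨rfl, h1⟩
  have htu : tab' (comp u) = res := by rw [htab, if_pos rfl]
  have hto : ∀ b < k, comp' b ≠ comp u → tab' (comp' b) = tab (comp b) := by
    intro b hb hbu
    rw [htab, if_neg hbu, (hout b hb hbu).1]
  have hoo : ∀ b < k, comp' b ≠ comp u → ∀ a < k, comp' a = comp' b → comp a = comp b := by
    intro b hb hbu a ha hab
    rw [← (hout b hb hbu).1, ← hab, (hout a ha (by rwa [hab])).1]
  have himg : ∀ b < k, ∀ p ∈ tab (comp b), ∀ a < k, img' (p + a) = img (p + a) := by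
    intro b hb p hp a ha
    have := h.below b hb p hp
    exact hC.img_eq _ (by omega)
  have hjoin : ∀ {p p' r}, IsJoin k comp img img' (comp u) p p' r →
      (∀ a < k, comp a = comp u → img' (r + a) = img (p + a)) ∧
      (∀ a < k, comp a = comp v → img' (r + a) = img (p' + a)) := by
    intro p p' r hj
    refine ⟨fun a ha hc => ?_, fun a ha hc => ?_⟩
    · rw [hj a ha, if_pos hc]
    · rw [hj a ha, if_neg (by rw [hc]; exact huv.symm)]
  refine ⟨?_, ?_, ?_, ?_, ?_, ?_, ?_, ?_, ?_⟩
  · intro a ha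
    rw [hcomp a ha]
    split_ifs
    · exact h.comp_lt u hu
    · exact h.comp_lt a ha
  · have hsub : (Finset.range k).image comp' ⊆ ((Finset.range k).image comp).erase (comp v) := by
      intro c hc
      obtain ⟨a, ha, rfl⟩ := Finset.mem_image.1 hc
      rw [Finset.mem_range] at ha
      rw [hcomp a ha, Finset.mem_erase]
      split_ifs with h1
      · exact ⟨huv, Finset.mem_image_of_mem _ (Finset.mem_range.2 hu)⟩
      · exact ⟨h1, Finset.mem_image_of_mem _ (Finset.mem_range.2 ha)⟩
    have h1 := Finset.card_le_card hsub
    have hvm : comp v ∈ (Finset.range k).image comp :=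
      Finset.mem_image_of_mem _ (Finset.mem_range.2 hv)
    rw [Finset.card_erase_of_mem hvm] at h1
    have h2 := Finset.card_pos.2 ⟨_, hvm⟩
    have h3 := h.card_le
    omega
  · have h2 : (1 : ℝ) ≤ 2 ^ i := one_le_pow₀ one_le_two
    -- Going through `u` and `v` gives `(2 ^ i - 1) * d + d + (2 ^ i - 1) * d = (2 ^ (i + 1) - 1) *
    -- d`.
    have hcross : ∀ a < k, ∀ b < k, comp a = comp u → comp b = comp v →
        dist (xp a) (xp b) ≤ (2 ^ (i + 1) - 1) * d := by
      intro a ha b hb h1 h3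
      have h4 := h.diam a ha u hu h1
      have h5 := h.diam v hv b hb h3.symm
      have h6 := dist_triangle4 (xp a) (xp u) (xp v) (xp b)
      rw [pow_succ]
      nlinarith
    intro a ha b hb hab
    by_cases hcc : comp a = comp b
    · refine (h.diam a ha b hb hcc).trans ?_
      rw [pow_succ]
      nlinarith
    · by_cases hbu : comp' b = comp u
      · rcases hin b hb hbu with h3 | h3 <;> rcases hin a ha (hab.trans hbu) with h4 | h4
        · exact absurd (h4.trans h3.symm) hcc
        · rw [dist_comm]
          exact hcross b hb a ha h3 h4
        · exact hcross a ha b hb h4 h3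
        · exact absurd (h4.trans h3.symm) hcc
      · exact absurd (hoo b hb hbu a ha hab) hcc
  · intro a ha b hb hab
    refine h.sep a ha b hb fun hc => hab ?_
    rw [hcomp a ha, hcomp b hb, hc]
  · intro b hb p hp
    by_cases hbu : comp' b = comp u
    · rw [hbu, htu] at hp
      exact (hC.sound p hp).1
    · rw [hto b hb hbu] at hp
      exact (h.below b hb p hp).trans hC.le_top
  · intro b hb p hp a ha hab
    by_cases hbu : comp' b = comp u
    · rw [hbu, htu] at hp
      obtain ⟨-, x, hx, y, hy, -, hj⟩ := hC.sound p hp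
      rcases hin a ha (hab.trans hbu) with h1 | h1
      · rw [(hjoin hj).1 a ha h1]
        exact h.mem u hu x hx a ha h1
      · rw [(hjoin hj).2 a ha h1]
        exact h.mem v hv y hy a ha h1
    · rw [hto b hb hbu] at hp
      rw [himg b hb p hp a ha]
      exact h.mem b hb p hp a ha (hoo b hb hbu a ha hab)
  · intro c hc p hp a ha b hb hac hbc
    by_cases hcu : comp' c = comp u
    · rw [hcu, htu] at hp
      obtain ⟨-, x, hx, y, hy, hcp, hj⟩ := hC.sound p hp
      obtain ⟨j1, j2⟩ := hjoin hj
      rcases hin a ha (hac.trans hcu) with h1 | h1 <;> rcases hin b hb (hbc.trans hcu) with h2 | h2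
      · rw [j1 a ha h1, j1 b hb h2]
        exact h.sound u hu x hx a ha b hb h1 h2
      · rw [j1 a ha h1, j2 b hb h2, ← hX a ha b hb]
        exact hcp a ha b hb h1 h2
      · rw [j2 a ha h1, j1 b hb h2, dist_comm (xp a), dist_comm (pt _), ← hX b hb a ha]
        exact hcp b hb a ha h2 h1
      · rw [j2 a ha h1, j2 b hb h2]
        exact h.sound v hv y hy a ha b hb h1 h2
    · rw [hto c hc hcu] at hp
      rw [himg c hc p hp a ha, himg c hc p hp b hb]
      exact h.sound c hc p hp a ha b hb (hoo c hc hcu a ha hac) (hoo c hc hcu b hb hbc)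
  · intro b hb
    by_cases hbu : comp' b = comp u
    · rw [hbu, htu]
      exact hC.length_le
    · rw [hto b hb hbu]
      exact h.length_le b hb
  · intro τ hτ b hb
    have hk0 : (0 : ℝ) < k := by
      have : 0 < k := by omega
      exact_mod_cast this
    set s := ε * d / (4 * (k * ρ)) with hs
    have hs0 : 0 < s := by positivity
    -- The entry near `τ` is replaced by a kept map of its bucket at distance at most `s`. This is
    -- where the error factor grows from `i` to `i + 1`.
    have happ : ∀ {c : ℕ} (_ : c < k) {K : ℕ → List ℕ}
        (_ : IsThinning pt n k comp img cen s (comp c) c (tab (comp c)) K),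
        ∃ q ∈ tab (comp c), q ∈ K (cen (img (q + c))) ∧ ∀ a < k, comp a = comp c →
          dist (pt (img (q + a))) (τ (xp a)) ≤ ((i + 1 : ℕ) : ℝ) * s := by
      intro c hc K hK
      obtain ⟨p, hp, hpa⟩ := h.complete τ hτ c hc
      obtain ⟨q, hq, hpq⟩ := hK.close p hp
      obtain ⟨h1, h2⟩ := hK.sub _ (hnet.mem _ (h.mem c hc p hp c hc rfl)) q hq
      refine ⟨q, h1, by rwa [h2], fun a ha hac => ?_⟩
      have h3 := hpa a ha hac
      have h4 := hpq a ha hac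
      have h5 := dist_triangle_left (pt (img (q + a))) (τ (xp a)) (pt (img (p + a)))
      push_cast
      linarith
    by_cases hbu : comp' b = comp u
    · obtain ⟨p, hp, hpK, hpa⟩ := happ hu hK
      obtain ⟨p', hp', hpK', hpa'⟩ := happ hv hK'
      have herr : ((i + 1 : ℕ) : ℝ) * s ≤ ε * d / (4 * ρ) := by
        have h1 : ((i + 1 : ℕ) : ℝ) ≤ k := by exact_mod_cast hik.le
        calc ((i + 1 : ℕ) : ℝ) * s ≤ k * s := by gcongr
          _ = ε * d / (4 * ρ) := by rw [hs]; field_simp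
      -- Each image is off by at most `ε * d / (4 * ρ)`, and `d ≤ D`, so the distance of the images
      -- changes by at most `ε * D / (2 * ρ)`. The lower bound survives because `1 / (1 + ε) ≤ 1 - ε
      -- / 2` for `ε ≤ 1`, the upper one because `1 / ρ ≤ ρ`.
      have hcompat : Compatible pt dX k comp img ((1 + ε) * ρ) (comp u) (comp v) p p' := by
        intro a ha c hc hau hcv
        rw [hX a ha c hc]
        have h1 := (hpa a ha hau).trans herr
        have h2 := (hpa' c hc hcv).trans herr
        obtain ⟨h3, h4⟩ := hτ (xp a) (xp c)
        have h5 : d ≤ dist (xp a) (xp c) := h.sep a ha c hc (by rw [hau, hcv]; exact huv)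
        set D := dist (xp a) (xp c)
        have h6 := dist_triangle4 (pt (img (p + a))) (τ (xp a)) (τ (xp c)) (pt (img (p' + c)))
        have h7 := dist_triangle4 (τ (xp a)) (pt (img (p + a))) (pt (img (p' + c))) (τ (xp c))
        rw [dist_comm (τ (xp c))] at h6
        rw [dist_comm (τ (xp a)) (pt _)] at h7
        have h8 : ε * d / (4 * ρ) ≤ (1 / ρ) * (ε * D) / 4 := by
          rw [show (1 / ρ) * (ε * D) / 4 = ε * D / (4 * ρ) by field_simp]
          gcongr
        have hD : 0 ≤ D := dist_nonneg
        have hρ1 : 1 / ρ ≤ 1 := by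
          rw [div_le_one (by linarith)]
          exact hρ
        have hεD : 0 ≤ ε * D := by positivity
        have h9 : (1 / ρ) * (ε * D) ≤ ρ * (ε * D) :=
          mul_le_mul_of_nonneg_right (hρ1.trans hρ) hεD
        constructor
        · have h10 : 1 / ((1 + ε) * ρ) * D = (1 / (1 + ε)) * (1 / ρ * D) := by
            field_simp
          have h11 : 1 / (1 + ε) ≤ 1 - ε / 2 := by
            rw [div_le_iff₀ (by linarith)]
            nlinarith
          have h12 : 0 ≤ 1 / ρ * D := by positivity
          rw [h10]
          have h13 := mul_le_mul_of_nonneg_right h11 h12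
          nlinarith
        · nlinarith
      have hmp := h.mem u hu p hp u hu rfl
      have hmp' := h.mem v hv p' hp' v hv rfl
      -- The images of the closest pair are at most `(1 + ε) * ρ * d ≤ 2 * (ρ * d)` apart, the range
      -- within which the net lists neighbours.
      have hfr : cen (img (p' + v)) ∈ fr (img (p + u)) := by
        refine hnet.near _ hmp _ hmp' ?_
        have h1 := (hcompat u hu v hv rfl rfl).2
        rw [hX u hu v hv, hd] at h1
        nlinarith [mul_nonneg (by linarith : (0 : ℝ) ≤ ρ) hd0.le]
      obtain ⟨r, hr, hj⟩ := hC.complete (p, p')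
        ⟨_, hnet.mem _ hmp, hpK, _, hfr, hpK'⟩ hcompat
      obtain ⟨j1, j2⟩ := hjoin hj
      refine ⟨r, by rwa [hbu, htu], fun a ha hab => ?_⟩
      rcases hin a ha (hab.trans hbu) with h1 | h1
      · rw [j1 a ha h1]
        exact hpa a ha h1
      · rw [j2 a ha h1]
        exact hpa' a ha h1
    -- Components not involved keep their tables; only the permitted error increases.
    · obtain ⟨p, hp, hpa⟩ := h.complete τ hτ b hb
      refine ⟨p, by rwa [hto b hb hbu], fun a ha hab => ?_⟩
      rw [himg b hb p hp a ha]
      refine (hpa a ha (hoo b hb hbu a ha hab)).trans ?_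
      push_cast
      nlinarith

end ListMachine

namespace ListMachine

open RealRAM (Oracle)

/-! ### The algorithm -/

/-- Setting up the tables of maps on single points. -/
def initTables : Cmd :=
  forX .a (.blk [.setN .comp (.var .a) (.var .a), .setL .tab (.var .a) .nil,
    forY (.blk [.setN .img (.add (.var .top) (.var .a)) (.var .y),
      .cons .tab (.var .a) (.var .top) (.get .tab (.var .a)),
      .put .top (.add (.var .top) (.var .k))])])

/-- Comparing a pair of points with the closest pair found before. -/
def comparePair : Cmd :=
  .ite (.and (.not (.eq (.get .comp (.var .a)) (.get .comp (.var .b))))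
      (.not (.and (.leN (.lit 1) (.var .go)) (.not (.leR (.dX (.var .a) (.var .b)) (.var .d))))))
    (.blk [.put .go (.lit 1), .setR .d (.dX (.var .a) (.var .b)), .put .ea (.var .a),
      .put .eb (.var .b)]) .skip

/-- Finding the closest pair of points in different components. -/
def findPair : Cmd := .blk [.put .go (.lit 0), forX .a (forX .b comparePair)]

/-- Merging the components of the points `ea` and `eb`. -/
def mergeStep : Cmd :=
  .blk [buildNet,
    .setR .s (.div (.mul (.var .eps) (.var .d))
      (.mul (.ofNat (.lit 4)) (.mul (.ofNat (.var .k)) (.var .rho)))),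
    .put .ca (.get .comp (.var .ea)), .put .cb (.get .comp (.var .eb)),
    .forTo .pos (.lit 1) (.add (.var .n) (.succ .n)) (.setL .bk (.var .pos) .nil),
    .put .c0 (.var .ca), .put .a0 (.var .ea), .put .off (.lit 0), thin,
    .put .c0 (.var .cb), .put .a0 (.var .eb), .put .off (.var .n), thin,
    combine,
    .setL .tab (.var .ca) (.get .res (.lit 0)),
    forX .a (.ite (.eq (.get .comp (.var .a)) (.var .cb)) (.setN .comp (.var .a) (.var .ca)) .skip)]

/-- Reporting a map from the table of the last component. -/
def report : Cmd :=
  .ite (.isNil .tab (.get .comp (.lit 0))) (.put .flag (.lit 0))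
    (.blk [.setL .l1 (.lit 0) (.get .tab (.get .comp (.lit 0))),
      forX .a (.out (.var .a) (.sub (.image .l1 .a) (.lit 1))), .put .flag (.lit 1)])

/-- The algorithm for the distortion problem. -/
def solve : Cmd :=
  .blk [initTables, findPair, .while (.leN (.lit 1) (.var .go)) (.blk [mergeStep, findPair]),
    report]

variable {X Y : Type*} [MetricSpace X] [MetricSpace Y] {xp : ℕ → X} {pt : ℕ → Y}
  {n k N : ℕ} {ρ ε : ℝ} {o : Oracle} {q : ℕ} {m : Mem}

/-- The table of the component `{c}` contains the maps to the points `1, …, j - 1`. -/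
structure IsInit (n k c j : ℕ) (m : Mem) : Prop where
  comp : m.N .comp c = c
  le_top : ∀ p ∈ m.L .tab c, p + k ≤ m.N .top 0
  img_mem : ∀ p ∈ m.L .tab c, m.N .img (p + c) ∈ Finset.Ico 1 (n + 1)
  length_eq : (m.L .tab c).length + 1 = j
  complete : ∀ y ∈ Finset.Ico 1 j, ∃ p ∈ m.L .tab c, m.N .img (p + c) = y

lemma IsInit.congr {c j : ℕ} {m' : Mem} (hc : c < k) (h : IsInit n k c j m)
    (h1 : m'.N .comp c = m.N .comp c) (h2 : m'.L .tab c = m.L .tab c)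
    (h3 : m.N .top 0 ≤ m'.N .top 0) (h4 : ∀ x < m.N .top 0, m'.N .img x = m.N .img x) :
    IsInit n k c j m' := by
  have h5 : ∀ p ∈ m.L .tab c, m'.N .img (p + c) = m.N .img (p + c) := fun p hp =>
    h4 _ (by have := h.le_top p hp; omega)
  refine ⟨h1.trans h.comp, fun p hp => ?_, fun p hp => ?_, by rw [h2, h.length_eq],
    fun y hy => ?_⟩
  · rw [h2] at hp
    exact (h.le_top p hp).trans h3
  · rw [h2] at hp
    rw [h5 p hp]
    exact h.img_mem p hp
  · obtain ⟨p, hp, hpy⟩ := h.complete y hy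
    exact ⟨p, by rwa [h2], by rw [h5 p hp, hpy]⟩

/-- A single point has diameter zero and its table contains all `n` maps, so approximation is exact.
Hence one may begin with `i = 0` and `d = 0`. -/
lemma wp_initTables (hk : m.N .k 0 = k) (hn : m.N .n 0 = n) (hnN : n ≤ N)
    (hsurj : ∀ y : Y, ∃ j ∈ Finset.Ico 1 (n + 1), pt j = y) (xp : ℕ → X) (ρ ε : ℝ) :
    wp o q initTables m fun t m' => t ≤ k * (n * 6 + 7) + 2 ∧
      IsTable xp pt n k ρ ε N 0 0 (m'.N .comp) (m'.N .img) (m'.N .top 0) (m'.L .tab) := by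
  refine (wp_forTo (fun i m' => ∀ c < i, IsInit n k c (n + 1) m') 0 k (n * 6 + 5) rfl rfl
    (fun m' hs => by simp [hs.N .k rfl, hk]) (by omega) (by simp) ?_).mono ?_
  · intro i m₁ hs₁ hi hi' ha hI
    have k₁ : m₁.N .k 0 = k := (congrFun (hs₁.N .k rfl) 0).trans hk
    have n₁ : m₁.N .n 0 = n := (congrFun (hs₁.N .n rfl) 0).trans hn
    simp only [wp_blk_cons, wp_blk_nil, wp_setN, wp_setL, NE.eval, LE.eval, ha,
      Mem.N_setN_ne, ne_eq, reduceCtorEq, not_false_eq_true]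
    refine (wp_forTo (fun j m' => (∀ c < i, IsInit n k c (n + 1) m') ∧ IsInit n k i j m')
      1 (n + 1) 4 rfl rfl (fun m' hs => by simp [hs.N .n rfl, n₁]) (by omega) ?_ ?_).mono ?_
    · refine ⟨fun c hc => (hI c hc).congr (by omega) ?_ ?_ ?_ ?_, ?_⟩
      · simp [hc.ne]
      · simp [hc.ne]
      · simp
      · simp
      · exact ⟨by simp, by simp, by simp, by simp, by simp⟩
    · rintro j m₂ hs₂ hj hj' hy ⟨hJ, hJi⟩
      have a₂ : m₂.N .a 0 = i := (congrFun (hs₂.N .a rfl) 0).trans (by simpa using ha)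
      have k₂ : m₂.N .k 0 = k := (congrFun (hs₂.N .k rfl) 0).trans (by simpa using k₁)
      simp only [wp_blk_cons, wp_blk_nil, wp_setN, wp_cons, NE.eval, LE.eval, a₂, hy, k₂,
        Mem.N_setN_ne, ne_eq, reduceCtorEq, not_false_eq_true, Mem.N_setL, Mem.L_setN]
      refine ⟨by omega, fun c hc => (hJ c hc).congr (by omega) ?_ ?_ ?_ ?_, ?_, ?_, ?_, ?_, ?_⟩
      · simp
      · simp [hc.ne]
      · simp
      · intro x hx
        have : x ≠ m₂.N .top 0 + i := by omega
        simp [this]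
      · simpa using hJi.comp
      · intro p hp
        simp only [Mem.L_setN, Mem.L_setL_self, Function.update_self, List.mem_cons] at hp
        rcases hp with rfl | hp
        · simp
        · have := hJi.le_top p hp
          simp
          omega
      · intro p hp
        simp only [Mem.L_setN, Mem.L_setL_self, Function.update_self, List.mem_cons] at hp
        rcases hp with rfl | hp
        · simp
          omega
        · have h1 := hJi.le_top p hp
          have h2 : p ≠ m₂.N .top 0 := by omega
          simpa [h2] using hJi.img_mem p hp
      · have := hJi.length_eq
        simp [this]
      · intro y hy'
        simp only [Mem.L_setN, Mem.L_setL_self, Function.update_self, List.mem_cons]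
        rcases Nat.lt_succ_iff_lt_or_eq.1 (Finset.mem_Ico.1 hy').2 with h | rfl
        · obtain ⟨p, hp, hpy⟩ := hJi.complete y (Finset.mem_Ico.2 ⟨(Finset.mem_Ico.1 hy').1, h⟩)
          have h1 := hJi.le_top p hp
          have h2 : p ≠ m₂.N .top 0 := by omega
          exact ⟨p, .inr hp, by simpa [h2] using hpy⟩
        · exact ⟨_, .inl rfl, by simp⟩
    · rintro t m₃ - ⟨ht, hJ, hJi⟩
      have ht' : t ≤ n * 6 + 2 := ht
      refine ⟨by omega, fun c hc => ?_⟩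
      rcases Nat.lt_succ_iff_lt_or_eq.1 hc with h | rfl
      · exact (hJ c h).congr (by omega) (by simp) (by simp) (by simp) (by simp)
      · exact hJi.congr hi' (by simp) (by simp) (by simp) (by simp)
  · rintro t m' - ⟨ht, h⟩
    have hc : ∀ a < k, m'.N .comp a = a := fun a ha => (h a ha).comp
    have hinj : ∀ {a b}, a < k → b < k → m'.N .comp a = m'.N .comp b → a = b :=
      fun ha hb hab => by rwa [hc _ ha, hc _ hb] at hab
    refine ⟨ht, fun a ha => by rwa [hc a ha], ?_, ?_, fun _ _ _ _ _ => dist_nonneg, ?_, ?_, ?_,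
      ?_, ?_⟩
    · simpa using Finset.card_image_le (s := Finset.range k) (f := m'.N .comp)
    · intro a ha b hb hab
      simp [hinj ha hb hab]
    · intro b hb p hp
      rw [hc b hb] at hp
      exact (h b hb).le_top p hp
    · intro b hb p hp a ha hab
      rw [hc b hb] at hp
      rw [hinj ha hb hab]
      exact (h b hb).img_mem p hp
    · intro c hck p hp a ha b hb hac hbc
      rw [hinj ha hck hac, hinj hb hck hbc]
      simp
    · intro b hb
      have := (h b hb).length_eq
      rw [hc b hb]
      omega
    · intro τ _ b hb
      obtain ⟨j, hj, hjy⟩ := hsurj (τ (xp b))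
      obtain ⟨p, hp, hpj⟩ := (h b hb).complete j hj
      refine ⟨p, by rwa [hc b hb], fun a ha hab => ?_⟩
      rw [hinj ha hb hab, hpj, hjy]
      simp

/-- Among the pairs of points in different components that satisfy `S`, the pair `ea`, `eb` is
closest, if there is any. -/
def IsClosest (dX : ℕ → ℕ → ℝ) (k : ℕ) (m : Mem) (S : ℕ → ℕ → Prop) : Prop :=
  (m.N .go 0 = 0 ∧ ∀ a b, S a b → m.N .comp a = m.N .comp b) ∨
  (m.N .go 0 = 1 ∧ m.N .ea 0 < k ∧ m.N .eb 0 < k ∧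
    m.N .comp (m.N .ea 0) ≠ m.N .comp (m.N .eb 0) ∧ m.R .d = dX (m.N .ea 0) (m.N .eb 0) ∧
    ∀ a b, S a b → m.N .comp a ≠ m.N .comp b → m.R .d ≤ dX a b)

lemma IsClosest.congr {dX : ℕ → ℕ → ℝ} {m' : Mem} {S S' : ℕ → ℕ → Prop}
    (h : IsClosest dX k m S) (hS : ∀ a b, S' a b → S a b) (h1 : m'.N .go = m.N .go)
    (h2 : m'.N .ea = m.N .ea) (h3 : m'.N .eb = m.N .eb) (h4 : m'.N .comp = m.N .comp)
    (h5 : m'.R .d = m.R .d) : IsClosest dX k m' S' := by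
  rw [IsClosest, h1, h2, h3, h4, h5]
  exact h.imp (fun h => ⟨h.1, fun a b hab => h.2 a b (hS a b hab)⟩)
    fun h => ⟨h.1, h.2.1, h.2.2.1, h.2.2.2.1, h.2.2.2.2.1,
      fun a b hab => h.2.2.2.2.2 a b (hS a b hab)⟩

/-- There is no infinite initial value for `d`; while `go` is `0`, any pair in different components
is accepted. Afterwards a pair replaces the stored one if its distance is at most `d`. -/
lemma wp_comparePair {i j : ℕ} {S : ℕ → ℕ → Prop} (hi : i < k) (hj : j < k)
    (ha : m.N .a 0 = i) (hb : m.N .b 0 = j) (h : IsClosest o.distX k m S) :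
    wp o q comparePair m fun t m' => t ≤ 6 ∧
      IsClosest o.distX k m' fun a b => S a b ∨ a = i ∧ b = j := by
  simp only [comparePair, wp_ite, wp_blk_cons, wp_blk_nil, wp_setN, wp_setR, wp_skip, BE.Holds,
    RE.eval, NE.eval, ha, hb, ← le_antisymm_iff, Mem.N_setN_ne, ne_eq, reduceCtorEq,
    not_false_eq_true, Mem.N_setR]
  refine ⟨fun ⟨h1, h2⟩ => ⟨by omega, .inr ?_⟩, fun h1 => ⟨by omega, ?_⟩⟩
  · simp only [ne_eq, reduceCtorEq, not_false_eq_true, Mem.N_setN_ne, Mem.N_setR,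
      Mem.N_setN_self, Function.update_self, Mem.R_setN, Mem.R_setR_self]
    refine ⟨trivial, hi, hj, h1, trivial, ?_⟩
    rintro a b (hab | ⟨rfl, rfl⟩) hne
    · rcases h with ⟨-, h3⟩ | ⟨h3, -, -, -, -, h4⟩
      · exact absurd (h3 a b hab) hne
      · rw [h3] at h2
        have : o.distX i j ≤ m.R .d := by
          by_contra h5
          exact h2 ⟨le_rfl, h5⟩
        exact this.trans (h4 a b hab hne)
    · exact le_rfl
  · rcases h with ⟨h3, h4⟩ | ⟨h3, h5, h6, h7, h8, h4⟩
    · refine .inl ⟨h3, ?_⟩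
      rintro a b (hab | ⟨rfl, rfl⟩)
      · exact h4 a b hab
      · by_contra hne
        exact h1 ⟨hne, fun h => by omega⟩
    · refine .inr ⟨h3, h5, h6, h7, h8, ?_⟩
      rintro a b (hab | ⟨rfl, rfl⟩) hne
      · exact h4 a b hab hne
      · by_contra hlt
        exact h1 ⟨hne, fun h => h.2 (not_le.1 hlt).le⟩

lemma wp_findPair (hk : m.N .k 0 = k) :
    wp o q findPair m fun t m' => t ≤ k * (k * 8 + 4) + 4 ∧
      IsClosest o.distX k m' fun a b => a < k ∧ b < k := by
  simp only [findPair, wp_blk_cons, wp_blk_nil, wp_setN, NE.eval]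
  refine (wp_forTo (fun i m' => IsClosest o.distX k m' fun a b => a < i ∧ b < k) 0 k (k * 8 + 2)
    rfl rfl (fun m' hs => by simp [hs.N .k rfl, hk]) (by omega) (.inl (by simp)) ?_).mono ?_
  · intro i m₁ hs₁ hi hi' ha hI
    have k₁ : m₁.N .k 0 = k := (congrFun (hs₁.N .k rfl) 0).trans hk
    refine (wp_forTo (fun j m' => IsClosest o.distX k m' fun a b => a < i ∧ b < k ∨ a = i ∧ b < j)
      0 k 6 rfl rfl (fun m' hs => by simp [hs.N .k rfl, k₁]) (by omega) ?_ ?_).mono ?_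
    · exact hI.congr (fun a b => by omega) (by simp) (by simp) (by simp) (by simp) (by simp)
    · intro j m₂ hs₂ _ hj hb hJ
      have a₂ : m₂.N .a 0 = i := (congrFun (hs₂.N .a rfl) 0).trans ha
      refine (wp_comparePair hi' hj a₂ hb hJ).mono ?_
      rintro t m₃ - ⟨ht, h⟩
      exact ⟨ht, h.congr (fun a b => by omega) (by simp) (by simp) (by simp) (by simp) (by simp)⟩
    · rintro t m₃ - ⟨ht, h⟩
      exact ⟨ht, h.congr (fun a b => by omega) (by simp) (by simp) (by simp) (by simp) (by simp)⟩
  · rintro t m' - ⟨ht, h⟩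
    have ht' : t ≤ k * (k * 8 + 4) + 2 := ht
    exact ⟨by omega, h⟩

end ListMachine

/-! ### Correctness of the merging step and of the whole algorithm -/

namespace ListMachine

open RealRAM (Oracle)

/-- The two memories agree on the input, on the tables, and on the current pair of points. -/
structure SameData (m m' : Mem) : Prop where
  k : m'.N .k = m.N .k
  n : m'.N .n = m.N .n
  comp : m'.N .comp = m.N .comp
  img : m'.N .img = m.N .img
  top : m'.N .top = m.N .top
  ea : m'.N .ea = m.N .ea
  eb : m'.N .eb = m.N .eb
  tab : m'.L .tab = m.L .tab
  rho : m'.R .rho = m.R .rho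
  eps : m'.R .eps = m.R .eps
  d : m'.R .d = m.R .d

lemma SameData.trans {m m' m'' : Mem} (h : SameData m m') (h' : SameData m' m'') :
    SameData m m'' :=
  ⟨h'.k.trans h.k, h'.n.trans h.n, h'.comp.trans h.comp, h'.img.trans h.img, h'.top.trans h.top,
    h'.ea.trans h.ea, h'.eb.trans h.eb, h'.tab.trans h.tab, h'.rho.trans h.rho,
    h'.eps.trans h.eps, h'.d.trans h.d⟩

variable {X Y : Type*} [MetricSpace X] [MetricSpace Y] {xp : ℕ → X} {pt : ℕ → Y}
  {n k N i B e b L : ℕ} {ρ ε D r : ℝ} {o : Oracle} {q : ℕ} {m : Mem}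

/-- The bound for the time of computing a net. -/
def netTime (n B L : ℕ) : ℕ := n * 10 + 20 + L * (n * (2 * (B ^ 3 * (B ^ 2 * 4 + 4)) + 30) + 13)

/-- The bound for the time of merging two components. -/
def mergeTime (n k B L b : ℕ) : ℕ :=
  netTime n B L + 2 * thinTime k (n * (b * (B ^ 3 * b))) b + combineTime n k b (B ^ 3) + n * 6 +
    k * 4 + 20

set_option maxHeartbeats 1000000 in
lemma wp_mergeStep (hY : Represents o.distY pt n) (hB : IsDoublingConst Y B)
    (hX : ∀ a < k, ∀ b < k, o.distX a b = dist (xp a) (xp b))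
    (hxp : ∀ a < k, ∀ b < k, xp a = xp b → a = b)
    (hρ : 1 ≤ ρ) (hε : 0 < ε) (hε1 : ε ≤ 1) (hn1 : 1 ≤ n)
    (hD : ∀ y ∈ Finset.Ico 1 (n + 1), ∀ z ∈ Finset.Ico 1 (n + 1), dist (pt y) (pt z) ≤ D)
    (hr : ∀ y ∈ Finset.Ico 1 (n + 1), ∀ z ∈ Finset.Ico 1 (n + 1), y ≠ z →
      r ≤ dist (pt y) (pt z))
    (hL : ∀ i : ℕ, 2 ^ i * r ≤ 2 * D → i < L)
    (he : 2 ^ (k + 4) * k * ρ ^ 2 / ε ≤ (2 : ℝ) ^ e) (hb : b = (B ^ e) ^ k)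
    (hmk : m.N .k 0 = k) (hmn : m.N .n 0 = n) (hmρ : m.R .rho = ρ) (hmε : m.R .eps = ε)
    (h : IsTable xp pt n k ρ ε (n * (b * (B ^ 3 * b))) i (m.R .d) (m.N .comp) (m.N .img)
      (m.N .top 0) (m.L .tab))
    (hea : m.N .ea 0 < k) (heb : m.N .eb 0 < k)
    (hne : m.N .comp (m.N .ea 0) ≠ m.N .comp (m.N .eb 0))
    (hd : m.R .d = dist (xp (m.N .ea 0)) (xp (m.N .eb 0))) :
    wp o q mergeStep m fun t m' => t ≤ mergeTime n k B L b ∧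
      IsTable xp pt n k ρ ε (n * (b * (B ^ 3 * b))) (i + 1) (m.R .d) (m'.N .comp) (m'.N .img)
        (m'.N .top 0) (m'.L .tab) := by
  set d := m.R .d with hd_def
  have hd0 : 0 < d := by
    rw [hd, dist_pos]
    exact fun h' => hne (by rw [hxp _ hea _ heb h'])
  have hk0 : 0 < k := by omega
  have hk0' : (0 : ℝ) < k := by exact_mod_cast hk0
  have hρ0 : 0 < ρ := by linarith
  simp only [mergeStep, wp_blk_cons, wp_blk_nil]
  refine (wp_buildNet hY hB hmn hn1 hD hr hL (by rw [hmρ, ← hd_def]; positivity)).mono ?_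
  rintro t₁ m₁ hs₁ ⟨ht₁, hnet⟩
  have s₁ : SameData m m₁ := ⟨hs₁.N _ rfl, hs₁.N _ rfl, hs₁.N _ rfl, hs₁.N _ rfl, hs₁.N _ rfl,
    hs₁.N _ rfl, hs₁.N _ rfl, hs₁.L _ rfl, hs₁.R _ rfl, hs₁.R _ rfl, hs₁.R _ rfl⟩
  rw [hmρ, ← hd_def] at hnet
  set cen := m₁.N .cen with hcen
  set fr := m₁.L .fr with hfr
  set s := ε * d / (4 * (k * ρ)) with hs
  have hs0 : 0 < s := by positivity
  -- After clearing denominators this reads `16 * 2 ^ k * k * ρ ^ 2 ≤ ε * 2 ^ e`, the origin of `2 ^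
  -- (k + 4)` in `he`.
  have hRs : 2 * (2 * (ρ * (2 ^ k * d)) / 2 ^ e) ≤ s := by
    rw [div_le_iff₀ hε] at he
    rw [hs, mul_div_assoc', div_le_div_iff₀ (by positivity) (by positivity)]
    rw [pow_add] at he
    have := mul_le_mul_of_nonneg_right he hd0.le
    nlinarith
  set u := m.N .ea 0 with hu
  set v := m.N .eb 0 with hv
  set ca := m.N .comp u with hca
  set cb := m.N .comp v with hcb
  simp only [wp_setR, wp_setN, NE.eval, RE.eval, Mem.N_setR, Mem.N_setN_ne, ne_eq, reduceCtorEq,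
    not_false_eq_true, s₁.k, s₁.comp, s₁.ea, s₁.eb, s₁.rho, s₁.eps, s₁.d, ← hu, ← hv,
    ← hca, ← hcb, hmk, hmρ, hmε, ← hd_def, Nat.cast_ofNat, ← hs]
  set m₂ := ((m₁.setR .s s).setN .ca 0 ca).setN .cb 0 cb with hm₂
  have s₂ : SameData m m₂ := s₁.trans (by constructor <;> simp [hm₂])
  have f₂ : m₂.N .cen = cen ∧ m₂.L .fr = fr ∧ m₂.R .s = s ∧ m₂.N .ca 0 = ca ∧
    m₂.N .cb 0 = cb := by simp [hm₂, hcen, hfr]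
  clear_value m₂
  have hn₂ : m₂.N .n 0 = n := by rw [s₂.n, hmn]
  refine (wp_forTo (fun i m' => ∀ w ∈ Finset.Ico 1 i, m'.L .bk w = []) 1 (n + (n + 1)) 1 rfl rfl
    (fun m' hs => by simp [hs.N .n rfl, hn₂]) (by omega) (by simp) ?_).mono ?_
  · intro i m' hs hi hi' hy hI
    simp only [wp_setL, NE.eval, hy, LE.eval]
    refine ⟨le_rfl, fun w hw => ?_⟩
    by_cases hwi : w = i
    · simp [hwi]
    · simp only [Finset.mem_Ico] at hw hI
      simpa [hwi] using hI w (by omega)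
  rintro t₃ m₃ hs₃ ⟨ht₃, hbk⟩
  have s₃ : SameData m m₃ := s₂.trans ⟨hs₃.N _ rfl, hs₃.N _ rfl, hs₃.N _ rfl, hs₃.N _ rfl,
    hs₃.N _ rfl, hs₃.N _ rfl, hs₃.N _ rfl, hs₃.L _ rfl, hs₃.R _ rfl, hs₃.R _ rfl, hs₃.R _ rfl⟩
  have f₃ : m₃.N .cen = cen ∧ m₃.L .fr = fr ∧ m₃.R .s = s ∧ m₃.N .ca 0 = ca ∧
      m₃.N .cb 0 = cb := by
    rw [hs₃.N .cen rfl, hs₃.L .fr rfl, hs₃.R .s rfl, hs₃.N .ca rfl, hs₃.N .cb rfl]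
    exact f₂
  simp only [s₃.ea, ← hu, f₃.2.2.2.1]
  set m₄ := ((m₃.setN .c0 0 ca).setN .a0 0 u).setN .off 0 0 with hm₄
  have s₄ : SameData m m₄ := s₃.trans (by constructor <;> simp [hm₄])
  have f₄ : m₄.N .cen = cen ∧ m₄.L .fr = fr ∧ m₄.R .s = s ∧ m₄.N .ca 0 = ca ∧
    m₄.N .cb 0 = cb := by simpa [hm₄] using f₃
  have g₄ : m₄.N .c0 0 = ca ∧ m₄.N .a0 0 = u ∧ m₄.N .off 0 = 0 ∧ m₄.L .bk = m₃.L .bk := by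
    simp [hm₄]
  clear_value m₄
  have hthin := wp_thin (q := q) (m := m₄) hY hB (by rw [s₄.k, hmk]) (by rw [f₄.2.2.1]; exact hs0.le)
    (R := 2 * (ρ * (2 ^ k * d))) (e := e) (by rw [f₄.2.2.1]; exact hRs)
    (by rw [f₄.1]; exact hnet.mem) (by rw [g₄.2.1]; exact hea)
    (by rw [s₄.comp, g₄.1, g₄.2.1])
    (by rw [s₄.comp, s₄.img, s₄.tab, g₄.1]; exact h.mem u hea)
    (by
      rw [s₄.comp, s₄.img, s₄.tab, g₄.1, g₄.2.1, f₄.1]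
      exact fun p hp b hb hc => h.dist_cell_le hρ hε1 hd0.le hnet hea hb hc hp)
    (by
      intro w hw
      rw [g₄.2.2.2, g₄.2.2.1]
      rw [Finset.mem_Ico] at hw
      exact hbk w (Finset.mem_Ico.2 (by omega)))
  rw [s₄.comp, s₄.img, s₄.tab, g₄.1, g₄.2.1, g₄.2.2.1, g₄.2.2.2, f₄.1, f₄.2.2.1, ← hb] at hthin
  refine hthin.mono ?_
  rintro t₅ m₅ hs₅ ⟨ht₅, hK, hbk₅⟩
  have s₅ : SameData m m₅ := s₄.trans ⟨hs₅.N _ rfl, hs₅.N _ rfl, hs₅.N _ rfl, hs₅.N _ rfl,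
    hs₅.N _ rfl, hs₅.N _ rfl, hs₅.N _ rfl, hs₅.L _ rfl, hs₅.R _ rfl, hs₅.R _ rfl, hs₅.R _ rfl⟩
  have f₅ : m₅.N .cen = cen ∧ m₅.L .fr = fr ∧ m₅.R .s = s ∧ m₅.N .ca 0 = ca ∧
      m₅.N .cb 0 = cb := by
    rw [hs₅.N .cen rfl, hs₅.L .fr rfl, hs₅.R .s rfl, hs₅.N .ca rfl, hs₅.N .cb rfl]
    exact f₄
  simp only [s₅.eb, s₅.n, ← hv, f₅.2.2.2.2, hmn]
  set m₆ := ((m₅.setN .c0 0 cb).setN .a0 0 v).setN .off 0 n with hm₆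
  have s₆ : SameData m m₆ := s₅.trans (by constructor <;> simp [hm₆])
  have f₆ : m₆.N .cen = cen ∧ m₆.L .fr = fr ∧ m₆.R .s = s ∧ m₆.N .ca 0 = ca ∧
    m₆.N .cb 0 = cb := by simpa [hm₆] using f₅
  have g₆ : m₆.N .c0 0 = cb ∧ m₆.N .a0 0 = v ∧ m₆.N .off 0 = n ∧ m₆.L .bk = m₅.L .bk := by
    simp [hm₆]
  clear_value m₆
  -- With offset `n` the second family occupies the buckets `n + 1, …, 2 * n`, which the first
  -- thinning left empty.
  have hthin' := wp_thin (q := q) (m := m₆) hY hB (by rw [s₆.k, hmk])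
    (by rw [f₆.2.2.1]; exact hs0.le)
    (R := 2 * (ρ * (2 ^ k * d))) (e := e) (by rw [f₆.2.2.1]; exact hRs)
    (by rw [f₆.1]; exact hnet.mem) (by rw [g₆.2.1]; exact heb)
    (by rw [s₆.comp, g₆.1, g₆.2.1])
    (by rw [s₆.comp, s₆.img, s₆.tab, g₆.1]; exact h.mem v heb)
    (by
      rw [s₆.comp, s₆.img, s₆.tab, g₆.1, g₆.2.1, f₆.1]
      exact fun p hp b hb hc => h.dist_cell_le hρ hε1 hd0.le hnet heb hb hc hp)
    (by
      intro w hw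
      rw [Finset.mem_Ico] at hw
      rw [g₆.2.2.2, g₆.2.2.1, hbk₅ _ fun w' hw' => by rw [Finset.mem_Ico] at hw'; omega]
      exact hbk _ (Finset.mem_Ico.2 (by omega)))
  rw [s₆.comp, s₆.img, s₆.tab, g₆.1, g₆.2.1, g₆.2.2.1, g₆.2.2.2, f₆.1, f₆.2.2.1, ← hb] at hthin'
  refine hthin'.mono ?_
  rintro t₇ m₇ hs₇ ⟨ht₇, hK', hbk₇⟩
  have s₇ : SameData m m₇ := s₆.trans ⟨hs₇.N _ rfl, hs₇.N _ rfl, hs₇.N _ rfl, hs₇.N _ rfl,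
    hs₇.N _ rfl, hs₇.N _ rfl, hs₇.N _ rfl, hs₇.L _ rfl, hs₇.R _ rfl, hs₇.R _ rfl, hs₇.R _ rfl⟩
  have f₇ : m₇.N .cen = cen ∧ m₇.L .fr = fr ∧ m₇.R .s = s ∧ m₇.N .ca 0 = ca ∧
      m₇.N .cb 0 = cb := by
    rw [hs₇.N .cen rfl, hs₇.L .fr rfl, hs₇.R .s rfl, hs₇.N .ca rfl, hs₇.N .cb rfl]
    exact f₆
  have hbk' : ∀ w ∈ Finset.Ico 1 (n + 1), m₇.L .bk w = m₅.L .bk w := fun w hw => by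
    rw [Finset.mem_Ico] at hw
    exact hbk₇ w fun w' hw' => by rw [Finset.mem_Ico] at hw'; omega
  have hlen : ∀ w ∈ Finset.Ico 1 (n + 1), (m₅.L .bk w).length ≤ b := fun w hw => by
    rw [hb]
    exact hK.length_le hB hs0.le hRs
      (fun p hp b hb hc => h.dist_cell_le hρ hε1 hd0.le hnet hea hb hc hp) hw
  have hlen' : ∀ w ∈ Finset.Ico 1 (n + 1), (m₇.L .bk (w + n)).length ≤ b := fun w hw => by
    rw [hb]
    exact hK'.length_le hB hs0.le hRs
      (fun p hp b hb hc => h.dist_cell_le hρ hε1 hd0.le hnet heb hb hc hp) hw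
  have hcomb := wp_combine (q := q) (m := m₇) hY (k := k) (n := n) (ρ := (1 + ε) * ρ)
    (l := m.L .tab ca) (l' := m.L .tab cb) (b := b) (f := B ^ 3)
    (by rw [s₇.k, hmk]) (by rw [s₇.n, hmn])
    (by simp [RE.distortion, s₇.rho, s₇.eps, hmρ, hmε])
    (by
      rw [s₇.top, s₇.comp, s₇.img, f₇.2.2.2.1]
      exact fun p hp => ⟨h.below u hea p hp, h.mem u hea p hp⟩)
    (by
      rw [s₇.top, s₇.comp, s₇.img, f₇.2.2.2.2]
      exact fun p hp => ⟨h.below v heb p hp, h.mem v heb p hp⟩)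
    (by rw [s₇.ea]; exact hea) (by rw [s₇.comp, s₇.ea, f₇.2.2.2.1])
    (fun w hw p hp => by
      rw [hbk' w hw] at hp
      exact (hK.sub w hw p hp).1)
    (fun w hw p hp => (hK'.sub w hw p hp).1)
    (fun w hw => by rw [hbk' w hw]; exact hlen w hw) hlen'
    (by rw [f₇.2.1]; exact hnet.mem_of_mem_fr) (by rw [f₇.2.1]; exact hnet.length_le)
  rw [s₇.comp, s₇.img, s₇.top, s₇.ea, f₇.2.1, f₇.2.2.2.1, f₇.2.2.2.2] at hcomb
  refine hcomb.mono ?_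
  rintro t₈ m₈ hs₈ ⟨ht₈, hC⟩
  have c1 : m₈.N .comp = m.N .comp := (hs₈.N .comp rfl).trans s₇.comp
  have c2 : m₈.L .tab = m.L .tab := (hs₈.L .tab rfl).trans s₇.tab
  have c3 : m₈.N .ca 0 = ca := (congrFun (hs₈.N .ca rfl) 0).trans f₇.2.2.2.1
  have c4 : m₈.N .cb 0 = cb := (congrFun (hs₈.N .cb rfl) 0).trans f₇.2.2.2.2
  have c5 : m₈.N .k 0 = k := (congrFun (hs₈.N .k rfl) 0).trans (by rw [s₇.k, hmk])
  simp only [wp_setL, NE.eval, LE.eval, c3]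
  refine (wp_forTo (fun j m' => (∀ a < j, m'.N .comp a = if m.N .comp a = cb then ca
      else m.N .comp a) ∧ ∀ a, j ≤ a → m'.N .comp a = m.N .comp a) 0 k 2 rfl rfl
    (fun m' hs => by simp [hs.N .k rfl, c5]) (by omega) (by simp [c1]) ?_).mono ?_
  · rintro j m' hs hj hj' ha ⟨hI, hI'⟩
    have d1 : m'.N .ca 0 = ca := (congrFun (hs.N .ca rfl) 0).trans (by simpa using c3)
    have d2 : m'.N .cb 0 = cb := (congrFun (hs.N .cb rfl) 0).trans (by simpa using c4)
    simp only [wp_ite, wp_setN, wp_skip, BE.Holds, NE.eval, ha, d1, d2, hI' j le_rfl,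
      ← le_antisymm_iff]
    refine ⟨fun hc => ⟨le_rfl, fun a ha' => ?_, fun a ha' => ?_⟩,
      fun hc => ⟨le_rfl, fun a ha' => ?_, fun a ha' => ?_⟩⟩
    · rcases Nat.lt_succ_iff_lt_or_eq.1 ha' with ha' | rfl
      · simpa [ha'.ne] using hI a ha'
      · simp [hc]
    · have : a ≠ j := by omega
      simpa [this] using hI' a (by omega)
    · rcases Nat.lt_succ_iff_lt_or_eq.1 ha' with ha' | rfl
      · simpa using hI a ha'
      · simpa [hc] using hI' a le_rfl
    · simpa using hI' a (by omega)
  · rintro t₉ m₉ hs₉ ⟨ht₉, hcomp, -⟩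
    have e1 : m₉.N .img = m₈.N .img := (hs₉.N .img rfl).trans (by simp)
    have e2 : m₉.N .top = m₈.N .top := (hs₉.N .top rfl).trans (by simp)
    have e3 : m₉.L .tab = Function.update (m.L .tab) ca (m₈.L .res 0) :=
      (hs₉.L .tab rfl).trans (by simp [c2])
    constructor
    · have hl₁ := h.length_le u hea
      have hl₂ := h.length_le v heb
      have ht₅' : t₅ ≤ thinTime k (n * (b * (B ^ 3 * b))) b := by
        refine ht₅.trans ?_
        unfold thinTime
        gcongr
      have ht₇' : t₇ ≤ thinTime k (n * (b * (B ^ 3 * b))) b := by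
        refine ht₇.trans ?_
        unfold thinTime
        gcongr
      simp only [mergeTime, netTime]
      omega
    · rw [e1, e2, e3]
      refine h.merge hρ hε hε1 hX hea heb hne hd.symm hd0 hnet hK hK' (hC.mono ?_ le_rfl) hcomp
        fun c => by rw [Function.update_apply]
      rintro ⟨x, x'⟩ ⟨w, hw, hx, z, hz, hx'⟩
      obtain hxm := (hK.sub w hw x hx).1
      have hzm := hnet.mem_of_mem_fr _ (h.mem u hea x hxm u hea rfl) z hz
      exact ⟨w, hw, by rw [hbk' w hw]; exact hx, z, hz, hx'⟩

/-- The bound for the running time of the algorithm. -/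
def solveTime (n k B L b : ℕ) : ℕ :=
  k * (n * 6 + 7) + k * (mergeTime n k B L b + (k * (k * 8 + 4) + 4) + 2) + k * (k * 8 + 4) +
    k * 3 + 15

/-- The memory reports a matching of distortion `(1 + ε) * ρ`, or there is none of distortion
`ρ`. -/
def IsSolution (xp : ℕ → X) (pt : ℕ → Y) (n k : ℕ) (ρ ε : ℝ) (m : Mem) : Prop :=
  (m.N .flag 0 = 1 ∧ ∃ σ : ℕ → ℕ, (∀ a < k, σ a ∈ Finset.Ico 1 (n + 1) ∧ m.out a = σ a - 1) ∧
    ∀ a < k, ∀ b < k,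
      1 / ((1 + ε) * ρ) * dist (xp a) (xp b) ≤ dist (pt (σ a)) (pt (σ b)) ∧
      dist (pt (σ a)) (pt (σ b)) ≤ (1 + ε) * ρ * dist (xp a) (xp b)) ∨
  (m.N .flag 0 = 0 ∧ ¬ ∃ τ : X → Y, IsDistortionMatching ρ τ)

/-- All points are in one component, so soundness of the table makes any entry a solution, while
completeness turns an empty table into a proof that no `ρ`-matching exists. -/
lemma wp_report {d : ℝ} (hk : m.N .k 0 = k) (hk1 : 1 ≤ k) (hq : k ≤ q)
    (hcomp : ∀ a < k, ∀ b < k, m.N .comp a = m.N .comp b)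
    (h : IsTable xp pt n k ρ ε N i d (m.N .comp) (m.N .img) (m.N .top 0) (m.L .tab)) :
    wp o q report m fun t m' => t ≤ k * 3 + 6 ∧ IsSolution xp pt n k ρ ε m' := by
  simp only [report, wp_ite, wp_blk_cons, wp_blk_nil, wp_setN, wp_setL, BE.Holds, NE.eval,
    LE.eval]
  refine ⟨fun hnil => ⟨by omega, .inr ⟨by simp, ?_⟩⟩, fun hne => ?_⟩
  · rintro ⟨τ, hτ⟩
    obtain ⟨p, hp, -⟩ := h.complete τ hτ 0 hk1
    rw [hnil] at hp
    simp at hp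
  · obtain ⟨p, l, hl⟩ := List.exists_cons_of_ne_nil hne
    have hp : p ∈ m.L .tab (m.N .comp 0) := by simp [hl]
    refine (wp_forTo (fun j m' => ∀ a < j, m'.out a = m.N .img (p + a) - 1) 0 k 1 rfl rfl
      (fun m' hs => by simp [hs.N .k rfl, hk]) (by omega) (by simp) ?_).mono ?_
    · intro j m' hs hj hj' ha hI
      have e1 : m'.N .img = m.N .img := hs.N .img rfl
      have e2 : m'.L .l1 0 = p :: l := (congrFun (hs.L .l1 rfl) 0).trans (by simpa using hl)
      simp only [wp_out, NE.eval, ha, e1, e2, List.headD_cons]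
      refine ⟨by omega, le_rfl, fun a ha' => ?_⟩
      rcases Nat.lt_succ_iff_lt_or_eq.1 ha' with ha' | rfl
      · simpa [ha'.ne] using hI a ha'
      · simp
    · rintro t m' - ⟨ht, hout⟩
      have ht' : t ≤ k * 3 + 2 := ht
      refine ⟨by omega, .inl ⟨by simp, fun a => m.N .img (p + a), fun a ha => ⟨?_, ?_⟩, ?_⟩⟩
      · exact h.mem 0 hk1 p hp a ha (hcomp a ha 0 hk1)
      · simpa using hout a ha
      · exact fun a ha b hb => h.sound 0 hk1 p hp a ha b hb (hcomp a ha 0 hk1) (hcomp b hb 0 hk1)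

lemma wp_solve (hY : Represents o.distY pt n) (hB : IsDoublingConst Y B)
    (hsurj : ∀ y : Y, ∃ j ∈ Finset.Ico 1 (n + 1), pt j = y)
    (hX : ∀ a < k, ∀ b < k, o.distX a b = dist (xp a) (xp b))
    (hxp : ∀ a < k, ∀ b < k, xp a = xp b → a = b)
    (hρ : 1 ≤ ρ) (hε : 0 < ε) (hε1 : ε ≤ 1) (hk1 : 1 ≤ k) (hn1 : 1 ≤ n)
    (hD : ∀ y ∈ Finset.Ico 1 (n + 1), ∀ z ∈ Finset.Ico 1 (n + 1), dist (pt y) (pt z) ≤ D)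
    (hr : ∀ y ∈ Finset.Ico 1 (n + 1), ∀ z ∈ Finset.Ico 1 (n + 1), y ≠ z →
      r ≤ dist (pt y) (pt z))
    (hL : ∀ i : ℕ, 2 ^ i * r ≤ 2 * D → i < L)
    (he : 2 ^ (k + 4) * k * ρ ^ 2 / ε ≤ (2 : ℝ) ^ e) (hb : b = (B ^ e) ^ k) :
    wp o (k + 1) solve (initialMem k n ρ ε) fun t m =>
      t ≤ solveTime n k B L b ∧ IsSolution xp pt n k ρ ε m := by
  have hB1 : 1 ≤ B := by
    have : Nonempty Y := ⟨pt 0⟩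
    exact hB.pos
  have hb1 : 1 ≤ b := by rw [hb]; exact Nat.pow_pos (Nat.pow_pos hB1)
  set N := n * (b * (B ^ 3 * b)) with hN
  have hnN : n ≤ N := Nat.le_mul_of_pos_right _ (by positivity)
  simp only [solve, wp_blk_cons, wp_blk_nil]
  refine (wp_initTables (N := N) (k := k) (n := n) rfl rfl hnN hsurj xp ρ ε).mono ?_
  rintro t₁ m₁ hs₁ ⟨ht₁, h₁⟩
  have hk₁ : m₁.N .k 0 = k := congrFun (hs₁.N .k rfl) 0
  have hn₁ : m₁.N .n 0 = n := congrFun (hs₁.N .n rfl) 0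
  have hρ₁ : m₁.R .rho = ρ := hs₁.R .rho rfl
  have hε₁ : m₁.R .eps = ε := hs₁.R .eps rfl
  refine (wp_findPair hk₁).mono ?_
  rintro t₂ m₂ hs₂ ⟨ht₂, hc₂⟩
  have hk₂ : m₂.N .k 0 = k := (congrFun (hs₂.N .k rfl) 0).trans hk₁
  have hn₂ : m₂.N .n 0 = n := (congrFun (hs₂.N .n rfl) 0).trans hn₁
  have hρ₂ : m₂.R .rho = ρ := (hs₂.R .rho rfl).trans hρ₁
  have hε₂ : m₂.R .eps = ε := (hs₂.R .eps rfl).trans hε₁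
  rw [← hs₂.N .comp rfl, ← hs₂.N .img rfl, ← hs₂.N .top rfl, ← hs₂.L .tab rfl] at h₁
  -- The counter `i` is the number of merges, which `IsTable.succ_lt` bounds by `k`. The distance
  -- `d` is quantified away because it changes from round to round.
  refine (wp_while (fun i m => (∃ d, IsTable xp pt n k ρ ε N i d (m.N .comp) (m.N .img)
    (m.N .top 0) (m.L .tab)) ∧ IsClosest o.distX k m fun a b => a < k ∧ b < k) k
    (mergeTime n k B L b + (k * (k * 8 + 4) + 4) + 1) ⟨⟨0, h₁⟩, hc₂⟩ ?_).mono ?_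
  · rintro i m₃ hs₃ ⟨⟨d, h⟩, hc⟩ hgo
    have hk₃ : m₃.N .k 0 = k := (congrFun (hs₃.N .k rfl) 0).trans hk₂
    have hn₃ : m₃.N .n 0 = n := (congrFun (hs₃.N .n rfl) 0).trans hn₂
    have hρ₃ : m₃.R .rho = ρ := (hs₃.R .rho rfl).trans hρ₂
    have hε₃ : m₃.R .eps = ε := (hs₃.R .eps rfl).trans hε₂
    simp only [BE.Holds, NE.eval] at hgo
    rcases hc with ⟨h0, -⟩ | ⟨-, hea, heb, hne, hd, hmin⟩
    · omega
    rw [hX _ hea _ heb] at hd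
    -- The old separation shows that the new closest distance is no smaller than the previous one;
    -- its minimality is the new separation.
    have hstep := h.mono hρ hε (d' := m₃.R .d) (by rw [hd]; exact h.sep _ hea _ heb hne)
      fun a ha b hb hab => by
        rw [← hX a ha b hb]
        exact hmin a b ⟨ha, hb⟩ hab
    refine ⟨by have := h.succ_lt hea heb hne; omega, ?_⟩
    simp only [wp_blk_cons, wp_blk_nil]
    refine (wp_mergeStep hY hB hX hxp hρ hε hε1 hn1 hD hr hL he hb hk₃ hn₃ hρ₃ hε₃ hstep hea heb
      hne hd).mono ?_
    rintro t₄ m₄ hs₄ ⟨ht₄, h₄⟩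
    have hk₄ : m₄.N .k 0 = k := (congrFun (hs₄.N .k rfl) 0).trans hk₃
    refine (wp_findPair hk₄).mono ?_
    rintro t₅ m₅ hs₅ ⟨ht₅, hc₅⟩
    refine ⟨by omega, ⟨m₃.R .d, ?_⟩, hc₅⟩
    rw [hs₅.N .comp rfl, hs₅.N .img rfl, hs₅.N .top rfl, hs₅.L .tab rfl]
    exact h₄
  · rintro t₃ m₃ hs₃ ⟨ht₃, hgo, i, ⟨d, h⟩, hc⟩
    have hk₃ : m₃.N .k 0 = k := (congrFun (hs₃.N .k rfl) 0).trans hk₂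
    simp only [BE.Holds, NE.eval] at hgo
    have hcomp : ∀ a < k, ∀ b < k, m₃.N .comp a = m₃.N .comp b := by
      rcases hc with ⟨-, hc⟩ | ⟨h0, -⟩
      · exact fun a ha b hb => hc a b ⟨ha, hb⟩
      · omega
    refine (wp_report hk₃ hk1 (Nat.le_succ k) hcomp h).mono ?_
    rintro t₄ m₄ - ⟨ht₄, hsol⟩
    refine ⟨?_, hsol⟩
    have ht₃' : t₃ ≤ k * (mergeTime n k B L b + (k * (k * 8 + 4) + 4) + 2) + 1 := ht₃
    rw [solveTime]
    omega

end ListMachine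

/-! ### The running time -/

namespace ListMachine

/-- Every part of a merge except the net is compared with `B ^ 5 * k ^ 2 * n * b ^ 3`, which absorbs
lower-order terms because all factors are at least `1`. Here `b ^ 3` is `b ^ 2` from the table
length times `b` from scanning a bucket. -/
lemma thinTime_le {n k B b : ℕ} (hk : 1 ≤ k) (hB : 1 ≤ B) (hb : 1 ≤ b) (hn : 1 ≤ n) :
    thinTime k (n * (b * (B ^ 3 * b))) b ≤ 26 * (B ^ 5 * (k ^ 2 * (n * b ^ 3))) := by
  have h1 : b * (4 * k + 10) + 10 ≤ 24 * (b * k) := by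
    have : 1 ≤ b * k := Nat.mul_pos hb hk
    have : b ≤ b * k := Nat.le_mul_of_pos_right _ hk
    linarith [mul_add b (4 * k) 10, mul_left_comm b 4 k]
  have h2 : 1 ≤ B ^ 5 * (k ^ 2 * (n * b ^ 3)) := Nat.succ_le_of_lt (by positivity)
  have h3 : n * (b * (B ^ 3 * b)) * (24 * (b * k)) ≤ 24 * (B ^ 5 * (k ^ 2 * (n * b ^ 3))) := by
    calc _ = 24 * (B ^ 3 * (k ^ 1 * (n * b ^ 3))) := by ring
      _ ≤ _ := by gcongr <;> omega
  calc thinTime k (n * (b * (B ^ 3 * b))) b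
      ≤ n * (b * (B ^ 3 * b)) * (24 * (b * k)) + 2 := by unfold thinTime; gcongr
    _ ≤ _ := by omega

lemma combineTime_le {n k B b : ℕ} (hk : 1 ≤ k) (hB : 1 ≤ B) (hb : 1 ≤ b) (hn : 1 ≤ n) :
    combineTime n k b (B ^ 3) ≤ 41 * (B ^ 5 * (k ^ 2 * (n * b ^ 3))) := by
  have hk2 : k ≤ k ^ 2 := Nat.le_self_pow two_ne_zero k
  have h1 : k * (k * 4 + 8) + 13 ≤ 25 * k ^ 2 := by nlinarith
  have h2 : b * (k * (k * 4 + 8) + 13) + 4 ≤ 29 * (b * k ^ 2) := by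
    have : 1 ≤ b * k ^ 2 := Nat.succ_le_of_lt (by positivity)
    linarith [Nat.mul_le_mul_left b h1, mul_left_comm b 25 (k ^ 2)]
  have h3 : B ^ 3 * (b * (k * (k * 4 + 8) + 13) + 4) + 4 ≤ 33 * (B ^ 3 * (b * k ^ 2)) := by
    have : 1 ≤ B ^ 3 * (b * k ^ 2) := Nat.succ_le_of_lt (by positivity)
    linarith [Nat.mul_le_mul_left (B ^ 3) h2, mul_left_comm (B ^ 3) 29 (b * k ^ 2)]
  have h4 : b * (B ^ 3 * (b * (k * (k * 4 + 8) + 13) + 4) + 4) + 4 ≤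
      37 * (b * (B ^ 3 * (b * k ^ 2))) := by
    have : 1 ≤ b * (B ^ 3 * (b * k ^ 2)) := Nat.succ_le_of_lt (by positivity)
    linarith [Nat.mul_le_mul_left b h3, mul_left_comm b 33 (B ^ 3 * (b * k ^ 2))]
  have h5 : 1 ≤ n * (b * (B ^ 3 * (b * k ^ 2))) := Nat.succ_le_of_lt (by positivity)
  calc combineTime n k b (B ^ 3) ≤ n * (37 * (b * (B ^ 3 * (b * k ^ 2)))) + 4 := by
        unfold combineTime; gcongr
    _ ≤ 41 * (n * (b * (B ^ 3 * (b * k ^ 2)))) := by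
        linarith [mul_left_comm n 37 (b * (B ^ 3 * (b * k ^ 2)))]
    _ = 41 * (B ^ 3 * (k ^ 2 * (n * b ^ 2))) := by ring
    _ ≤ _ := by gcongr <;> omega

lemma netTime_le {n B L : ℕ} (hB : 1 ≤ B) (hn : 1 ≤ n) :
    netTime n B L ≤ 30 * n + 59 * (B ^ 5 * (n * L)) := by
  have h1 : 2 * (B ^ 3 * (B ^ 2 * 4 + 4)) + 30 ≤ 46 * B ^ 5 := by
    have : B ^ 3 ≤ B ^ 5 := Nat.pow_le_pow_right hB (by omega)
    have : 1 ≤ B ^ 5 := Nat.pow_pos hB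
    have : B ^ 3 * B ^ 2 = B ^ 5 := by ring
    linarith [mul_add (B ^ 3) (B ^ 2 * 4) 4, mul_assoc (B ^ 3) (B ^ 2) 4]
  have h2 : n * (2 * (B ^ 3 * (B ^ 2 * 4 + 4)) + 30) + 13 ≤ 59 * (B ^ 5 * n) := by
    have : 1 ≤ B ^ 5 * n := Nat.mul_pos (Nat.pow_pos hB) hn
    linarith [Nat.mul_le_mul_left n h1, mul_left_comm n 46 (B ^ 5), mul_comm n (B ^ 5)]
  calc netTime n B L ≤ n * 10 + 20 + L * (59 * (B ^ 5 * n)) := by unfold netTime; gcongr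
    _ = n * 10 + 20 + 59 * (B ^ 5 * (n * L)) := by ring
    _ ≤ _ := by omega

lemma mergeTime_le {n k B L b : ℕ} (hk : 1 ≤ k) (hB : 1 ≤ B) (hb : 1 ≤ b) (hn : 1 ≤ n) :
    mergeTime n k B L b ≤ 153 * (B ^ 5 * (k ^ 2 * (n * b ^ 3))) + 59 * (B ^ 5 * (n * L)) := by
  have h1 := thinTime_le hk hB hb hn
  have h2 := combineTime_le hk hB hb hn
  have h3 := netTime_le (L := L) hB hn
  have hn' : n ≤ B ^ 5 * (k ^ 2 * (n * b ^ 3)) :=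
    calc n ≤ (B ^ 5 * k ^ 2 * b ^ 3) * n := Nat.le_mul_of_pos_left _ (by positivity)
      _ = _ := by ring
  have hk' : k ≤ B ^ 5 * (k ^ 2 * (n * b ^ 3)) :=
    calc k ≤ (B ^ 5 * k * n * b ^ 3) * k := Nat.le_mul_of_pos_left _ (by positivity)
      _ = _ := by ring
  unfold mergeTime
  omega

/-- The two terms are kept apart since they become the two summands of the theorem: the work on
tables and the work on nets. -/
lemma solveTime_le {n k B L b : ℕ} (hk : 1 ≤ k) (hB : 1 ≤ B) (hb : 1 ≤ b) (hn : 1 ≤ n) :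
    solveTime n k B L b + 1 ≤
      300 * (B ^ 5 * (k ^ 3 * (n * b ^ 3))) + 59 * (B ^ 5 * (k * (n * L))) := by
  have h1 := Nat.mul_le_mul_left k (mergeTime_le (L := L) hk hB hb hn)
  have hP : 1 ≤ B ^ 5 * n * b ^ 3 := Nat.succ_le_of_lt (by positivity)
  have hkn : k * n ≤ B ^ 5 * (k ^ 3 * (n * b ^ 3)) :=
    calc k * n ≤ (B ^ 5 * k ^ 2 * b ^ 3) * (k * n) := Nat.le_mul_of_pos_left _ (by positivity)
      _ = _ := by ring
  have hk3 : k ^ 3 ≤ B ^ 5 * (k ^ 3 * (n * b ^ 3)) :=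
    calc k ^ 3 ≤ (B ^ 5 * n * b ^ 3) * k ^ 3 := Nat.le_mul_of_pos_left _ (by positivity)
      _ = _ := by ring
  have hk2 : k ^ 2 ≤ k ^ 3 := Nat.pow_le_pow_right hk (by omega)
  have hk1 : k ≤ k ^ 2 := Nat.le_self_pow two_ne_zero k
  have e : solveTime n k B L b = 6 * (k * n) + k * mergeTime n k B L b + 8 * k ^ 3 + 12 * k ^ 2 +
      20 * k + 15 := by unfold solveTime; ring
  have e2 : k * (153 * (B ^ 5 * (k ^ 2 * (n * b ^ 3))) + 59 * (B ^ 5 * (n * L))) =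
      153 * (B ^ 5 * (k ^ 3 * (n * b ^ 3))) + 59 * (B ^ 5 * (k * (n * L))) := by ring
  rw [e2] at h1
  omega

end ListMachine

/-! ### Real estimates of the running time -/

lemma HasDoublingDimension.nonneg {S : Type*} [MetricSpace S] [Nonempty S] {δ : ℝ}
    (h : HasDoublingDimension S δ) : 0 ≤ δ := by
  have h1 : (1 : ℝ) ≤ (2 : ℝ) ^ δ := by
    have := h.isDoublingConst.pos
    exact (Nat.one_le_floor_iff _).1 this
  by_contra! hδ
  exact absurd (Real.rpow_lt_one_of_one_lt_of_neg one_lt_two hδ) (not_lt.2 h1)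

/-- Converts factors `2 ^ O(k ^ 2)` into the form of the theorem. The summand `1` is needed for `k =
1`, where the logarithm vanishes, and goes into the constant. -/
lemma sq_le_one_add_sq_mul_logb {k : ℕ} (hk : 1 ≤ k) :
    (k : ℝ) ^ 2 ≤ 1 + (k : ℝ) ^ 2 * Real.logb 2 k := by
  rcases hk.eq_or_lt with rfl | hk
  · simp
  · have : 1 ≤ Real.logb 2 k := by
      rw [Real.le_logb_iff_rpow_le one_lt_two (by positivity)]
      simpa using (show (2 : ℝ) ≤ k by exact_mod_cast hk)
    nlinarith [sq_nonneg (k : ℝ)]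

/-- `2 ^ e` exceeds the required value by at most a factor `2`, and `k ≤ 2 ^ k` turns `2 ^ (k + 4) *
k` into a power of `2`. -/
lemma exists_pow_near {k : ℕ} {q : ℝ} (hk : 1 ≤ k) (hq : 1 ≤ q) :
    ∃ e : ℕ, 2 ^ (k + 4) * k * q ≤ (2 : ℝ) ^ e ∧ (2 : ℝ) ^ e ≤ 2 ^ (2 * k + 5) * q := by
  have hk' : (1 : ℝ) ≤ k := by exact_mod_cast hk
  have h1 : (1 : ℝ) ≤ 2 ^ (k + 4) * k * q :=
    one_le_mul_of_one_le_of_one_le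
      (one_le_mul_of_one_le_of_one_le (one_le_pow₀ one_le_two) hk') hq
  obtain ⟨e, he, he'⟩ := exists_nat_pow_near h1 one_lt_two
  refine ⟨e + 1, he'.le, ?_⟩
  have hk2 : (k : ℝ) ≤ 2 ^ k := by exact_mod_cast Nat.lt_two_pow_self.le
  calc (2 : ℝ) ^ (e + 1) = 2 * 2 ^ e := pow_succ' _ _
    _ ≤ 2 * (2 ^ (k + 4) * 2 ^ k * q) := by
        gcongr
        exact he.trans (by gcongr)
    _ = _ := by ring

/-- The number of entries of the tables, in terms of the input. -/
lemma table_bound {B e k : ℕ} {q δ D : ℝ} (hB : (B : ℝ) ≤ 2 ^ δ) (hδ : 0 ≤ δ) (hD : δ ≤ D)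
    (hq : 1 ≤ q) (hk : 1 ≤ k) (he : (2 : ℝ) ^ e ≤ 2 ^ (2 * k + 5) * q) :
    (k : ℝ) ^ 3 * (((B ^ e) ^ k : ℕ) : ℝ) ^ 3 ≤
      2 ^ (3 + 21 * D) * 2 ^ ((3 + 21 * D) * ((k : ℝ) ^ 2 * Real.logb 2 k)) *
        q ^ (3 * (k : ℝ) * δ) := by
  have hq0 : 0 ≤ q := by linarith
  have hk1 : (1 : ℝ) ≤ k := by exact_mod_cast hk
  have hD0 : 0 ≤ D := hδ.trans hD
  have h1 : (B : ℝ) ^ e ≤ (2 ^ (2 * k + 5) * q) ^ δ :=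
    calc (B : ℝ) ^ e ≤ ((2 : ℝ) ^ δ) ^ e := by gcongr
      _ = ((2 : ℝ) ^ e) ^ δ := by
          rw [← Real.rpow_natCast, ← Real.rpow_mul zero_le_two, mul_comm,
            Real.rpow_mul zero_le_two, Real.rpow_natCast]
      _ ≤ _ := by gcongr
  -- The factor in `q` has exactly the exponent of the theorem; everything else is a power of `2`
  -- with exponent quadratic in `k`.
  have h2 : (((B ^ e) ^ k : ℕ) : ℝ) ^ 3 ≤
      2 ^ ((2 * (k : ℝ) + 5) * δ * (3 * k)) * q ^ (3 * (k : ℝ) * δ) :=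
    calc (((B ^ e) ^ k : ℕ) : ℝ) ^ 3 = ((B : ℝ) ^ e) ^ (3 * k) := by
          push_cast; rw [← pow_mul, mul_comm k 3]
      _ ≤ ((2 ^ (2 * k + 5) * q) ^ δ) ^ (3 * k) := by gcongr
      _ = _ := by
          rw [Real.mul_rpow (by positivity) hq0, mul_pow, ← Real.rpow_natCast,
            ← Real.rpow_natCast (q ^ δ), ← Real.rpow_natCast 2, ← Real.rpow_mul zero_le_two,
            ← Real.rpow_mul zero_le_two, ← Real.rpow_mul hq0]
          push_cast
          rw [mul_comm δ]
  have h3 : (k : ℝ) ^ 3 ≤ 2 ^ (3 * (k : ℝ)) := by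
    rw [mul_comm, Real.rpow_mul zero_le_two, Real.rpow_natCast]
    have : (k : ℝ) ≤ 2 ^ k := by exact_mod_cast Nat.lt_two_pow_self.le
    calc (k : ℝ) ^ 3 ≤ (2 ^ k) ^ 3 := by gcongr
      _ = _ := by norm_cast
  calc (k : ℝ) ^ 3 * (((B ^ e) ^ k : ℕ) : ℝ) ^ 3
      ≤ 2 ^ (3 * (k : ℝ)) * (2 ^ ((2 * (k : ℝ) + 5) * δ * (3 * k)) * q ^ (3 * (k : ℝ) * δ)) := by
        gcongr
    _ = 2 ^ (3 * (k : ℝ) + (2 * (k : ℝ) + 5) * δ * (3 * k)) * q ^ (3 * (k : ℝ) * δ) := by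
        rw [Real.rpow_add two_pos]; ring
    _ ≤ 2 ^ ((3 + 21 * D) * (1 + (k : ℝ) ^ 2 * Real.logb 2 k)) * q ^ (3 * (k : ℝ) * δ) := by
        gcongr
        · exact one_le_two
        -- Since `k ≥ 1`, replacing `3 * k` by `3 * k ^ 2` and `5` by `5 * k` makes the exponent a
        -- multiple of `k ^ 2`.
        calc 3 * (k : ℝ) + (2 * (k : ℝ) + 5) * δ * (3 * k)
            ≤ 3 * ((k : ℝ) * k) + (2 * (k : ℝ) + 5 * k) * D * (3 * k) := by
              gcongr
              · exact le_mul_of_one_le_left (by linarith) hk1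
              · linarith
          _ = (3 + 21 * D) * (k : ℝ) ^ 2 := by ring
          _ ≤ _ := by gcongr; exact sq_le_one_add_sq_mul_logb hk
    _ = _ := by rw [mul_add, mul_one, Real.rpow_add two_pos]

/-- The scales that matter in a finite metric space are few. -/
lemma exists_scales {Y : Type*} [MetricSpace Y] [Finite Y] : ∃ (r D : ℝ) (L : ℕ),
    (∀ y z : Y, dist y z ≤ D) ∧ (∀ y z : Y, y ≠ z → r ≤ dist y z) ∧
    (∀ i : ℕ, 2 ^ i * r ≤ 2 * D → i < L) ∧ (L : ℝ) ≤ Real.logb 2 (spread Y) + 2 ∧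
    0 ≤ Real.logb 2 (spread Y) := by
  have hdist : ∀ y z : Y, dist y z ≤ Metric.diam (Set.univ : Set Y) := fun y z =>
    Metric.dist_le_diam_of_mem Set.finite_univ.isBounded trivial trivial
  rcases subsingleton_or_nontrivial Y with hY | hY
  · have h0 : Real.logb 2 (spread Y) = 0 := by
      simp [spread, Metric.diam_subsingleton (Set.subsingleton_univ (α := Y))]
    -- For a single point any positive lower bound will do: with diameter zero no `i` satisfies the
    -- inequality.
    refine ⟨1, 0, 2, fun y z => ?_, fun y z h => absurd (Subsingleton.elim y z) h, fun i hi => ?_,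
      by rw [h0]; norm_num, h0.ge⟩
    · rw [Subsingleton.elim y z, dist_self]
    · have : (0 : ℝ) < 2 ^ i * 1 := by positivity
      linarith
  · have hfin : (Set.univ : Set Y).Finite := Set.finite_univ
    have hpos : 0 < Set.infsep (Set.univ : Set Y) :=
      hfin.infsep_pos_iff_nontrivial.2 Set.nontrivial_univ
    have hle : ∀ y z : Y, y ≠ z → Set.infsep (Set.univ : Set Y) ≤ dist y z := fun y z h =>
      Set.infsep_le_dist_of_mem trivial trivial h
    obtain ⟨y, z, hyz⟩ := exists_pair_ne Y
    have hs : 1 ≤ spread Y := (one_le_div hpos).2 ((hle y z hyz).trans (hdist y z))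
    have hlog : 0 ≤ Real.logb 2 (spread Y) := Real.logb_nonneg one_lt_two hs
    -- If `2 ^ (i + 1) * r ≤ 2 * D`, then `2 ^ i` is at most the spread. One unit of the `2` is for
    -- this shift, the other makes the bound strict.
    refine ⟨_, _, ⌊Real.logb 2 (spread Y)⌋₊ + 2, hdist, hle, fun i hi => ?_, ?_, hlog⟩
    · rcases i with - | i
      · omega
      have : (2 : ℝ) ^ i ≤ spread Y := by
        rw [spread, le_div_iff₀ hpos]
        rw [pow_succ] at hi
        linarith
      have : i ≤ ⌊Real.logb 2 (spread Y)⌋₊ := by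
        refine Nat.le_floor ?_
        rwa [Real.le_logb_iff_rpow_le one_lt_two (by linarith), Real.rpow_natCast]
      omega
    · push_cast
      linarith [Nat.floor_le hlog]

/-- `C` is a sum so that it dominates the coefficients as well as the exponent `3 + 21 * D`. The `2`
in `L ≤ s + 2` costs `118 = 2 * 59`, absorbed by the first term through `k ≤ k ^ 3 * b ^ 3`; this
gives `418 = 300 + 118`. -/
lemma time_bound {K n k B L b : ℕ} {δ D q s t : ℝ} (hk : 1 ≤ k) (hn : 1 ≤ n) (hB1 : 1 ≤ B)
    (hb1 : 1 ≤ b) (hB : (B : ℝ) ≤ 2 ^ δ) (hδ : 0 ≤ δ) (hD : δ ≤ D) (hq : 1 ≤ q)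
    (hL : (L : ℝ) ≤ s + 2) (hs : 0 ≤ s)
    (hb : (k : ℝ) ^ 3 * (b : ℝ) ^ 3 ≤
      2 ^ (3 + 21 * D) * 2 ^ ((3 + 21 * D) * ((k : ℝ) ^ 2 * Real.logb 2 k)) *
        q ^ (3 * (k : ℝ) * δ))
    (ht : t ≤ K * (ListMachine.solveTime n k B L b + 1 : ℕ)) :
    let C := 418 * K * 2 ^ (5 * D) * 2 ^ (3 + 21 * D) + (3 + 21 * D)
    t ≤ C * (2 : ℝ) ^ (C * ((k : ℝ) ^ 2 * Real.logb 2 k)) * q ^ (3 * (k : ℝ) * δ) * (n : ℝ) +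
      C * ((k : ℝ) * n * s) := by
  intro C
  have hk1 : (1 : ℝ) ≤ k := by exact_mod_cast hk
  have hb1' : (1 : ℝ) ≤ b := by exact_mod_cast hb1
  have hD0 : 0 ≤ D := hδ.trans hD
  have hA : (1 : ℝ) ≤ 2 ^ (3 + 21 * D) := Real.one_le_rpow one_le_two (by linarith)
  have hlog : 0 ≤ (k : ℝ) ^ 2 * Real.logb 2 k :=
    mul_nonneg (by positivity) (Real.logb_nonneg one_lt_two hk1)
  set W := (2 : ℝ) ^ (5 * D) with hW
  have hB5 : (B : ℝ) ^ 5 ≤ W :=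
    calc (B : ℝ) ^ 5 ≤ ((2 : ℝ) ^ δ) ^ 5 := by gcongr
      _ = 2 ^ (5 * δ) := by
          rw [← Real.rpow_natCast, ← Real.rpow_mul zero_le_two, mul_comm]; norm_num
      _ ≤ _ := by rw [hW]; gcongr; exact one_le_two
  have hsolve := ListMachine.solveTime_le (L := L) hk hB1 hb1 hn
  have hsolve' : ((ListMachine.solveTime n k B L b + 1 : ℕ) : ℝ) ≤
      300 * ((B : ℝ) ^ 5 * ((k : ℝ) ^ 3 * (n * (b : ℝ) ^ 3))) +
        59 * ((B : ℝ) ^ 5 * (k * (n * (L : ℝ)))) := by exact_mod_cast hsolve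
  have hkb : (k : ℝ) ≤ (k : ℝ) ^ 3 * (b : ℝ) ^ 3 :=
    calc (k : ℝ) = (k : ℝ) ^ 1 * 1 := by ring
      _ ≤ _ := by
        gcongr
        · norm_num
        · exact one_le_pow₀ hb1'
  set M := (k : ℝ) ^ 3 * (b : ℝ) ^ 3 with hM
  have hC1 : 418 * K * W * 2 ^ (3 + 21 * D) ≤ C := by simp only [C]; linarith
  have hC2 : 3 + 21 * D ≤ C := by
    have : 0 ≤ 418 * K * W * (2 : ℝ) ^ (3 + 21 * D) := by positivity
    simp only [C]; linarith
  have hC3 : 59 * K * W ≤ C := by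
    refine le_trans ?_ hC1
    have : 0 ≤ K * W := by positivity
    nlinarith
  calc t ≤ K * (300 * (W * ((k : ℝ) ^ 3 * (n * (b : ℝ) ^ 3))) + 59 * (W * (k * (n * (s + 2))))) := by
        refine ht.trans (mul_le_mul_of_nonneg_left (hsolve'.trans ?_) (by positivity))
        gcongr
    _ = 300 * K * W * M * n + 118 * K * W * k * n + 59 * K * W * (k * n * s) := by rw [hM]; ring
    _ ≤ 300 * K * W * M * n + 118 * K * W * M * n + C * (k * n * s) := by gcongr
    _ = 418 * K * W * M * n + C * (k * n * s) := by ring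
    _ ≤ 418 * K * W * (2 ^ (3 + 21 * D) * 2 ^ ((3 + 21 * D) * ((k : ℝ) ^ 2 * Real.logb 2 k)) *
        q ^ (3 * (k : ℝ) * δ)) * n + C * (k * n * s) := by gcongr
    _ = (418 * K * W * 2 ^ (3 + 21 * D)) * 2 ^ ((3 + 21 * D) * ((k : ℝ) ^ 2 * Real.logb 2 k)) *
        q ^ (3 * (k : ℝ) * δ) * n + C * (k * n * s) := by ring
    _ ≤ _ := by
        gcongr
        exact one_le_two

/-! ### The main theorem -/

/-- The points of a space, listed from the index `0` on. -/
def listedPoint {S : Type*} {m : ℕ} [NeZero m] (e : Fin m ≃ S) (a : ℕ) : S := e (Fin.ofNat m a)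

section ListedPoint

variable {S : Type*} {m : ℕ} [NeZero m] (e : Fin m ≃ S) {a b : ℕ}

lemma listedPoint_of_lt (ha : a < m) : listedPoint e a = e ⟨a, ha⟩ := by
  simp only [listedPoint, Fin.ofNat, Nat.mod_eq_of_lt ha]

lemma indexedDist_eq [MetricSpace S] (ha : a < m) (hb : b < m) :
    indexedDist e a b = dist (listedPoint e a) (listedPoint e b) := by
  rw [indexedDist, dif_pos ⟨ha, hb⟩, listedPoint_of_lt e ha, listedPoint_of_lt e hb]

lemma listedPoint_inj (ha : a < m) (hb : b < m) (h : listedPoint e a = listedPoint e b) :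
    a = b := by
  rw [listedPoint_of_lt e ha, listedPoint_of_lt e hb] at h
  simpa using e.injective h

end ListedPoint

theorem mainTheorem6 :
    ∃ P : RealRAM.Program, ∀ D : ℝ, ∃ C : ℝ,
      ∀ (X Y : Type*) [MetricSpace X] [MetricSpace Y] (k n : ℕ) (eX : Fin k ≃ X) (eY : Fin n ≃ Y)
        (δ ρ ε : ℝ),
        1 ≤ k → k ≤ n →
        HasDoublingDimension X δ → HasDoublingDimension Y δ → δ ≤ D →
        1 ≤ ρ → 0 < ε → ε ≤ 1 →
        SolvesDistortionWithin P eX eY ρ ε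
          (C * (2 : ℝ) ^ (C * ((k : ℝ) ^ 2 * Real.logb 2 k)) *
              (ρ ^ 2 / ε) ^ (3 * (k : ℝ) * δ) * (n : ℝ) +
            C * ((k : ℝ) * (n : ℝ) * Real.logb 2 (spread Y))) := by
  obtain ⟨K, hK⟩ := ListMachine.Cmd.exec_program ListMachine.solve
  refine ⟨ListMachine.solve.program, fun D =>
    ⟨418 * K * 2 ^ (5 * D) * 2 ^ (3 + 21 * D) + (3 + 21 * D), ?_⟩⟩
  intro X Y _ _ k n eX eY δ ρ ε hk hkn _ hY hD hρ hε hε1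
  have hn : 1 ≤ n := hk.trans hkn
  have : NeZero k := ⟨by omega⟩
  have : NeZero n := ⟨by omega⟩
  have : Nonempty Y := ⟨eY 0⟩
  have : Finite Y := Finite.of_equiv _ eY
  have hq : 1 ≤ ρ ^ 2 / ε := (one_le_div hε).2 (hε1.trans (one_le_pow₀ hρ))
  obtain ⟨e, he, he'⟩ := exists_pow_near hk hq
  obtain ⟨r, d, L, hd, hr, hL, hLs, hs⟩ := exists_scales (Y := Y)
  have hB := hY.isDoublingConst
  have hδ := hY.nonneg
  set B := ⌊(2 : ℝ) ^ δ⌋₊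
  have hB2 : (B : ℝ) ≤ 2 ^ δ := Nat.floor_le (by positivity)
  have hB1 : 1 ≤ B := hB.pos
  have hpt : ∀ {y}, y ∈ Finset.Ico 1 (n + 1) → y - 1 < n := fun h => by
    rw [Finset.mem_Ico] at h; omega
  -- The algorithm numbers the points of `Y` from `1`, the oracle from `0`.
  have hrep : Represents (indexedDist eY) (fun y => listedPoint eY (y - 1)) n :=
    { dist_eq := fun y z hy hz => indexedDist_eq eY (hpt hy) (hpt hz)
      inj := by
        intro y z hy hz h
        have := listedPoint_inj eY (hpt hy) (hpt hz) h
        rw [Finset.mem_Ico] at hy hz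
        omega }
  have hwp := ListMachine.wp_solve (o := ⟨indexedDist eX, indexedDist eY⟩)
    (pt := fun y => listedPoint eY (y - 1))
    (xp := listedPoint eX) hrep hB
    (fun y => ⟨(eY.symm y : ℕ) + 1, by simp, by
      simp [listedPoint_of_lt eY (eY.symm y).isLt]⟩)
    (fun a ha b hb => indexedDist_eq eX ha hb) (fun a ha b hb h => listedPoint_inj eX ha hb h)
    hρ hε hε1 hk hn (fun _ _ _ _ => hd _ _)
    (fun y hy z hz hyz => hr _ _ fun h => hyz (hrep.inj y z hy hz h)) hL
    (by rwa [mul_div_assoc]) rfl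
  obtain ⟨t, s, m, hex, ht, hsol, hflag, hout⟩ := hK _ k n ρ ε _ _ hk hwp
  have hb1 : 1 ≤ (B ^ e) ^ k := Nat.pow_pos (Nat.pow_pos hB1)
  refine ⟨t, s, hex, time_bound hk hn hB1 hb1 hB2 hδ hD hq hLs hs
    (table_bound hB2 hδ hD hq hk he') (by exact_mod_cast ht), ?_⟩
  rcases hsol with ⟨hf, σ, hσ, hdist⟩ | ⟨hf, hno⟩
  · refine .inl ⟨fun x => listedPoint eY (σ (eX.symm x) - 1), fun x x' => ?_,
      hflag.trans hf, fun i => ?_⟩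
    · have := hdist _ (eX.symm x).isLt _ (eX.symm x').isLt
      simpa [listedPoint_of_lt eX (Fin.isLt _)] using this
    · obtain ⟨hi, ho⟩ := hσ i i.isLt
      rw [hout i i.isLt, ho]
      simp [listedPoint_of_lt eY (hpt hi)]
  · exact .inr ⟨hflag.trans hf, hno⟩
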